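/- **Setting.** Let $N\ge 2$ and let $F_1,\dots,F_N$ be contracting similitudes of $\mathbb R^d$ with pairwise distinct fixed points $q_1,\dots,q_N$, whose self-similar set $F=\bigcup_i F_i(F)$ is connected. Write $\mathcal A=\{1,\dots,N\}$, $F_w=F_{w_1}\circ\dots\circ F_{w_n}$ for a word $w=w_1\cdots w_n$ ($F_\emptyset=\mathrm{id}$), $\mathcal C=\bigcup_{i\ne j}F_i(F)\cap F_j(F)$ and $\mathcal P=\{x\in F: F_w(x)\in\mathcal C\text{ for some nonempty word }w\}$. Assume that $\mathcal P$ is finite (p.c.f.), that every $p\in\mathcal P$ is of the form $p=F_w(q_i)$ with a (possibly empty) word $w$ and $q_i\in\mathcal P$, and that no $q_i$ lies in $\mathcal C$. For $c\in\mathcal C$ let $\rho(c)=\#\{i: c\in F_i(F)\}$, and for $l=1,\dots,\rho(c)$ fix words $w^{c,l}$ with pairwise distinct first letters and fixed points $q^c_l\in\mathcal P\cap\{q_1,\dots,q_N\}$ with $F_{w^{c,l}}(q^c_l)=c$, so that the first letters run through all $i$ with $c\in F_i(F)$. Fix $0<\alpha<1$ and put $G_i=\alpha(F_i-q_i)+q_i$.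 Let $e_{c,l}$ be the segment from $c$ to $G_{w^{c,l}}(q^c_l)$, parametrized affinely by $\xi_{c,l}:[0,1]\to e_{c,l}$, and $e^w_{c,l}=G_w(e_{c,l})$. The stretched fractal is the unique nonempty compact $K$ with $K=\bigcup_iG_i(K)\cup\bigcup_{c,l}e_{c,l}$, and its fractal part is the unique nonempty compact $\Sigma$ with $\Sigma=\bigcup_iG_i(\Sigma)$. Assume that the stretching separates the copies of the fractal part: $G_i(\Sigma)\cap G_j(\Sigma)=\emptyset$ for $i\ne j$. Let $V_0$ be the finite set of all points $G_v(q^c_l)$, where $v$ arises from $w^{c,l}$ by deleting one or more initial letters (this is $\mathcal P$ if all points of $\mathcal P$ are fixed points $q_i$). **Forms.** Let $r_0(x,y)=r_0(y,x)\in(0,\infty]$ for distinct $x,y\in V_0$, and put $1/\infty=0$, $$Q(u)=\sum_{\{x,y\}\subset V_0,\,x\neq y}\frac{(u(x)-u(y))^2}{r_0(x,y)},\qquad Q^I_\rho(u)=\sum_{c,l}\frac{(u(c)-u(G_{w^{c,l}}(q^c_l)))^2}{\rho_{c,l}}.$$ A triple $(r_0,\lambda,\rho)$ with $0<\lambda<1$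 and $\rho_{c,l}\in(0,\infty)$ is a harmonic structure if $V_0$ is connected by the pairs with $r_0<\infty$ and, with $V_1=\mathcal C\cup\bigcup_iG_i(V_0)$, for all $g:V_0\to\mathbb R$ $$Q(g)=\inf\Big\{\tfrac1\lambda\sum_iQ(f\circ G_i)+Q^I_\rho(f)\ :\ f:V_1\to\mathbb R,\ f|_{V_0}=g\Big\}.$$ Let $\mathcal R=(r_0,\lambda_i,\rho^i)_{i\ge1}$ be a regular sequence of harmonic structures, i.e. each $(r_0,\lambda_i,\rho^i)$ is a harmonic structure, $\lambda_i\le\lambda^*$ for all $i$ with some $\lambda^*<1$, and $\sup_{i,c,l}\rho^i_{c,l}<\infty$. With $\delta_n=\lambda_1\cdots\lambda_n$ let $$\mathcal E_{\mathcal R,n}(u)=\sum_{|w|=n}\frac1{\delta_n}Q(u\circ G_w)+\sum_{k=1}^n\frac1{\delta_{k-1}}\sum_{|w|=k-1}\sum_{c,l}\frac1{\rho^k_{c,l}}\int_0^1\big((u\circ G_w\circ\xi_{c,l})'\big)^2dt ,$$ $\mathcal E_{\mathcal R}(u)=\lim_n\mathcal E_{\mathcal R,n}(u)$, let $\mathcal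 D_{\mathcal R}$ be the set of all $u\in C(K)$ with $u\circ G_w\circ\xi_{c,l}\in H^1[0,1]$ for all $w,c,l$ for which this limit is finite, and let $\mathcal D^0_{\mathcal R}=\{u\in\mathcal D_{\mathcal R}:u|_{V_0}=0\}$. **Measures.** Let $\mu_\Sigma$ be the self-similar probability measure on $\Sigma$, $\mu_\Sigma=\frac1N\sum_i\mu_\Sigma\circ G_i^{-1}$. Let $0<\beta<\frac1N$, $a_{c,l}>0$ with $\sum_{c,l}a_{c,l}=1-\beta N$, and let $\mu_I$ be the sum over all $w,c,l$ of $\beta^{|w|}a_{c,l}$ times the normalized one-dimensional Lebesgue measure on $e^w_{c,l}$ (the image of Lebesgue measure on $[0,1]$ under $G_w\circ\xi_{c,l}$). For $\eta\in(0,1]$ put $\mu_\eta=\eta\mu_I+(1-\eta)\mu_\Sigma$. **Lemma.** The form $(\mathcal E_{\mathcal R},\mathcal D_{\mathcal R})$ on $L^2(K,\mu_\eta)$ and the form $(\mathcal E_{\mathcal R},\mathcal D^0_{\mathcal R})$ on $L^2(K,\mu_\eta|_{K\setminus V_0})$ have unique associated operators $-\Delta_N^{\mu_\eta,\mathcal R}$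 and $-\Delta_D^{\mu_\eta,\mathcal R}$ ($f$ lies in the domain and is mapped to $g$ if and only if $f$ is in the form domain and $\mathcal E_{\mathcal R}(f,v)=\langle g,v\rangle$ for all $v$ in the form domain). These operators are self-adjoint, and both have discrete, non-negative spectrum: the spectrum is contained in $[0,\infty)$, consists of eigenvalues of finite multiplicity, and has no finite accumulation point. -/

import Mathlib

open MeasureTheory Filter Topology Set
open scoped ENNReal NNReal

noncomputable section

namespace Stretched

/-- The ambient Euclidean space `ℝ^d`. -/
abbrev Eu (d : ℕ) := EuclideanSpace ℝ (Fin d)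

/-! ### Iterated function systems with condensation -/

section Attractor

variable {d N : ℕ}

/-- `f_w = f_{w_1} ∘ ⋯ ∘ f_{w_n}` for a finite word `w`; the empty word gives the identity. -/
def wordMap (f : Fin N → Eu d → Eu d) : List (Fin N) → Eu d → Eu d
  | [] => id
  | i :: w => f i ∘ wordMap f w

/-- `X` is a nonempty compact set with `X = ⋃ i, f i (X) ∪ B`. -/
def IsAttractor (f : Fin N → Eu d → Eu d) (B X : Set (Eu d)) : Prop :=
  X.Nonempty ∧ IsCompact X ∧ X = (⋃ i, f i '' X) ∪ B

/-- The unique nonempty compact set `X` with `X = ⋃ i, f i (X) ∪ B`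
(see `existsUnique_isAttractor`); `B` is the condensation set. -/
def attractor (f : Fin N → Eu d → Eu d) (B : Set (Eu d)) : Set (Eu d) :=
  Classical.epsilon (IsAttractor f B)

theorem existsUnique_isAttractor (hN : 0 < N) (f : Fin N → Eu d → Eu d) (c : Fin N → ℝ≥0)
    (hc : ∀ i, c i < 1) (hf : ∀ i, LipschitzWith (c i) (f i)) (B : Set (Eu d))
    (hB : IsCompact B) : ∃! X, IsAttractor f B X := by
  have : Nonempty (Fin N) := ⟨⟨0, hN⟩⟩
  let Φ : TopologicalSpace.NonemptyCompacts (Eu d) → TopologicalSpace.NonemptyCompacts (Eu d) :=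
    fun X => ⟨⟨(⋃ i, f i '' (X : Set (Eu d))) ∪ B,
      (isCompact_iUnion fun i => X.isCompact.image (hf i).continuous).union hB⟩,
      ((nonempty_iUnion.2 ⟨⟨0, hN⟩, X.nonempty.image _⟩).mono subset_union_left)⟩
  have hΦ : ∀ X, ((Φ X : TopologicalSpace.NonemptyCompacts (Eu d)) : Set (Eu d))
      = (⋃ i, f i '' (X : Set (Eu d))) ∪ B := fun X => rfl
  let K : ℝ≥0 := Finset.univ.sup' Finset.univ_nonempty c
  have hK1 : K < 1 := by
    simp only [K, Finset.sup'_lt_iff]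
    exact fun i _ => hc i
  have hcK : ∀ i, c i ≤ K := fun i => Finset.le_sup' c (Finset.mem_univ i)
  have key : ∀ (X Y : TopologicalSpace.NonemptyCompacts (Eu d)),
      ∀ x ∈ (⋃ i, f i '' (X : Set (Eu d))) ∪ B, ∃ y ∈ (⋃ i, f i '' (Y : Set (Eu d))) ∪ B,
        edist x y ≤ K * Metric.hausdorffEDist (X : Set (Eu d)) (Y : Set (Eu d)) := by
    rintro X Y x (hx | hx)
    · obtain ⟨i, z, hz, rfl⟩ := mem_iUnion.1 hx
      obtain ⟨y, hy, hzy⟩ := Y.isCompact.exists_infEDist_eq_edist Y.nonempty z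
      refine ⟨f i y, Or.inl (mem_iUnion.2 ⟨i, y, hy, rfl⟩), ((hf i) z y).trans ?_⟩
      refine mul_le_mul' (by exact_mod_cast hcK i) ?_
      rw [← hzy]
      exact Metric.infEDist_le_hausdorffEDist_of_mem hz
    · exact ⟨x, Or.inr hx, by simp⟩
  have hcon : ContractingWith K Φ := by
    refine ⟨hK1, fun X Y => ?_⟩
    change Metric.hausdorffEDist ((Φ X : _) : Set (Eu d)) (Φ Y : Set (Eu d)) ≤
      K * Metric.hausdorffEDist (X : Set (Eu d)) (Y : Set (Eu d))
    refine Metric.hausdorffEDist_le_of_mem_edist (key X Y) ?_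
    rw [Metric.hausdorffEDist_comm]
    exact key Y X
  refine ⟨(ContractingWith.fixedPoint Φ hcon : TopologicalSpace.NonemptyCompacts (Eu d)),
    ⟨TopologicalSpace.NonemptyCompacts.nonempty _,
      TopologicalSpace.NonemptyCompacts.isCompact _, ?_⟩, ?_⟩
  · rw [← hΦ]
    exact congrArg _ (hcon.fixedPoint_isFixedPt).eq.symm
  · rintro X ⟨h1, h2, h3⟩
    let X' : TopologicalSpace.NonemptyCompacts (Eu d) := ⟨⟨X, h2⟩, h1⟩
    have : X' = ContractingWith.fixedPoint Φ hcon := by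
      refine hcon.fixedPoint_unique ?_
      apply SetLike.coe_injective
      exact h3.symm
    rw [← this]
    rfl

end Attractor

/-! ### Self-similar sets, critical and post critical points -/

/-- Contracting similitudes `F_1, …, F_N` of `ℝ^d` with pairwise distinct fixed points
`q_1, …, q_N`. -/
structure SimilitudeSystem (d N : ℕ) where
  two_le : 2 ≤ N
  map : Fin N → Eu d → Eu d
  ratio : Fin N → ℝ
  ratio_pos : ∀ i, 0 < ratio i
  ratio_lt_one : ∀ i, ratio i < 1
  dist_map : ∀ i x y, dist (map i x) (map i y) = ratio i * dist x y
  fixedPt : Fin N → Eu d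
  map_fixedPt : ∀ i, map i (fixedPt i) = fixedPt i
  fixedPt_injective : Function.Injective fixedPt

namespace SimilitudeSystem

variable {d N : ℕ} (S : SimilitudeSystem d N)

/-- The self-similar set `F`. -/
def carrier : Set (Eu d) := attractor S.map ∅

/-- The critical set `𝒞 = ⋃_{i ≠ j} F_i(F) ∩ F_j(F)`. -/
def critical : Set (Eu d) :=
  {x | ∃ i j, i ≠ j ∧ x ∈ S.map i '' S.carrier ∧ x ∈ S.map j '' S.carrier}

/-- The post critical set `𝒫`. -/
def postCritical : Set (Eu d) :=
  {x | x ∈ S.carrier ∧ ∃ w : List (Fin N), w ≠ [] ∧ wordMap S.map w x ∈ S.critical}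

/-- The pairs `(c, i)` with `c ∈ 𝒞` and `c ∈ F_i(F)`. For fixed `c` there are `ρ(c)` of them (the
multiplicity of `c`), so these are the pairs `(c, l)`, `1 ≤ l ≤ ρ(c)`, where the index `l` is
replaced by the `1`-cell it stands for, that is, by the first letter of `w^{c,l}`. -/
def Branch : Type :=
  {p : Eu d × Fin N // p.1 ∈ S.critical ∧ p.1 ∈ S.map p.2 '' S.carrier}

end SimilitudeSystem

/-! ### Stretched fractals -/

/-- The data of a stretched fractal: the similitudes of a connected p.c.f. self-similar set
with the two conditions on the post critical set below, a stretching parameter `0 < α < 1`, and for each `(c, l)` a word `w^{c,l}` and a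
fixed point `q^c_l ∈ 𝒫` with `F_{w^{c,l}}(q^c_l) = c`, the first letters being pairwise
distinct for different `l`. -/
structure StretchedFractal (d N : ℕ) extends SimilitudeSystem d N where
  connected : IsConnected toSimilitudeSystem.carrier
  finite_postCritical : toSimilitudeSystem.postCritical.Finite
  /-- every post critical point is the image of a post critical fixed point -/
  postCritical_eq : ∀ p ∈ toSimilitudeSystem.postCritical, ∃ (w : List (Fin N)) (i : Fin N),
    fixedPt i ∈ toSimilitudeSystem.postCritical ∧ p = wordMap map w (fixedPt i)
  /-- the fixed points are not critical -/
  fixedPt_notMem : ∀ i, fixedPt i ∉ toSimilitudeSystem.critical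
  α : ℝ
  α_pos : 0 < α
  α_lt_one : α < 1
  /-- `w^{c,l}` without its first letter -/
  tail : toSimilitudeSystem.Branch → List (Fin N)
  /-- the index `j` with `q^c_l = q_j` -/
  foot : toSimilitudeSystem.Branch → Fin N
  foot_mem : ∀ b, fixedPt (foot b) ∈ toSimilitudeSystem.postCritical
  address : ∀ b, wordMap map (b.1.2 :: tail b) (fixedPt (foot b)) = b.1.1

namespace StretchedFractal

variable {d N : ℕ} (T : StretchedFractal d N)

/-- The index set of all `(c, l)`. -/
abbrev Branch : Type := T.toSimilitudeSystem.Branch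

/-- The contractions `G_i = α (F_i - q_i) + q_i`. -/
def G (i : Fin N) (x : Eu d) : Eu d := T.α • (T.map i x - T.fixedPt i) + T.fixedPt i

/-- The fractal part `Σ` of the stretched fractal, the attractor of `(G_1, …, G_N)`. -/
def dust : Set (Eu d) := attractor T.G ∅

/-- The critical point `c` of `(c, l)`. -/
def crit (b : T.Branch) : Eu d := b.1.1

/-- The point `G_{w^{c,l}}(q^c_l)` that is stretched away from `c`. -/
def tip (b : T.Branch) : Eu d := wordMap T.G (b.1.2 :: T.tail b) (T.fixedPt (T.foot b))

/-- The connecting line `e_{c,l}`. -/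
def edge (b : T.Branch) : Set (Eu d) := segment ℝ (T.crit b) (T.tip b)

/-- The parametrization `ξ(t) = t G_{w^{c,l}}(q^c_l) + (1 - t) c` of `e_{c,l}`, `0 ≤ t ≤ 1`. -/
def ξ (b : T.Branch) (t : ℝ) : Eu d := t • T.tip b + (1 - t) • T.crit b

/-- The stretched fractal `K`: the unique nonempty compact set with
`K = ⋃ i, G_i(K) ∪ ⋃_{c,l} e_{c,l}`. -/
def K : Set (Eu d) := attractor T.G (⋃ b, T.edge b)

/-- `G_w` for a word of length `n`. -/
def Gn {n : ℕ} (w : Fin n → Fin N) : Eu d → Eu d := wordMap T.G (List.ofFn w)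

/-- The vertex set `V_0`: the points `G_v(q^c_l)`, where `v` is `w^{c,l}` with one or more initial
letters removed. In `F`, the points `F_v(q^c_l)` are the post critical points, and when all post
critical points are fixed points of the similitudes, `V_0 = 𝒫`. -/
def V₀ : Set (Eu d) :=
  ⋃ b : T.Branch, (fun v => wordMap T.G v (T.fixedPt (T.foot b))) '' {v | v <:+ T.tail b}

theorem finite_critical : T.toSimilitudeSystem.critical.Finite := by
  refine (Set.finite_iUnion fun i : Fin N => T.finite_postCritical.image (T.map i)).subset ?_
  rintro x ⟨i, j, hij, ⟨y, hy, rfl⟩, hj⟩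
  refine mem_iUnion.2 ⟨i, y, ⟨hy, [i], by simp, ?_⟩, rfl⟩
  exact ⟨i, j, hij, ⟨y, hy, rfl⟩, hj⟩

instance finite_branch : Finite T.Branch := by
  have h : ({p : Eu d × Fin N | p.1 ∈ T.toSimilitudeSystem.critical ∧
      p.1 ∈ T.map p.2 '' T.toSimilitudeSystem.carrier}).Finite :=
    (T.finite_critical.prod (Set.finite_univ (α := Fin N))).subset
      fun p hp => ⟨hp.1, mem_univ _⟩
  exact h.to_subtype

instance : Fintype T.Branch := Fintype.ofFinite _

instance finite_V₀ : Finite T.V₀ := by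
  have h : T.V₀.Finite := by
    refine Set.finite_iUnion fun b => Set.Finite.image _ ?_
    refine (List.finite_toSet (T.tail b).tails).subset fun v hv => ?_
    exact (List.mem_tails _ _).2 hv
  exact h.to_subtype

instance : Fintype T.V₀ := Fintype.ofFinite _

/-! The three sets defined through `attractor` solve their equations. -/

theorem isAttractor_carrier : IsAttractor T.map ∅ T.toSimilitudeSystem.carrier := by
  refine Classical.epsilon_spec (existsUnique_isAttractor (by have := T.two_le; omega) _
    (fun i => ⟨T.ratio i, (T.ratio_pos i).le⟩) (fun i => T.ratio_lt_one i) (fun i => ?_) ∅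
    isCompact_empty).exists
  exact LipschitzWith.of_dist_le_mul fun x y => (T.dist_map i x y).le

theorem existsUnique_isAttractor_G (B : Set (Eu d)) (hB : IsCompact B) :
    ∃! X, IsAttractor T.G B X := by
  refine existsUnique_isAttractor (by have := T.two_le; omega) _
    (fun i => ⟨T.ratio i, (T.ratio_pos i).le⟩) (fun i => T.ratio_lt_one i) (fun i => ?_) B hB
  refine LipschitzWith.of_dist_le_mul fun x y => ?_
  simp only [G, dist_add_right]
  rw [dist_smul₀, dist_sub_right, T.dist_map, Real.norm_of_nonneg T.α_pos.le]
  exact mul_le_of_le_one_left (mul_nonneg (T.ratio_pos i).le dist_nonneg) T.α_lt_one.le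

theorem isAttractor_dust : IsAttractor T.G ∅ T.dust :=
  Classical.epsilon_spec (T.existsUnique_isAttractor_G ∅ isCompact_empty).exists

theorem isAttractor_K : IsAttractor T.G (⋃ b, T.edge b) T.K := by
  refine Classical.epsilon_spec (T.existsUnique_isAttractor_G _ ?_).exists
  refine isCompact_iUnion fun b => ?_
  rw [edge, segment_eq_image_lineMap]
  exact isCompact_Icc.image AffineMap.lineMap_continuous

/-! ### Harmonic structures -/

/-- `Q^Σ_{r_0}(u) = ∑_{{x,y} ∈ E_0} (u(x) - u(y))² / r_0(x,y)`, the sum over unordered pairs of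
distinct points of `V_0` being written as half of the sum over ordered pairs (the diagonal
contributes zero). Here `1 / ∞ = 0`. -/
def Qfrac (r₀ : T.V₀ → T.V₀ → ℝ≥0∞) (u : Eu d → ℝ) : ℝ :=
  (1 / 2) * ∑ x : T.V₀, ∑ y : T.V₀, (r₀ x y)⁻¹.toReal * (u x - u y) ^ 2

/-- `Q^I_ρ(u) = ∑_{c,l} (u(c) - u(G_{w^{c,l}}(q^c_l)))² / ρ_{c,l}`. -/
def Qline (ρ : T.Branch → ℝ) (u : Eu d → ℝ) : ℝ :=
  ∑ b, (ρ b)⁻¹ * (u (T.crit b) - u (T.tip b)) ^ 2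

/-- The energy `E_1` of the network `(V_1, E_1, r_1)`. -/
def networkEnergy (r₀ : T.V₀ → T.V₀ → ℝ≥0∞) (lam : ℝ) (ρ : T.Branch → ℝ) (u : Eu d → ℝ) : ℝ :=
  lam⁻¹ * ∑ i, T.Qfrac r₀ (u ∘ T.G i) + T.Qline ρ u

/-- `(r_0, λ, ρ)` is a harmonic structure: `r_0` takes values in `(0, ∞]`, `λ` in `(0, 1)`
and `ρ` in `(0, ∞)`, the network `(V_0, E_0, r_0)` is connected, and the trace of `E_1` on `V_0` is
`E_0`. All functions are written as functions on `ℝ^d`; only their values on the finite sets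
`V_0` and `V_1` enter. -/
structure IsHarmonicStructure (r₀ : T.V₀ → T.V₀ → ℝ≥0∞) (lam : ℝ) (ρ : T.Branch → ℝ) : Prop where
  symm : ∀ x y, r₀ x y = r₀ y x
  r₀_pos : ∀ x y, x ≠ y → 0 < r₀ x y
  lam_pos : 0 < lam
  lam_lt_one : lam < 1
  ρ_pos : ∀ b, 0 < ρ b
  network_connected : ∀ x y : T.V₀,
    Relation.ReflTransGen (fun p q : T.V₀ => p ≠ q ∧ r₀ p q < ∞) x y
  trace_eq : ∀ g : Eu d → ℝ,
    IsGLB {e | ∃ f : Eu d → ℝ, (∀ x ∈ T.V₀, f x = g x) ∧ e = T.networkEnergy r₀ lam ρ f}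
      (T.Qfrac r₀ g)

/-- A regular sequence of harmonic structures `(r_0, λ_i, ρ^i)_{i ≥ 1}` with common `r_0`; the entry
`λ_{i+1}` is `lam i`, and `ρ^{i+1}` is `ρ i`. -/
structure RegularSequence where
  r₀ : T.V₀ → T.V₀ → ℝ≥0∞
  lam : ℕ → ℝ
  ρ : ℕ → T.Branch → ℝ
  harmonic : ∀ i, T.IsHarmonicStructure r₀ (lam i) (ρ i)
  lam_bound : ∃ l < 1, ∀ i, lam i ≤ l
  ρ_bound : ∃ r, ∀ i b, ρ i b ≤ r

end StretchedFractal

/-! ### The resistance form -/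

/-- Membership in `H^1[0,1]`, for a (continuous) function on `[0,1]`: it is absolutely continuous
and its derivative is square integrable. -/
def MemH1 (u : ℝ → ℝ) : Prop :=
  AbsolutelyContinuousOnInterval u 0 1 ∧ MemLp (deriv u) 2 (volume.restrict (Icc 0 1))

namespace StretchedFractal

namespace RegularSequence

variable {d N : ℕ} {T : StretchedFractal d N} (R : T.RegularSequence)

/-- `δ_n = λ_1 ⋯ λ_n`. -/
def δ (n : ℕ) : ℝ := ∏ k ∈ Finset.range n, R.lam k

/-- `𝓓_ρ(u) = ∑_{c,l} (1 / ρ_{c,l}) ∫_0^1 ((u ∘ ξ_{e_{c,l}})')²`. -/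
def lineEnergy (_R : T.RegularSequence) (ρ : T.Branch → ℝ) (u : Eu d → ℝ) : ℝ :=
  ∑ b, (ρ b)⁻¹ * ∫ t in (0 : ℝ)..1, (deriv (u ∘ T.ξ b) t) ^ 2

/-- `𝓔_{R,n}(u)`, the sum of the fractal part `∑_{|w| = n} δ_n⁻¹ Q^Σ(u ∘ G_w)` and the line part
`∑_{k=1}^n γ_k⁻¹ ∑_{|w| = k-1} 𝓓_{ρ^k}(u ∘ G_w)`, where `γ_k = δ_{k-1}`. -/
def energyN (n : ℕ) (u : Eu d → ℝ) : ℝ :=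
  (∑ w : Fin n → Fin N, (R.δ n)⁻¹ * T.Qfrac R.r₀ (u ∘ T.Gn w)) +
    ∑ k ∈ Finset.range n, (R.δ k)⁻¹ *
      ∑ w : Fin k → Fin N, R.lineEnergy (R.ρ k) (u ∘ T.Gn w)

/-- `𝓔_R(u) = lim_n 𝓔_{R,n}(u)`. -/
def energy (u : Eu d → ℝ) : ℝ := limUnder atTop fun n => R.energyN n u

/-- The bilinear form `𝓔_R(u, v)`, by polarization. -/
def form (u v : Eu d → ℝ) : ℝ := (R.energy (u + v) - R.energy (u - v)) / 4

/-- The domain `𝓕_R = 𝓓_R`: functions that are continuous on `K`, in `H^1` along all the lines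
`e^w_{c,l}`, with finite limit energy. Functions on `K` are written as functions on `ℝ^d` whose
values off `K` are irrelevant. -/
def domain : Set (Eu d → ℝ) :=
  {u | ContinuousOn u T.K ∧
    (∀ (w : List (Fin N)) (b : T.Branch), MemH1 (u ∘ wordMap T.G w ∘ T.ξ b)) ∧
    ∃ l : ℝ, Tendsto (fun n => R.energyN n u) atTop (𝓝 l)}

/-- The domain `𝓓_R^0` with Dirichlet boundary conditions on `V_0`. -/
def domain₀ : Set (Eu d → ℝ) := {u | u ∈ R.domain ∧ ∀ x ∈ T.V₀, u x = 0}

end RegularSequence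

/-! ### The measures -/

variable {d N : ℕ} (T : StretchedFractal d N)

/-- The coding map `{1, …, N}^ℕ → Σ`, `ω ↦ lim_n G_{ω_1 ⋯ ω_n}(0)`. -/
def coding (ω : ℕ → Fin N) : Eu d :=
  limUnder atTop fun n : ℕ => T.Gn (fun k : Fin n => ω k) 0

/-- The normalized self-similar measure `μ_Σ` with equal weights `1/N`: the image of the uniform
Bernoulli measure on sequences under the coding map. -/
def μfrac : Measure (Eu d) :=
  haveI : NeZero N := ⟨by have := T.two_le; omega⟩
  (Measure.infinitePi fun _ : ℕ => ProbabilityTheory.uniformOn (univ : Set (Fin N))).map T.coding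

/-- The line measure `μ_I`: on each `e^w_{c,l}` it is the normalized one-dimensional Lebesgue
measure times `β^{|w|} a_{c,l}`. -/
def μline (a : T.Branch → ℝ) (β : ℝ) : Measure (Eu d) :=
  Measure.sum fun w : List (Fin N) => ∑ b : T.Branch,
    ENNReal.ofReal (β ^ w.length * a b) •
      (volume.restrict (Icc (0 : ℝ) 1)).map (wordMap T.G w ∘ T.ξ b)

/-- `μ_η = η μ_I + (1 - η) μ_Σ`, a Borel measure on `ℝ^d` carried by `K`. Therefore
`L²(K, μ_η)` is `Lp ℝ 2 (T.μη a β η)`. -/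
def μη (a : T.Branch → ℝ) (β η : ℝ) : Measure (Eu d) :=
  ENNReal.ofReal η • T.μline a β + ENNReal.ofReal (1 - η) • T.μfrac

end StretchedFractal

/-! ### Operators associated with forms; discrete spectrum -/

/-- `A` is the operator associated with the form `(a, D)` on `L²(μ)`: a class `f` is in the domain
of `A` with `A f = g` if and only if `f` is represented by some `u ∈ D` such that
`a(u, v) = ⟨g, v⟩` for all `v ∈ D`. -/
def IsFormOperator {X : Type*} [MeasurableSpace X] (μ : Measure X) (D : Set (X → ℝ))
    (a : (X → ℝ) → (X → ℝ) → ℝ) (A : Lp ℝ 2 μ →ₗ.[ℝ] Lp ℝ 2 μ) : Prop :=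
  ∀ f g : Lp ℝ 2 μ, (f, g) ∈ A.graph ↔
    ∃ u ∈ D, f =ᵐ[μ] u ∧ ∀ v ∈ D, a u v = ∫ x, g x * v x ∂μ

section Spectrum

variable {H : Type*} [NormedAddCommGroup H] [InnerProductSpace ℝ H]

/-- The spectrum of an unbounded operator `A`: the `z` such that `A - z` has no bounded, everywhere
defined inverse. -/
def opSpectrum (A : H →ₗ.[ℝ] H) : Set ℝ :=
  {z | ¬ ∃ S : H →L[ℝ] H,
    (∀ y, ∃ h : S y ∈ A.domain, A ⟨S y, h⟩ - z • S y = y) ∧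
      ∀ x : A.domain, S (A x - z • (x : H)) = x}

/-- The eigenspace of `A` for `z`, inside the domain of `A`. -/
def opEigenspace (A : H →ₗ.[ℝ] H) (z : ℝ) : Submodule ℝ A.domain :=
  LinearMap.ker (A.toFun - z • A.domain.subtype)

/-- The spectrum of `A` is discrete: it consists of eigenvalues of finite multiplicity and has no
(finite) accumulation point. -/
def HasDiscreteSpectrum (A : H →ₗ.[ℝ] H) : Prop :=
  (∀ z ∈ opSpectrum A, opEigenspace A z ≠ ⊥ ∧ FiniteDimensional ℝ (opEigenspace A z)) ∧
    ∀ z : ℝ, ¬ AccPt z (𝓟 (opSpectrum A))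

end Spectrum

end Stretched

end

/-! A densely defined, closed, non-negative form whose domain embeds compactly in L² has a unique
associated operator, which is self-adjoint with discrete non-negative spectrum. The abstract half of
the proof makes this concrete: if `j` embeds the form domain, with inner product a(u,v) + ⟨u,v⟩,
into L², then S = j j* is compact, symmetric, injective and satisfies ‖S h‖² ≤ ⟨S h, h⟩. The
operator sought is the A with (A + 1)⁻¹ = S, and the spectrum of A is read off from the eigenvalues
1/(1+z) of S (`exists_resolvent`, `finite_hasEigenvalue_ge`).

The analytic half checks closedness, compactness and density for the energy. The trace property and
the one-dimensional inequality (u(1) - u(0))² ≤ ∫ u'² make the energies of level n increase with n,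
so the limit energy is a supremum of energies that each see only finitely many vertices and lines
(`energyN_le_succ`).

The central estimate is `exists_osc_bound`: on the cell of a word w the oscillation of u is at most
C √(δ_|w| E(u)). The vertices of one cell are compared by chaining through neighbouring subcells and
the lines between them; descending through the levels sums a geometric series because the λ_i stay
below some λ* < 1. On the lines, u is Hölder continuous of exponent 1/2, uniformly because the ρ^i
are bounded. Hence u is determined up to ε√E(u) by its values at finitely many points
(`exists_finite_sample`), which gives compactness. Moreover the form norm dominates the sup norm, so
Cauchy sequences converge uniformly, and lower semicontinuity together with completeness of H¹[0,1]
gives closedness (`exists_limit`).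

Density is where the disjointness of the sets G_i(Σ) enters. It makes Σ totally separated, so
bounded Lipschitz functions that are locally constant near Σ separate points. They are constant on
all small cells, hence of finite energy, and Stone–Weierstrass applies. Vanishing on a finite null
set costs nothing in L² (`eq_zero_of_forall_test`). Both boundary conditions are treated at once, as
functions vanishing on a finite null set Z: empty for Neumann, V₀ for Dirichlet. -/

noncomputable section

namespace Stretched

/-! ### Operators with a compact resolvent -/

section Resolvent

variable {H : Type*} [NormedAddCommGroup H] [InnerProductSpace ℝ H]

/-- `S` is the resolvent `(A + 1)⁻¹` of `A`, expressed through the graph of `A`. -/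
def IsResolventAtNegOne (A : H →ₗ.[ℝ] H) (S : H →L[ℝ] H) : Prop :=
  ∀ f g : H, (f, g) ∈ A.graph ↔ f = S (f + g)

/-- The pairs with f = S (f + g) form a linear subspace. It is the graph of an operator because a
pair (0, b) in it gives S b = 0, hence b = 0 by injectivity. -/
theorem exists_isResolventAtNegOne (S : H →L[ℝ] H) (hinj : ∀ h, S h = 0 → h = 0) :
    ∃ A : H →ₗ.[ℝ] H, IsResolventAtNegOne A S := by
  let Γ : Submodule ℝ (H × H) :=
    { carrier := {p | p.1 = S (p.1 + p.2)}
      add_mem' := by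
        rintro ⟨a, b⟩ ⟨c, d⟩ h1 h2
        simp only [mem_ofPred_eq, Prod.fst_add, Prod.snd_add] at h1 h2 ⊢
        rw [add_add_add_comm, map_add, ← h1, ← h2]
      zero_mem' := by simp
      smul_mem' := by
        rintro c ⟨a, b⟩ h1
        simp only [mem_ofPred_eq, Prod.smul_fst, Prod.smul_snd] at h1 ⊢
        rw [← smul_add, map_smul, ← h1] }
  refine ⟨Γ.toLinearPMap, fun f g => ?_⟩
  rw [Submodule.toLinearPMap_graph_eq]
  · rfl
  · rintro ⟨a, b⟩ h (h0 : a = 0)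
    have h : a = S (a + b) := h
    subst h0
    rw [zero_add] at h
    exact hinj b h.symm

namespace IsResolventAtNegOne

variable {A : H →ₗ.[ℝ] H} {S : H →L[ℝ] H}

theorem mem_graph (hA : IsResolventAtNegOne A S) (h : H) : (S h, h - S h) ∈ A.graph := by
  rw [hA]
  congr 1
  abel

theorem mem_domain (hA : IsResolventAtNegOne A S) (h : H) : S h ∈ A.domain :=
  LinearPMap.mem_domain_of_mem_graph (hA.mem_graph h)

theorem apply (hA : IsResolventAtNegOne A S) (h : H) : A ⟨S h, hA.mem_domain h⟩ = h - S h :=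
  (LinearPMap.image_iff (hA.mem_domain h)).2 (hA.mem_graph h) |>.symm

theorem apply_add (hA : IsResolventAtNegOne A S) (x : A.domain) : S (x + A x) = x :=
  ((hA _ _).1 (A.mem_graph x)).symm

/-- The range of S is dense because its orthogonal complement lies in the kernel of S. Symmetry of S
makes A symmetric, so A ≤ A*. Conversely, testing a pair (y, g) of the graph of A* against S v gives
⟨g, S v⟩ = ⟨y, v - S v⟩ for all v, that is y = S (y + g). -/
theorem isSelfAdjoint [CompleteSpace H] (hA : IsResolventAtNegOne A S)
    (hsymm : ∀ x y, inner ℝ (S x) y = inner ℝ x (S y))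
    (hinj : ∀ h, S h = 0 → h = 0) : IsSelfAdjoint A := by
  have hdense : Dense (A.domain : Set H) := by
    rw [Submodule.dense_iff_topologicalClosure_eq_top,
      Submodule.topologicalClosure_eq_top_iff, Submodule.eq_bot_iff]
    intro y hy
    refine hinj y (ext_inner_left ℝ fun v => ?_)
    rw [← hsymm, inner_zero_right]
    exact hy _ (hA.mem_domain v)
  have hformal : A.IsFormalAdjoint A := by
    intro x y
    have hx := hA.apply_add x
    have hy := hA.apply_add y
    have := hsymm (x + A x) (y + A y)
    rw [hx, hy, inner_add_left, inner_add_right] at this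
    linarith
  rw [LinearPMap.isSelfAdjoint_def]
  refine le_antisymm ?_ (hformal.le_adjoint hdense)
  refine LinearPMap.le_of_le_graph ?_
  rintro ⟨y, g⟩ hyg
  obtain ⟨hy, rfl⟩ : ∃ hy : y ∈ A.adjoint.domain, A.adjoint ⟨y, hy⟩ = g := by
    obtain ⟨z, h1, h2⟩ := (LinearPMap.mem_graph_iff _).1 hyg
    simp only at h1 h2
    subst h1
    exact ⟨z.2, h2⟩
  have hadj := LinearPMap.adjoint_isFormalAdjoint hdense (T := A) ⟨y, hy⟩
  rw [hA]
  refine ext_inner_right ℝ fun v => ?_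
  have := hadj ⟨S v, hA.mem_domain v⟩
  rw [hA.apply] at this
  simp only [inner_sub_right] at this
  rw [hsymm, inner_add_left]
  linarith

/-- On the range of S one has A - z = (1 - (1 + z) S) S⁻¹. So A - z is invertible as soon as 1 - (1
+ z) S is, and for compact S this fails only if 1 + z ≠ 0 and (1 + z)⁻¹ is an eigenvalue. -/
theorem hasEigenvalue_of_mem_opSpectrum [CompleteSpace H] (hA : IsResolventAtNegOne A S)
    (hcomp : IsCompactOperator S) {z : ℝ}
    (hz : z ∈ opSpectrum A) :
    1 + z ≠ 0 ∧ Module.End.HasEigenvalue (S : Module.End ℝ H) (1 + z)⁻¹ := by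
  by_contra hcon
  refine hz ?_
  -- R is the two-sided inverse of 1 - (1 + z) S; the inverse of A - z is then S R.
  obtain ⟨R, hR1, hR2⟩ : ∃ R : H →L[ℝ] H, (∀ h, R (h - (1 + z) • S h) = h) ∧
      ∀ g, R g - (1 + z) • S (R g) = g := by
    by_cases h0 : 1 + z = 0
    · exact ⟨ContinuousLinearMap.id ℝ H, by simp [h0], by simp [h0]⟩
    · have hres := (hcomp.hasEigenvalue_or_mem_resolventSet (inv_ne_zero h0)).resolve_left
        fun h => hcon ⟨h0, h⟩
      rw [spectrum.mem_resolventSet_iff] at hres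
      obtain ⟨U, hU⟩ := hres
      have hUapp : ∀ h, (U : H →L[ℝ] H) h = (1 + z)⁻¹ • h - S h := fun h => by
        rw [hU, Algebra.algebraMap_eq_smul_one]; rfl
      have h1 : ∀ h, (↑U⁻¹ : H →L[ℝ] H) ((U : H →L[ℝ] H) h) = h := fun h => by
        rw [← mul_apply_eq_comp, U.inv_mul, one_apply_eq_self]
      have h2 : ∀ h, (U : H →L[ℝ] H) ((↑U⁻¹ : H →L[ℝ] H) h) = h := fun h => by
        rw [← mul_apply_eq_comp, U.mul_inv, one_apply_eq_self]
      have key : ∀ h, h - (1 + z) • S h = (1 + z) • (U : H →L[ℝ] H) h := fun h => by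
        rw [hUapp, smul_sub, smul_smul, mul_inv_cancel₀ h0, one_smul]
      refine ⟨(1 + z)⁻¹ • (↑U⁻¹ : H →L[ℝ] H), fun h => ?_, fun g => ?_⟩
      · rw [key, smul_apply, map_smul, h1, smul_smul, inv_mul_cancel₀ h0,
          one_smul]
      · rw [key, smul_apply, map_smul, h2, smul_smul, mul_inv_cancel₀ h0,
          one_smul]
  refine ⟨S ∘L R, fun y => ⟨hA.mem_domain (R y), ?_⟩, fun x => ?_⟩
  · have h := hA.apply (R y)
    change A ⟨S (R y), _⟩ - z • S (R y) = y
    rw [h]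
    conv_rhs => rw [← hR2 y]
    module
  · have h := hA.apply_add x
    have : A x - z • (x : H) = ((x : H) + A x) - (1 + z) • S (x + A x) := by
      rw [h]
      module
    rw [this, ContinuousLinearMap.comp_apply, hR1, h]

/-- On an eigenvector, ‖S h‖² ≤ ⟨S h, h⟩ says μ² ≤ μ for the eigenvalue μ = (1 + z)⁻¹ ≠ 0. Thus 0 <
μ ≤ 1 and 1 + z ≥ 1. -/
theorem nonneg_of_mem_opSpectrum [CompleteSpace H] (hA : IsResolventAtNegOne A S)
    (hcomp : IsCompactOperator S)
    (hpos : ∀ h, ‖S h‖ ^ 2 ≤ inner ℝ (S h) h) {z : ℝ} (hz : z ∈ opSpectrum A) : 0 ≤ z := by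
  obtain ⟨h0, hev⟩ := hA.hasEigenvalue_of_mem_opSpectrum hcomp hz
  obtain ⟨x, hx⟩ := hev.exists_hasEigenvector
  have hSx : S x = (1 + z)⁻¹ • x := hx.apply_eq_smul
  have h := hpos x
  rw [hSx, norm_smul, inner_smul_left, real_inner_self_eq_norm_sq, mul_pow, Real.norm_eq_abs,
    sq_abs] at h
  have hx2 : 0 < ‖x‖ ^ 2 := by have := norm_pos_iff.2 hx.2; positivity
  have h' : ((1 + z)⁻¹) ^ 2 ≤ (1 + z)⁻¹ := le_of_mul_le_mul_right h hx2
  have hp : 0 < (1 + z)⁻¹ := lt_of_lt_of_le (by positivity) h'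
  have h1 : (1 + z)⁻¹ ≤ 1 := by nlinarith
  have hp' : 0 < 1 + z := inv_pos.1 hp
  have := (inv_le_one₀ hp').1 h1
  linarith

/-- An eigenvector of S for a nonzero eigenvalue lies in the range of S, hence in the domain of A.
-/
theorem opEigenspace_ne_bot [CompleteSpace H] (hA : IsResolventAtNegOne A S)
    (hcomp : IsCompactOperator S) {z : ℝ}
    (hz : z ∈ opSpectrum A) : opEigenspace A z ≠ ⊥ := by
  obtain ⟨h0, hev⟩ := hA.hasEigenvalue_of_mem_opSpectrum hcomp hz
  obtain ⟨x, hx⟩ := hev.exists_hasEigenvector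
  have hSx : S x = (1 + z)⁻¹ • x := hx.apply_eq_smul
  have hx' : x = S ((1 + z) • x) := by
    rw [map_smul, hSx, smul_smul, mul_inv_cancel₀ h0, one_smul]
  have hg : (x, z • x) ∈ A.graph := by
    rw [hA]
    conv_lhs => rw [hx']
    congr 1
    module
  have hdom := LinearPMap.mem_domain_of_mem_graph hg
  intro hbot
  have hmem : (⟨x, hdom⟩ : A.domain) ∈ opEigenspace A z := by
    rw [opEigenspace, LinearMap.mem_ker]
    change A ⟨x, hdom⟩ - z • x = 0
    rw [← (LinearPMap.image_iff hdom).2 hg, sub_self]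
  rw [hbot, Submodule.mem_bot] at hmem
  exact hx.2 (congrArg Subtype.val hmem)

theorem finiteDimensional_opEigenspace [CompleteSpace H] (hA : IsResolventAtNegOne A S)
    (hcomp : IsCompactOperator S) {z : ℝ}
    (hz : z ∈ opSpectrum A) : FiniteDimensional ℝ (opEigenspace A z) := by
  obtain ⟨h0, -⟩ := hA.hasEigenvalue_of_mem_opSpectrum hcomp hz
  have := ContinuousLinearMap.finite_dimensional_eigenspace hcomp _ (inv_ne_zero h0)
  let ι : opEigenspace A z →ₗ[ℝ] Module.End.eigenspace S.toLinearMap (1 + z)⁻¹ :=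
    LinearMap.codRestrict _ (A.domain.subtype ∘ₗ (opEigenspace A z).subtype) fun x => by
      rw [Module.End.mem_eigenspace_iff]
      have hx : A x.1 - z • (x.1 : H) = 0 := x.2
      have h := hA.apply_add x.1
      rw [sub_eq_zero.1 hx, map_add, map_smul] at h
      change S (x.1 : H) = (1 + z)⁻¹ • (x.1 : H)
      conv_rhs => rw [← h]
      rw [show S (x.1 : H) + z • S (x.1 : H) = (1 + z) • S (x.1 : H) by module, smul_smul,
        inv_mul_cancel₀ h0, one_smul]
  refine FiniteDimensional.of_injective ι fun x y hxy => ?_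
  exact Subtype.ext (Subtype.ext (congrArg (Submodule.subtype
    (Module.End.eigenspace S.toLinearMap (1 + z)⁻¹)) hxy))

end IsResolventAtNegOne

/-- A compact symmetric operator has only finitely many eigenvalues outside a neighbourhood
of zero. -/
theorem finite_hasEigenvalue_ge {S : H →L[ℝ] H} (hcomp : IsCompactOperator S)
    (hsymm : ∀ x y, inner ℝ (S x) y = inner ℝ x (S y)) {ε : ℝ} (hε : 0 < ε) :
    {μ : ℝ | ε ≤ μ ∧ Module.End.HasEigenvalue (S : Module.End ℝ H) μ}.Finite := by
  by_contra hinf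
  have hinf : Set.Infinite _ := hinf
  have hex : ∀ μ : ℝ, ∃ x : H, Module.End.HasEigenvalue (S : Module.End ℝ H) μ →
      ‖x‖ = 1 ∧ S x = μ • x := by
    intro μ
    by_cases h : Module.End.HasEigenvalue (S : Module.End ℝ H) μ
    · obtain ⟨x, hx⟩ := h.exists_hasEigenvector
      have hSx : S x = μ • x := hx.apply_eq_smul
      refine ⟨‖x‖⁻¹ • x, fun _ => ⟨?_, ?_⟩⟩
      · rw [norm_smul, norm_inv, norm_norm, inv_mul_cancel₀ (norm_ne_zero_iff.2 hx.2)]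
      · rw [map_smul, hSx, smul_comm]
    · exact ⟨0, fun h' => absurd h' h⟩
  choose e he using hex
  have hK := (hcomp.isCompact_closure_image_closedBall 1).totallyBounded
  obtain ⟨t, htfin, ht⟩ := Metric.totallyBounded_iff.1 hK (ε / 2) (half_pos hε)
  have hmap : ∀ μ ∈ {μ : ℝ | ε ≤ μ ∧ Module.End.HasEigenvalue (S : Module.End ℝ H) μ},
      ∃ y ∈ t, dist (S (e μ)) y < ε / 2 := by
    rintro μ ⟨-, hμ⟩
    have : S (e μ) ∈ ⋃ y ∈ t, Metric.ball y (ε / 2) := by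
      refine ht (subset_closure ⟨e μ, ?_, rfl⟩)
      rw [mem_closedBall_zero_iff]
      exact (he μ hμ).1.le
    simpa using this
  choose! y hyt hy using hmap
  -- Pigeonhole: two distinct eigenvalues have images S e within ε/2 of the same point of the finite
  -- net. Yet these images are orthogonal with norms at least ε, so they are too far apart.
  obtain ⟨μ, hμ, ν, hν, hne, heq⟩ := hinf.exists_ne_map_eq_of_mapsTo hyt htfin
  have hlt : dist (S (e μ)) (S (e ν)) < ε := by
    have h1 := hy μ hμ
    have h2 := hy ν hν
    rw [heq] at h1
    rw [dist_comm] at h2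
    linarith [dist_triangle (S (e μ)) (y ν) (S (e ν))]
  obtain ⟨hn1, hS1⟩ := he μ hμ.2
  obtain ⟨hn2, hS2⟩ := he ν hν.2
  have horth : inner ℝ (e μ) (e ν) = (0 : ℝ) := by
    have := hsymm (e μ) (e ν)
    rw [hS1, hS2, inner_smul_left, inner_smul_right] at this
    have h3 : (μ - ν) * inner ℝ (e μ) (e ν) = 0 := by
      simp only [conj_trivial] at this
      linarith
    exact (mul_eq_zero.1 h3).resolve_left (sub_ne_zero.2 hne)
  have hsq : dist (S (e μ)) (S (e ν)) ^ 2 = μ ^ 2 + ν ^ 2 := by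
    rw [dist_eq_norm, hS1, hS2, norm_sub_sq_real, inner_smul_left, inner_smul_right, horth,
      norm_smul, norm_smul, hn1, hn2]
    simp
  have hμε : ε ≤ μ := hμ.1
  have : ε ^ 2 ≤ dist (S (e μ)) (S (e ν)) ^ 2 := by
    rw [hsq]
    nlinarith [sq_nonneg ν]
  nlinarith [dist_nonneg (x := S (e μ)) (y := S (e ν))]

/-- Spectral points below |z| + 1 give eigenvalues of S that are at least (|z| + 2)⁻¹, and there are
only finitely many of those. -/
theorem IsResolventAtNegOne.not_accPt [CompleteSpace H] {A : H →ₗ.[ℝ] H} {S : H →L[ℝ] H}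
    (hA : IsResolventAtNegOne A S) (hcomp : IsCompactOperator S)
    (hsymm : ∀ x y, inner ℝ (S x) y = inner ℝ x (S y))
    (hpos : ∀ h, ‖S h‖ ^ 2 ≤ inner ℝ (S h) h) (z : ℝ) : ¬ AccPt z (𝓟 (opSpectrum A)) := by
  intro hacc
  have hfin : (Iio (|z| + 1) ∩ opSpectrum A).Finite := by
    have h1 := (finite_hasEigenvalue_ge hcomp hsymm
      (ε := (|z| + 2)⁻¹) (by positivity)).preimage
      (f := fun w : ℝ => (1 + w)⁻¹) (s := _) (fun a _ b _ hab => by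
        simpa using hab)
    refine h1.subset ?_
    rintro w ⟨hw1, hw2⟩
    have h0 := hA.nonneg_of_mem_opSpectrum hcomp hpos hw2
    refine ⟨?_, (hA.hasEigenvalue_of_mem_opSpectrum hcomp hw2).2⟩
    have : w < |z| + 1 := hw1
    exact inv_anti₀ (by linarith) (by linarith)
  have hacc' := hacc.nhds_inter (Iio_mem_nhds (show z < |z| + 1 by linarith [le_abs_self z]))
  rw [accPt_iff_nhds] at hacc'
  obtain ⟨y, ⟨hy1, hy2⟩, hy3⟩ := hacc' _ ((hfin.subset sdiff_subset).isClosed.isOpen_compl.mem_nhds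
    (show z ∈ ((Iio (|z| + 1) ∩ opSpectrum A) \ {z})ᶜ by simp))
  exact hy1 ⟨hy2, hy3⟩

end Resolvent

/-! ### Closed forms with compact embedding -/

section Form

variable {H : Type*} [NormedAddCommGroup H] [InnerProductSpace ℝ H]

/-- The resolvent of a closed form, on the form domain equipped with the graph inner product. -/
theorem exists_resolvent_of_complete [CompleteSpace H] {V : Type*} [SeminormedAddCommGroup V]
    [InnerProductSpace ℝ V] [CompleteSpace V] (j : V →L[ℝ] H) (hj : ∀ u, ‖j u‖ ≤ ‖u‖)
    (hdense : ∀ h : H, (∀ v, inner ℝ h (j v) = 0) → h = 0)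
    (htb : TotallyBounded (j '' Metric.closedBall 0 1)) :
    ∃ S : H →L[ℝ] H, (∀ x y, inner ℝ (S x) y = inner ℝ x (S y)) ∧ (∀ h, S h = 0 → h = 0) ∧
      (∀ h, ‖S h‖ ^ 2 ≤ inner ℝ (S h) h) ∧ IsCompactOperator S ∧
      ∀ f k, f = S k ↔ ∃ u, j u = f ∧ ∀ v, inner ℝ u v = inner ℝ k (j v) := by
  -- The form norm is only a seminorm: functions that agree on K but differ off K have distance
  -- zero. Passing to the Hausdorff quotient gives a Hilbert space, on which the adjoint exists.
  let J : SeparationQuotient V →L[ℝ] H :=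
    SeparationQuotient.liftCLM j fun x y h => (h.map j.continuous).eq
  have hJ : ∀ v : V, J (SeparationQuotient.mk v) = j v := fun v => rfl
  have hJle : ∀ v, ‖J v‖ ≤ ‖v‖ := by
    intro v
    obtain ⟨v, rfl⟩ := SeparationQuotient.surjective_mk v
    rw [hJ, SeparationQuotient.norm_mk]
    exact hj v
  let J' := ContinuousLinearMap.adjoint J
  have hJ' : ∀ k v, inner ℝ (J' k) v = inner ℝ k (J v) :=
    fun k v => ContinuousLinearMap.adjoint_inner_left J v k
  refine ⟨J ∘L J', fun x y => ?_, fun h hh => ?_, fun h => ?_, ?_, fun f k => ⟨?_, ?_⟩⟩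
  · simp only [ContinuousLinearMap.comp_apply]
    rw [← hJ' x, real_inner_comm, ← hJ' y, real_inner_comm]
  · have h0 : J' h = 0 := by
      rw [← inner_self_eq_zero (𝕜 := ℝ), hJ']
      have hh : J (J' h) = 0 := hh
      rw [hh, inner_zero_right]
    refine hdense h fun v => ?_
    rw [← hJ, ← hJ', h0, inner_zero_left]
  · simp only [ContinuousLinearMap.comp_apply]
    rw [real_inner_comm, ← hJ', real_inner_self_eq_norm_sq]
    exact pow_le_pow_left₀ (norm_nonneg _) (hJle _) 2
  · refine IsCompactOperator.comp_clm ?_ J'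
    change IsCompactOperator (J : SeparationQuotient V →ₗ[ℝ] H)
    rw [isCompactOperator_iff_isCompact_closure_image_closedBall _ one_pos]
    refine (TotallyBounded.closure (TotallyBounded.subset ?_ htb)).isCompact_of_isClosed
      isClosed_closure
    rintro _ ⟨v, hv, rfl⟩
    obtain ⟨v, rfl⟩ := SeparationQuotient.surjective_mk v
    rw [mem_closedBall_zero_iff, SeparationQuotient.norm_mk] at hv
    exact ⟨v, mem_closedBall_zero_iff.2 hv, rfl⟩
  · intro hf
    obtain ⟨u, hu⟩ := SeparationQuotient.surjective_mk (J' k)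
    refine ⟨u, ?_, fun v => ?_⟩
    · rw [← hJ, hu, hf]
      rfl
    · rw [← SeparationQuotient.inner_mk_mk, hu, hJ', hJ]
  · rintro ⟨u, rfl, hu⟩
    have : J' k = SeparationQuotient.mk u := by
      refine ext_inner_right ℝ fun v => ?_
      obtain ⟨v, rfl⟩ := SeparationQuotient.surjective_mk v
      rw [hJ', hJ, SeparationQuotient.inner_mk_mk, hu]
    rw [ContinuousLinearMap.comp_apply, this, hJ]

/-- An image of the unit ball is totally bounded if the map is, up to small errors, controlled by
finitely many bounded linear functionals. -/
theorem totallyBounded_image_closedBall {V : Type*} [SeminormedAddCommGroup V]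
    [InnerProductSpace ℝ V] (j : V →L[ℝ] H)
    (hcpt : ∀ ε > 0, ∃ (ι : Type) (_ : Fintype ι) (φ : ι → V →ₗ[ℝ] ℝ) (C M : ℝ),
      (∀ i u, |φ i u| ≤ C * ‖u‖) ∧ ∀ u, ‖j u‖ ≤ ε * ‖u‖ + M * ∑ i, |φ i u|) :
    TotallyBounded (j '' Metric.closedBall 0 1) := by
  rw [Metric.totallyBounded_iff]
  intro ε hε
  obtain ⟨ι, _, φ, C, M, hC, hM⟩ := hcpt (ε / 4) (by positivity)
  -- Φ sends the unit ball to a bounded, hence totally bounded, subset of a finite-dimensional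
  -- space. A finite net there is pulled back to points of the unit ball.
  let Φ : V → ι → ℝ := fun u i => φ i u
  have hbdd : Bornology.IsBounded (Φ '' Metric.closedBall 0 1) := by
    refine (Metric.isBounded_closedBall (x := (0 : ι → ℝ)) (r := |C|)).subset ?_
    rintro _ ⟨u, hu, rfl⟩
    rw [mem_closedBall_zero_iff] at hu ⊢
    refine (pi_norm_le_iff_of_nonneg (abs_nonneg C)).2 fun i => ?_
    have h1 : C * ‖u‖ ≤ |C| * 1 :=
      mul_le_mul (le_abs_self C) hu (norm_nonneg _) (abs_nonneg C)
    exact (hC i u).trans (by linarith)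
  have htb := TotallyBounded.subset subset_closure hbdd.isCompact_closure.totallyBounded
  -- With this δ the functionals contribute at most ε/4. The other term is at most (ε/4)·2, since
  -- differences in the unit ball have norm at most 2; the total stays below ε.
  let δ : ℝ := ε / (4 * (|M| * Fintype.card ι + 1))
  have hδ : 0 < δ := by positivity
  obtain ⟨t, hts, htfin, ht⟩ := Metric.finite_approx_of_totallyBounded htb δ hδ
  choose! s hs1 hs2 using (fun y (hy : y ∈ t) => hts hy :
    ∀ y ∈ t, ∃ u, u ∈ Metric.closedBall (0 : V) 1 ∧ Φ u = y)
  refine ⟨(fun y => j (s y)) '' t, htfin.image _, ?_⟩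
  rintro _ ⟨u, hu, rfl⟩
  have hmem := ht ⟨u, hu, rfl⟩
  simp only [mem_iUnion, Metric.mem_ball, exists_prop] at hmem
  obtain ⟨y, hyt, hy⟩ := hmem
  simp only [mem_iUnion, Metric.mem_ball, exists_prop]
  refine ⟨j (s y), ⟨y, hyt, rfl⟩, ?_⟩
  rw [dist_eq_norm, ← map_sub]
  have hn : ‖u - s y‖ ≤ 2 := by
    have h1 := mem_closedBall_zero_iff.1 hu
    have h2 := mem_closedBall_zero_iff.1 (hs1 y hyt)
    linarith [norm_sub_le u (s y)]
  have hφ : ∀ i, |φ i (u - s y)| ≤ δ := by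
    intro i
    have h1 := (dist_le_pi_dist (Φ u) y i).trans hy.le
    rw [← hs2 y hyt, Real.dist_eq] at h1
    rwa [map_sub]
  have hsum : ∑ i, |φ i (u - s y)| ≤ Fintype.card ι * δ := by
    have := Finset.sum_le_sum fun i (_ : i ∈ Finset.univ) => hφ i
    simpa using this
  have h0 : 0 ≤ ∑ i, |φ i (u - s y)| := Finset.sum_nonneg fun i _ => abs_nonneg _
  have hMle : M * ∑ i, |φ i (u - s y)| ≤ |M| * (Fintype.card ι * δ) :=
    mul_le_mul (le_abs_self M) hsum h0 (abs_nonneg M)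
  have hδ' : |M| * (Fintype.card ι * δ) ≤ ε / 4 := by
    have h1 : (4 * (|M| * Fintype.card ι + 1)) * δ = ε := mul_div_cancel₀ _ (by positivity)
    nlinarith
  have := hM (u - s y)
  nlinarith

/-- In the inner product ⟨u, v⟩ = a(u, v) + ⟨j u, j v⟩, the weak equation a(u, v) = ⟨g, j v⟩ with j
u = f reads ⟨u, v⟩ = ⟨f + g, j v⟩, so the Riesz representation of the right-hand side solves it. The
hypotheses are stated through a and j alone, so that V needs no prior norm. -/
theorem exists_resolvent [CompleteSpace H] {V : Type*} [AddCommGroup V] [Module ℝ V]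
    (a : V →ₗ[ℝ] V →ₗ[ℝ] ℝ)
    (j : V →ₗ[ℝ] H) (hsymm : ∀ u v, a u v = a v u) (hnn : ∀ u, 0 ≤ a u u)
    (hcomplete : ∀ s : ℕ → V,
      (∀ ε > 0, ∃ n₀, ∀ m ≥ n₀, ∀ n ≥ n₀,
        a (s m - s n) (s m - s n) + ‖j (s m - s n)‖ ^ 2 < ε) →
      ∃ u, Tendsto (fun n => a (s n - u) (s n - u) + ‖j (s n - u)‖ ^ 2) atTop (𝓝 0))
    (hdense : ∀ h : H, (∀ v, inner ℝ h (j v) = 0) → h = 0)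
    (hcpt : ∀ ε > 0, ∃ (ι : Type) (_ : Fintype ι) (φ : ι → V →ₗ[ℝ] ℝ) (C M : ℝ),
      (∀ i u, |φ i u| ≤ C * √(a u u + ‖j u‖ ^ 2)) ∧
      ∀ u, ‖j u‖ ≤ ε * √(a u u + ‖j u‖ ^ 2) + M * ∑ i, |φ i u|) :
    ∃ S : H →L[ℝ] H, (∀ x y, inner ℝ (S x) y = inner ℝ x (S y)) ∧ (∀ h, S h = 0 → h = 0) ∧
      (∀ h, ‖S h‖ ^ 2 ≤ inner ℝ (S h) h) ∧ IsCompactOperator S ∧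
      ∀ f g, f = S (f + g) ↔ ∃ u, j u = f ∧ ∀ v, a u v = inner ℝ g (j v) := by
  let core : PreInnerProductSpace.Core ℝ V :=
    { inner := fun u v => a u v + inner ℝ (j u) (j v)
      conj_inner_symm := fun u v => by
        simp only [conj_trivial]
        rw [hsymm, real_inner_comm]
      re_inner_nonneg := fun u => by
        simp only [RCLike.re_to_real]
        exact add_nonneg (hnn u) real_inner_self_nonneg
      add_left := fun u v w => by
        simp only [map_add, LinearMap.add_apply, inner_add_left]
        ring
      smul_left := fun u v r => by
        simp only [map_smul, LinearMap.smul_apply, inner_smul_left, smul_eq_mul, conj_trivial]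
        ring }
  let _ : SeminormedAddCommGroup V := InnerProductSpace.Core.toSeminormedAddCommGroup (𝕜 := ℝ)
  let _ : InnerProductSpace ℝ V := InnerProductSpace.ofCore core
  have hinner : ∀ u v : V, inner ℝ u v = a u v + inner ℝ (j u) (j v) := fun u v => rfl
  have hnormsq : ∀ u : V, ‖u‖ ^ 2 = a u u + ‖j u‖ ^ 2 := fun u => by
    rw [← real_inner_self_eq_norm_sq, hinner, real_inner_self_eq_norm_sq]
  have hnorm : ∀ u : V, √(a u u + ‖j u‖ ^ 2) = ‖u‖ := fun u => by
    rw [← hnormsq, Real.sqrt_sq (norm_nonneg _)]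
  have hj : ∀ u, ‖j u‖ ≤ ‖u‖ := fun u => by
    refine le_of_sq_le_sq ?_ (norm_nonneg _)
    rw [hnormsq]
    linarith [hnn u]
  let jc : V →L[ℝ] H := j.mkContinuous 1 fun u => by simpa using hj u
  have hcs : CompleteSpace V := by
    refine Metric.complete_of_cauchySeq_tendsto fun s hs => ?_
    obtain ⟨u, hu⟩ := hcomplete s fun ε hε => by
      obtain ⟨n₀, hn₀⟩ := Metric.cauchySeq_iff.1 hs (√ε) (Real.sqrt_pos.2 hε)
      refine ⟨n₀, fun m hm n hn => ?_⟩
      have h1 := hn₀ m hm n hn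
      rw [dist_eq_norm] at h1
      rw [← hnormsq, ← Real.sq_sqrt hε.le]
      exact pow_lt_pow_left₀ h1 (norm_nonneg _) two_ne_zero
    refine ⟨u, tendsto_iff_norm_sub_tendsto_zero.2 ?_⟩
    have h1 := (Real.continuous_sqrt.tendsto 0).comp hu
    rw [Real.sqrt_zero] at h1
    exact h1.congr fun n => hnorm _
  obtain ⟨S, h1, h2, h3, h4, h5⟩ := exists_resolvent_of_complete jc hj hdense
    (totallyBounded_image_closedBall jc fun ε hε => by
      obtain ⟨ι, hι, φ, C, M, hC, hM⟩ := hcpt ε hε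
      simp only [hnorm] at hC hM
      exact ⟨ι, hι, φ, C, M, hC, hM⟩)
  refine ⟨S, h1, h2, h3, h4, fun f g => (h5 f (f + g)).trans ?_⟩
  refine exists_congr fun u => and_congr_right fun hu => forall_congr' fun v => ?_
  have hu : j u = f := hu
  rw [hinner, hu, inner_add_left]
  change _ + _ = _ + inner ℝ g (j v) ↔ _
  constructor <;> intro h
  · have h' : a u v + inner ℝ f (j v) = inner ℝ f (j v) + inner ℝ g (j v) := h
    linarith
  · change a u v + inner ℝ f (j v) = inner ℝ f (j v) + inner ℝ g (j v)
    linarith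

end Form

/-! ### The Sobolev space `H¹[0,1]` -/

section H1

theorem integrableOn_of_memLp_two {h : ℝ → ℝ} (hh : MemLp h 2 (volume.restrict (Icc 0 1))) {s t : ℝ}
    (hs : s ∈ Icc (0 : ℝ) 1) (ht : t ∈ Icc (0 : ℝ) 1) :
    IntervalIntegrable h volume s t ∧ IntervalIntegrable (fun x => h x ^ 2) volume s t := by
  have hsub : uIcc s t ⊆ Icc 0 1 := uIcc_subset_Icc hs ht
  constructor
  · exact intervalIntegrable_iff.2 ((show IntegrableOn h (Icc 0 1) volume from
      hh.integrable one_le_two).mono_set (uIoc_subset_uIcc.trans hsub))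
  · exact intervalIntegrable_iff.2 ((show IntegrableOn (fun x => h x ^ 2) (Icc 0 1) volume from
      hh.integrable_sq).mono_set (uIoc_subset_uIcc.trans hsub))

/-- Cauchy–Schwarz in variance form: expand ∫ (h - c)² ≥ 0 with c the mean of h over [s, t]. -/
theorem sq_intervalIntegral_le {h : ℝ → ℝ} (hh : MemLp h 2 (volume.restrict (Icc 0 1))) {s t : ℝ}
    (hs : s ∈ Icc (0 : ℝ) 1) (ht : t ∈ Icc (0 : ℝ) 1) :
    (∫ x in s..t, h x) ^ 2 ≤ |t - s| * ∫ x in (0 : ℝ)..1, h x ^ 2 := by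
  wlog hst : s ≤ t generalizing s t
  · have := this ht hs (le_of_not_ge hst)
    rwa [intervalIntegral.integral_symm, neg_sq, abs_sub_comm] at this
  obtain ⟨h1, h2⟩ := integrableOn_of_memLp_two hh hs ht
  have hmono : ∫ x in s..t, h x ^ 2 ≤ ∫ x in (0 : ℝ)..1, h x ^ 2 :=
    intervalIntegral.integral_mono_interval hs.1 hst ht.2
      (Eventually.of_forall fun x => sq_nonneg (h x))
      (integrableOn_of_memLp_two hh (left_mem_Icc.2 zero_le_one) (right_mem_Icc.2 zero_le_one)).2
  rcases hst.eq_or_lt with rfl | hlt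
  · simp
  rw [abs_of_pos (sub_pos.2 hlt)]
  set I := ∫ x in s..t, h x with hI
  set c := I / (t - s) with hc
  have hnn : 0 ≤ ∫ x in s..t, (h x - c) ^ 2 :=
    intervalIntegral.integral_nonneg hst fun x _ => sq_nonneg _
  have hexp : ∫ x in s..t, (h x - c) ^ 2 =
      (∫ x in s..t, h x ^ 2) - 2 * c * I + c ^ 2 * (t - s) := by
    have : ∀ x, (h x - c) ^ 2 = h x ^ 2 - 2 * c * h x + c ^ 2 := fun x => by ring
    simp only [this]
    rw [intervalIntegral.integral_add (h2.sub (h1.const_mul _)) intervalIntegrable_const,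
      intervalIntegral.integral_sub h2 (h1.const_mul _), intervalIntegral.integral_const_mul,
      intervalIntegral.integral_const, smul_eq_mul]
    ring
  rw [hexp] at hnn
  have hpos := sub_pos.2 hlt
  have hcI : c * (t - s) = I := div_mul_cancel₀ _ hpos.ne'
  have : I ^ 2 ≤ (t - s) * ∫ x in s..t, h x ^ 2 := by
    have : I ^ 2 = (t - s) * (2 * c * I - c ^ 2 * (t - s)) := by rw [← hcI]; ring
    rw [this]
    exact mul_le_mul_of_nonneg_left (by linarith) hpos.le
  exact this.trans (mul_le_mul_of_nonneg_left hmono hpos.le)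

namespace MemH1

/-- `deriv` is additive only where both functions are differentiable. Absolute continuity provides
this almost everywhere, which is what makes the weak derivative a linear map into L². -/
theorem ae_differentiableAt {f : ℝ → ℝ} (hf : MemH1 f) :
    ∀ᵐ t ∂volume.restrict (Icc (0 : ℝ) 1), DifferentiableAt ℝ f t := by
  rw [ae_restrict_iff' measurableSet_Icc]
  have := hf.1.ae_differentiableAt
  rwa [uIcc_of_le zero_le_one] at this

theorem deriv_add_ae {f g : ℝ → ℝ} (hf : MemH1 f) (hg : MemH1 g) :
    deriv (f + g) =ᵐ[volume.restrict (Icc 0 1)] deriv f + deriv g := by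
  filter_upwards [hf.ae_differentiableAt, hg.ae_differentiableAt] with t h1 h2
  exact deriv_add h1 h2

theorem deriv_const_smul_ae {f : ℝ → ℝ} (hf : MemH1 f) (c : ℝ) :
    deriv (c • f) =ᵐ[volume.restrict (Icc 0 1)] c • deriv f := by
  filter_upwards [hf.ae_differentiableAt] with t h1
  exact deriv_const_smul c h1

theorem add {f g : ℝ → ℝ} (hf : MemH1 f) (hg : MemH1 g) : MemH1 (f + g) :=
  ⟨hf.1.add hg.1, (hf.2.add hg.2).ae_eq (hf.deriv_add_ae hg).symm⟩

theorem const_smul {f : ℝ → ℝ} (hf : MemH1 f) (c : ℝ) : MemH1 (c • f) :=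
  ⟨hf.1.const_smul c, (hf.2.const_smul c).ae_eq (hf.deriv_const_smul_ae c).symm⟩

theorem of_lipschitzWith {f : ℝ → ℝ} {C : ℝ≥0} (hf : LipschitzWith C f) : MemH1 f := by
  refine ⟨(hf.lipschitzOnWith (s := uIcc 0 1)).absolutelyContinuousOnInterval, ?_⟩
  refine MemLp.of_bound (measurable_deriv f).aestronglyMeasurable C
    (Eventually.of_forall fun t => norm_deriv_le_of_lipschitz hf)

theorem zero : MemH1 0 :=
  of_lipschitzWith (C := 0) (LipschitzWith.const 0)

theorem deriv_sub_ae {f g : ℝ → ℝ} (hf : MemH1 f) (hg : MemH1 g) :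
    deriv (f - g) =ᵐ[volume.restrict (Icc 0 1)] deriv f - deriv g := by
  filter_upwards [hf.ae_differentiableAt, hg.ae_differentiableAt] with t h1 h2
  exact deriv_sub h1 h2

theorem integral_deriv {f : ℝ → ℝ} (hf : MemH1 f) {s t : ℝ} (hs : s ∈ Icc (0 : ℝ) 1)
    (ht : t ∈ Icc (0 : ℝ) 1) : ∫ x in s..t, deriv f x = f t - f s := by
  refine AbsolutelyContinuousOnInterval.integral_deriv_eq_sub (hf.1.mono ?_)
  rw [uIcc_of_le zero_le_one]
  exact uIcc_subset_Icc hs ht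

/-- The Morrey estimate. -/
theorem sq_sub_le {f : ℝ → ℝ} (hf : MemH1 f) {s t : ℝ} (hs : s ∈ Icc (0 : ℝ) 1)
    (ht : t ∈ Icc (0 : ℝ) 1) :
    (f t - f s) ^ 2 ≤ |t - s| * ∫ x in (0 : ℝ)..1, deriv f x ^ 2 := by
  rw [← hf.integral_deriv hs ht]
  exact sq_intervalIntegral_le hf.2 hs ht

end MemH1

theorem norm_toLp_sq {f : ℝ → ℝ} (hf : MemLp f 2 (volume.restrict (Icc 0 1))) :
    ‖hf.toLp f‖ ^ 2 = ∫ t in (0 : ℝ)..1, f t ^ 2 := by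
  rw [← real_inner_self_eq_norm_sq, L2.inner_def, intervalIntegral.integral_of_le zero_le_one,
    ← integral_Icc_eq_integral_Ioc]
  refine integral_congr_ae ?_
  filter_upwards [hf.coeFn_toLp] with t ht
  rw [ht]
  simp [sq]

/-- The space `H¹[0,1]`. -/
def H1 : Submodule ℝ (ℝ → ℝ) where
  carrier := {f | MemH1 f}
  add_mem' := MemH1.add
  zero_mem' := MemH1.zero
  smul_mem' c _ hf := hf.const_smul c

/-- The weak derivative of an `H¹` function as an element of `L²[0,1]`. -/
def H1.derivLp : H1 →ₗ[ℝ] Lp ℝ 2 (volume.restrict (Icc (0 : ℝ) 1)) where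
  toFun f := f.2.2.toLp (deriv f.1)
  map_add' f g := by
    rw [← MemLp.toLp_add]
    exact MemLp.toLp_congr _ _ (MemH1.deriv_add_ae f.2 g.2)
  map_smul' c f := by
    rw [RingHom.id_apply, ← MemLp.toLp_const_smul]
    exact MemLp.toLp_congr _ _ (MemH1.deriv_const_smul_ae f.2 c)

theorem H1.norm_derivLp_sq (f : H1) : ‖H1.derivLp f‖ ^ 2 = ∫ t in (0 : ℝ)..1, deriv f.1 t ^ 2 :=
  norm_toLp_sq f.2.2

/-- `H¹[0,1]` is complete: a pointwise limit of functions in `H¹` whose derivatives form a Cauchy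
sequence in `L²` is in `H¹`, and the derivatives converge to its derivative. -/
theorem MemH1.of_tendsto {f : ℕ → ℝ → ℝ} (hf : ∀ n, MemH1 (f n)) {g : ℝ → ℝ}
    (hlim : ∀ t ∈ Icc (0 : ℝ) 1, Tendsto (fun n => f n t) atTop (𝓝 (g t)))
    (hcauchy : ∀ ε > 0, ∃ n₀, ∀ m ≥ n₀, ∀ n ≥ n₀,
      ∫ t in (0 : ℝ)..1, deriv (f m - f n) t ^ 2 < ε) :
    MemH1 g ∧ Tendsto (fun n => ∫ t in (0 : ℝ)..1, deriv (f n - g) t ^ 2) atTop (𝓝 0) := by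
  let φ : ℕ → H1 := fun n => ⟨f n, hf n⟩
  have hC : CauchySeq fun n => H1.derivLp (φ n) := by
    refine Metric.cauchySeq_iff.2 fun ε hε => ?_
    obtain ⟨n₀, h⟩ := hcauchy (ε ^ 2) (by positivity)
    refine ⟨n₀, fun m hm n hn => ?_⟩
    rw [dist_eq_norm, ← map_sub]
    refine lt_of_pow_lt_pow_left₀ 2 hε.le ?_
    rw [H1.norm_derivLp_sq]
    exact h m hm n hn
  obtain ⟨G, hG⟩ := cauchySeq_tendsto_of_complete hC
  have hGm : MemLp G 2 (volume.restrict (Icc (0 : ℝ) 1)) := Lp.memLp G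
  have hnorm : ∀ n, ‖H1.derivLp (φ n) - G‖ ^ 2 = ∫ x in (0 : ℝ)..1, (deriv (f n) x - G x) ^ 2 := by
    intro n
    have : H1.derivLp (φ n) - G = ((hf n).2.sub hGm).toLp (deriv (f n) - (G : ℝ → ℝ)) := by
      rw [MemLp.toLp_sub (hf n).2 hGm, Lp.toLp_coeFn]
      rfl
    rw [this, norm_toLp_sq]
    rfl
  have h0 : Tendsto (fun n => ∫ x in (0 : ℝ)..1, (deriv (f n) x - G x) ^ 2) atTop (𝓝 0) := by
    have := (tendsto_iff_norm_sub_tendsto_zero.1 hG).pow 2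
    simp only [hnorm] at this
    simpa using this
  have h01 : (0 : ℝ) ∈ Icc (0 : ℝ) 1 := left_mem_Icc.2 zero_le_one
  have h11 : (1 : ℝ) ∈ Icc (0 : ℝ) 1 := right_mem_Icc.2 zero_le_one
  -- The fundamental theorem of calculus for f n passes to the limit, because L² convergence of the
  -- derivatives gives convergence of their integrals over [0, t].
  have hrep : ∀ t ∈ Icc (0 : ℝ) 1, g t = g 0 + ∫ x in (0 : ℝ)..t, G x := by
    intro t ht
    have hI : Tendsto (fun n => ∫ x in (0 : ℝ)..t, (deriv (f n) x - G x)) atTop (𝓝 0) := by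
      refine squeeze_zero_norm (a := fun n => √(∫ x in (0 : ℝ)..1, (deriv (f n) x - G x) ^ 2))
        (fun n => ?_) ?_
      · refine Real.abs_le_sqrt ?_
        have h1 := sq_intervalIntegral_le ((hf n).2.sub hGm) h01 ht
        simp only [Pi.sub_apply] at h1
        refine h1.trans (mul_le_of_le_one_left ?_ ?_)
        · exact intervalIntegral.integral_nonneg zero_le_one fun x _ => sq_nonneg _
        · rw [sub_zero, abs_of_nonneg ht.1]
          exact ht.2
      · have := (Real.continuous_sqrt.tendsto 0).comp h0
        rwa [Real.sqrt_zero] at this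
    have hsplit : ∀ n, ∫ x in (0 : ℝ)..t, (deriv (f n) x - G x)
        = (f n t - f n 0) - ∫ x in (0 : ℝ)..t, G x := by
      intro n
      rw [intervalIntegral.integral_sub (integrableOn_of_memLp_two (hf n).2 h01 ht).1
        (integrableOn_of_memLp_two hGm h01 ht).1, (hf n).integral_deriv h01 ht]
    simp only [hsplit] at hI
    have h2 := ((hlim t ht).sub (hlim 0 h01)).sub_const (∫ x in (0 : ℝ)..t, G x)
    linarith [tendsto_nhds_unique h2 hI]
  have hGi := (integrableOn_of_memLp_two hGm h01 h11).1
  have hgAC : AbsolutelyContinuousOnInterval g 0 1 := by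
    have h1 : AbsolutelyContinuousOnInterval (fun t => g 0 + ∫ x in (0 : ℝ)..t, G x) 0 1 :=
      ((LipschitzWith.const (g 0)).lipschitzOnWith
        (s := uIcc 0 1)).absolutelyContinuousOnInterval.add
        (hGi.absolutelyContinuousOnInterval_intervalIntegral (c := 0) (by simp))
    -- The representation holds only on [0, 1], so absolute continuity is transferred through its
    -- definition, which evaluates the functions only there.
    rw [absolutelyContinuousOnInterval_iff] at h1 ⊢
    intro ε hε
    obtain ⟨δ, hδ, h⟩ := h1 ε hε
    refine ⟨δ, hδ, fun E hE hEδ => ?_⟩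
    refine (Finset.sum_congr rfl fun i hi => ?_).trans_lt (h E hE hEδ)
    have hmem := hE.1 i hi
    rw [uIcc_of_le zero_le_one] at hmem
    rw [hrep _ hmem.1, hrep _ hmem.2]
  have hderiv : deriv g =ᵐ[volume.restrict (Icc 0 1)] G := by
    have h1 := hGi.ae_hasDerivAt_integral
    -- Restriction to the open interval is needed: at the endpoints `deriv g` also depends on values
    -- of g outside [0, 1]. The endpoints form a null set.
    have h3 : ∀ᵐ t ∂volume.restrict (Ioo (0 : ℝ) 1), deriv g t = G t := by
      rw [ae_restrict_iff' measurableSet_Ioo]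
      filter_upwards [h1] with t ht htm
      rw [uIcc_of_le zero_le_one] at ht
      have h2 := (ht (Ioo_subset_Icc_self htm) 0 h01).const_add (g 0)
      refine (h2.congr_of_eventuallyEq ?_).deriv
      filter_upwards [Ioo_mem_nhds htm.1 htm.2] with s hs
      exact hrep s (Ioo_subset_Icc_self hs)
    rwa [Measure.restrict_congr_set Ioo_ae_eq_Icc] at h3
  have hg : MemH1 g := ⟨hgAC, hGm.ae_eq hderiv.symm⟩
  refine ⟨hg, h0.congr fun n => ?_⟩
  rw [intervalIntegral.integral_of_le zero_le_one, intervalIntegral.integral_of_le zero_le_one,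
    ← integral_Icc_eq_integral_Ioc, ← integral_Icc_eq_integral_Ioc]
  refine integral_congr_ae ?_
  filter_upwards [(hf n).deriv_sub_ae hg, hderiv] with t h1 h2
  rw [h1, Pi.sub_apply, h2]

end H1

/-! ### Geometry of the stretched fractal -/

section Words

variable {d N : ℕ}

theorem wordMap_append (f : Fin N → Eu d → Eu d) (v w : List (Fin N)) (x : Eu d) :
    wordMap f (v ++ w) x = wordMap f v (wordMap f w x) := by
  induction v with
  | nil => rfl
  | cons i v ih => exact congrArg (f i) ih

theorem mapsTo_wordMap {f : Fin N → Eu d → Eu d} {X : Set (Eu d)}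
    (h : ∀ i, MapsTo (f i) X X) (w : List (Fin N)) : MapsTo (wordMap f w) X X := by
  induction w with
  | nil => exact mapsTo_id X
  | cons i w ih => exact (h i).comp ih

theorem dist_wordMap_le {f : Fin N → Eu d → Eu d} {r : ℝ} (hr : 0 ≤ r)
    (h : ∀ i x y, dist (f i x) (f i y) ≤ r * dist x y) (w : List (Fin N)) (x y : Eu d) :
    dist (wordMap f w x) (wordMap f w y) ≤ r ^ w.length * dist x y := by
  induction w with
  | nil => simp [wordMap]
  | cons i w ih =>
    refine (h i _ _).trans ?_
    rw [List.length_cons, pow_succ', mul_assoc]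
    exact mul_le_mul_of_nonneg_left ih hr

end Words

/-! ### Contractions, vertices, and the cells and lines of K -/

namespace StretchedFractal

variable {d N : ℕ} (T : StretchedFractal d N)

theorem dist_G (i : Fin N) (x y : Eu d) :
    dist (T.G i x) (T.G i y) = T.α * T.ratio i * dist x y := by
  simp only [G, dist_add_right]
  rw [dist_smul₀, dist_sub_right, T.dist_map, Real.norm_of_nonneg T.α_pos.le, mul_assoc]

theorem dist_G_le (i : Fin N) (x y : Eu d) : dist (T.G i x) (T.G i y) ≤ T.α * dist x y := by
  rw [dist_G]
  exact mul_le_mul_of_nonneg_right (mul_le_of_le_one_right T.α_pos.le (T.ratio_lt_one i).le)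
    dist_nonneg

theorem G_injective (i : Fin N) : Function.Injective (T.G i) := by
  intro x y h
  rw [← dist_eq_zero, dist_G] at h
  exact dist_eq_zero.1 ((mul_eq_zero.1 h).resolve_left
    (mul_pos T.α_pos (T.ratio_pos i)).ne')

theorem dist_wordMap_G_le (w : List (Fin N)) (x y : Eu d) :
    dist (wordMap T.G w x) (wordMap T.G w y) ≤ T.α ^ w.length * dist x y :=
  dist_wordMap_le T.α_pos.le T.dist_G_le w x y

theorem lipschitzWith_wordMap_G (w : List (Fin N)) : LipschitzWith 1 (wordMap T.G w) := by
  refine LipschitzWith.of_dist_le_mul fun x y => (T.dist_wordMap_G_le w x y).trans ?_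
  exact mul_le_mul_of_nonneg_right (pow_le_one₀ T.α_pos.le T.α_lt_one.le) dist_nonneg

theorem G_fixedPt (i : Fin N) : T.G i (T.fixedPt i) = T.fixedPt i := by
  simp [G, T.map_fixedPt]

theorem K_nonempty : T.K.Nonempty := T.isAttractor_K.1

theorem isCompact_K : IsCompact T.K := T.isAttractor_K.2.1

theorem mapsTo_G_K (i : Fin N) : MapsTo (T.G i) T.K T.K := by
  intro x hx
  rw [T.isAttractor_K.2.2]
  exact Or.inl (mem_iUnion.2 ⟨i, x, hx, rfl⟩)

theorem edge_subset_K (b : T.Branch) : T.edge b ⊆ T.K := by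
  intro x hx
  rw [T.isAttractor_K.2.2]
  exact Or.inr (mem_iUnion.2 ⟨b, hx⟩)

theorem mapsTo_wordMap_K (w : List (Fin N)) : MapsTo (wordMap T.G w) T.K T.K :=
  mapsTo_wordMap T.mapsTo_G_K w

theorem exists_dist_le_K : ∃ D, 0 < D ∧ ∀ x ∈ T.K, ∀ y ∈ T.K, dist x y ≤ D := by
  obtain ⟨D, hD⟩ := Metric.isBounded_iff.1 T.isCompact_K.isBounded
  exact ⟨max D 1, by positivity, fun x hx y hy => (hD hx hy).trans (le_max_left _ _)⟩

theorem tendsto_α_pow_mul (C : ℝ) : Tendsto (fun n : ℕ => T.α ^ n * C) atTop (𝓝 0) := by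
  simpa using (tendsto_pow_atTop_nhds_zero_of_lt_one T.α_pos.le T.α_lt_one).mul_const C

theorem fixedPt_mem_K (i : Fin N) : T.fixedPt i ∈ T.K := by
  obtain ⟨x, hx⟩ := T.K_nonempty
  refine T.isCompact_K.isClosed.mem_of_tendsto (f := fun n : ℕ =>
    wordMap T.G (List.replicate n i) x) (b := atTop) ?_
    (Eventually.of_forall fun n => T.mapsTo_wordMap_K _ hx)
  have hfix : ∀ n : ℕ, wordMap T.G (List.replicate n i) (T.fixedPt i) = T.fixedPt i := by
    intro n
    induction n with
    | zero => rfl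
    | succ n ih => exact (congrArg (T.G i) ih).trans (T.G_fixedPt i)
  rw [tendsto_iff_dist_tendsto_zero]
  refine squeeze_zero (fun _ => dist_nonneg) (fun n => ?_)
    (T.tendsto_α_pow_mul (dist x (T.fixedPt i)))
  have := T.dist_wordMap_G_le (List.replicate n i) x (T.fixedPt i)
  rwa [hfix, List.length_replicate] at this

theorem V₀_subset_K : T.V₀ ⊆ T.K := by
  intro x hx
  obtain ⟨b, v, -, rfl⟩ := mem_iUnion.1 hx
  exact T.mapsTo_wordMap_K v (T.fixedPt_mem_K _)

theorem ξ_zero (b : T.Branch) : T.ξ b 0 = T.crit b := by simp [ξ]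

theorem ξ_one (b : T.Branch) : T.ξ b 1 = T.tip b := by simp [ξ]

theorem edge_eq (b : T.Branch) : T.edge b = T.ξ b '' Icc 0 1 := by
  rw [edge, segment_eq_image]
  refine image_congr fun t _ => ?_
  rw [ξ, add_comm]

theorem ξ_mem_K (b : T.Branch) {t : ℝ} (ht : t ∈ Icc (0 : ℝ) 1) : T.ξ b t ∈ T.K := by
  refine T.edge_subset_K b ?_
  rw [edge_eq]
  exact mem_image_of_mem _ ht

theorem exists_lipschitzWith_ξ (b : T.Branch) : ∃ C, LipschitzWith C (T.ξ b) := by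
  refine ⟨‖T.tip b - T.crit b‖₊, LipschitzWith.of_dist_le_mul fun s t => ?_⟩
  have : T.ξ b s - T.ξ b t = (s - t) • (T.tip b - T.crit b) := by
    simp only [ξ]
    module
  rw [dist_eq_norm, this, norm_smul, Real.dist_eq, mul_comm]
  rfl

theorem exists_tip_eq (b : T.Branch) : ∃ p ∈ T.V₀, T.tip b = T.G b.1.2 p :=
  ⟨_, mem_iUnion.2 ⟨b, T.tail b, List.suffix_refl _, rfl⟩, rfl⟩

/-- V₀ is indexed by suffixes: dropping the first letter of a suffix leaves a suffix, and the empty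
word gives a fixed point, which its own contraction reproduces. So every vertex of a cell is also a
vertex of one of its subcells, and vertices of consecutive levels can be compared. -/
theorem exists_mem_V₀_eq_G {x : Eu d} (hx : x ∈ T.V₀) : ∃ i, ∃ p ∈ T.V₀, x = T.G i p := by
  obtain ⟨b, v, hv, rfl⟩ := mem_iUnion.1 hx
  cases v with
  | nil => exact ⟨T.foot b, T.fixedPt (T.foot b), hx, (T.G_fixedPt _).symm⟩
  | cons i v =>
    exact ⟨i, _, mem_iUnion.2 ⟨b, v, (List.suffix_cons i v).trans hv, rfl⟩, rfl⟩

/-- Up to finitely many lines, `K` consists of the cells of level `n`. -/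
theorem mem_cell_or_mem_edge (n : ℕ) {x : Eu d} (hx : x ∈ T.K) :
    (∃ w : List (Fin N), w.length = n ∧ ∃ y ∈ T.K, x = wordMap T.G w y) ∨
    ∃ w : List (Fin N), w.length < n ∧ ∃ b, ∃ t ∈ Icc (0 : ℝ) 1, x = wordMap T.G w (T.ξ b t) := by
  induction n with
  | zero => exact Or.inl ⟨[], rfl, x, hx, rfl⟩
  | succ n ih =>
    rcases ih with ⟨w, hw, y, hy, rfl⟩ | ⟨w, hw, h⟩
    · rw [T.isAttractor_K.2.2] at hy
      rcases hy with hy | hy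
      · obtain ⟨i, z, hz, rfl⟩ := mem_iUnion.1 hy
        refine Or.inl ⟨w ++ [i], by simp [hw], z, hz, ?_⟩
        rw [wordMap_append]
        rfl
      · obtain ⟨b, hb⟩ := mem_iUnion.1 hy
        rw [edge_eq] at hb
        obtain ⟨t, ht, rfl⟩ := hb
        exact Or.inr ⟨w, by omega, b, t, ht, rfl⟩
    · exact Or.inr ⟨w, by omega, h⟩

/-! Connectedness of the cell graph -/

/-- Two `1`-cells of the self-similar set are neighbours if they meet. -/
def Adjacent (i j : Fin N) : Prop :=
  i ≠ j ∧
    (T.map i '' T.toSimilitudeSystem.carrier ∩ T.map j '' T.toSimilitudeSystem.carrier).Nonempty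

theorem continuous_map (i : Fin N) : Continuous (T.map i) :=
  (LipschitzWith.of_dist_le_mul (K := ⟨T.ratio i, (T.ratio_pos i).le⟩)
    fun x y => (T.dist_map i x y).le).continuous

/-- Otherwise the cells reachable from i and the remaining cells would give two nonempty disjoint
closed sets covering the connected set F. -/
theorem reflTransGen_adjacent (i j : Fin N) : Relation.ReflTransGen T.Adjacent i j := by
  by_contra hij
  obtain ⟨hne, hcomp, heq⟩ := T.isAttractor_carrier
  rw [union_empty] at heq
  set F := T.toSimilitudeSystem.carrier with hF
  let I : Set (Fin N) := {k | Relation.ReflTransGen T.Adjacent i k}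
  let U : Set (Eu d) := ⋃ k ∈ I, T.map k '' F
  let V : Set (Eu d) := ⋃ k ∈ Iᶜ, T.map k '' F
  have hcl : ∀ J : Set (Fin N), IsClosed (⋃ k ∈ J, T.map k '' F) := fun J =>
    J.toFinite.isClosed_biUnion fun k _ => (hcomp.image (T.continuous_map k)).isClosed
  have hsub : F ⊆ U ∪ V := by
    intro x hx
    rw [heq] at hx
    obtain ⟨k, hk⟩ := mem_iUnion.1 hx
    by_cases h : k ∈ I
    · exact Or.inl (mem_biUnion h hk)
    · exact Or.inr (mem_biUnion h hk)
  have hmeet : ∀ (J : Set (Fin N)) (k : Fin N), k ∈ J → (F ∩ ⋃ k ∈ J, T.map k '' F).Nonempty := by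
    intro J k hk
    obtain ⟨x, hx⟩ := hne
    refine ⟨T.map k x, ?_, mem_biUnion hk ⟨x, hx, rfl⟩⟩
    rw [heq]
    exact mem_iUnion.2 ⟨k, x, hx, rfl⟩
  obtain ⟨x, -, hxU, hxV⟩ := isPreconnected_closed_iff.1 T.connected.isPreconnected U V (hcl I)
    (hcl Iᶜ) hsub (hmeet I i Relation.ReflTransGen.refl) (hmeet Iᶜ j hij)
  obtain ⟨k, hk, hxk⟩ := mem_iUnion₂.1 hxU
  obtain ⟨l, hl, hxl⟩ := mem_iUnion₂.1 hxV
  exact hl (hk.tail ⟨fun h => hl (h ▸ hk), x, hxk, hxl⟩)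

/-- A common point of two distinct cells is critical and has a line towards each of them. After
stretching, neighbouring cells are therefore still linked, by two lines that meet at this point. -/
theorem Adjacent.exists_branch {T : StretchedFractal d N} {i j : Fin N} (h : T.Adjacent i j) :
    ∃ b b' : T.Branch, b.1.2 = i ∧ b'.1.2 = j ∧ T.crit b = T.crit b' := by
  obtain ⟨hij, x, hi, hj⟩ := h
  exact ⟨⟨(x, i), ⟨i, j, hij, hi, hj⟩, hi⟩, ⟨(x, j), ⟨i, j, hij, hi, hj⟩, hj⟩, rfl, rfl, rfl⟩

instance nonempty_branch : Nonempty T.Branch := by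
  have h2 := T.two_le
  have h := T.reflTransGen_adjacent ⟨0, by omega⟩ ⟨1, by omega⟩
  rcases Relation.ReflTransGen.cases_head h with h | ⟨k, hk, -⟩
  · simp at h
  · exact ⟨hk.exists_branch.choose⟩

theorem V₀_nonempty : T.V₀.Nonempty := by
  obtain ⟨b⟩ := T.nonempty_branch
  exact ⟨_, mem_iUnion.2 ⟨b, T.tail b, List.suffix_refl _, rfl⟩⟩

/-! The coding map and the measures -/

theorem coding_mem_K (ω : ℕ → Fin N) : T.coding ω ∈ T.K := by
  obtain ⟨x, hx⟩ := T.K_nonempty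
  let W : ℕ → List (Fin N) := fun n => List.ofFn fun k : Fin n => ω k
  have hlen : ∀ n, (W n).length = n := fun n => List.length_ofFn
  have hsucc : ∀ n y, wordMap T.G (W (n + 1)) y = wordMap T.G (W n) (T.G (ω n) y) := by
    intro n y
    have : W (n + 1) = W n ++ [ω n] := by
      simp only [W, List.ofFn_succ_last]
      rfl
    rw [this, wordMap_append]
    rfl
  obtain ⟨D, hD, hDK⟩ := T.exists_dist_le_K
  have hcauchy : CauchySeq fun n => wordMap T.G (W n) x := by
    refine cauchySeq_of_le_geometric T.α D T.α_lt_one fun n => ?_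
    rw [hsucc]
    refine (T.dist_wordMap_G_le _ _ _).trans ?_
    rw [hlen, mul_comm]
    exact mul_le_mul_of_nonneg_right (hDK _ hx _ (T.mapsTo_G_K _ hx))
      (pow_nonneg T.α_pos.le n)
  obtain ⟨y, hy⟩ := cauchySeq_tendsto_of_complete hcauchy
  have hyK : y ∈ T.K := T.isCompact_K.isClosed.mem_of_tendsto hy
    (Eventually.of_forall fun n => T.mapsTo_wordMap_K _ hx)
  -- The coding map starts from 0, which need not lie in K. The contraction makes the starting point
  -- irrelevant in the limit.
  have h0 : Tendsto (fun n => wordMap T.G (W n) 0) atTop (𝓝 y) := by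
    refine tendsto_of_tendsto_of_dist hy ?_
    refine squeeze_zero (fun _ => dist_nonneg) (fun n => ?_) (T.tendsto_α_pow_mul (dist x 0))
    have := T.dist_wordMap_G_le (W n) x 0
    rwa [hlen] at this
  have : T.coding ω = y := h0.limUnder_eq
  rwa [this]

theorem μfrac_compl_K : T.μfrac T.Kᶜ = 0 := by
  rw [μfrac]
  -- Measurability of the coding map is not required here: the image under a map that is not a.e.
  -- measurable is the zero measure by convention.
  by_cases h : AEMeasurable T.coding (Measure.infinitePi fun _ : ℕ =>
      ProbabilityTheory.uniformOn (univ : Set (Fin N)))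
  · rw [Measure.map_apply_of_aemeasurable h T.isCompact_K.isClosed.measurableSet.compl]
    have : T.coding ⁻¹' T.Kᶜ = ∅ := by
      ext ω
      simpa using T.coding_mem_K ω
    rw [this, measure_empty]
  · rw [Measure.map_of_not_aemeasurable h]
    rfl

instance isFiniteMeasure_μfrac : IsFiniteMeasure T.μfrac := by
  have : NeZero N := ⟨by have := T.two_le; omega⟩
  rw [μfrac]
  infer_instance

theorem measurable_wordMap_ξ (w : List (Fin N)) (b : T.Branch) :
    Measurable (wordMap T.G w ∘ T.ξ b) := by
  obtain ⟨C, hC⟩ := T.exists_lipschitzWith_ξ b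
  exact ((T.lipschitzWith_wordMap_G w).continuous.comp hC.continuous).measurable

theorem μline_compl_K (a : T.Branch → ℝ) (β : ℝ) : T.μline a β T.Kᶜ = 0 := by
  have hm := T.isCompact_K.isClosed.measurableSet.compl
  rw [μline, Measure.sum_apply _ hm, ENNReal.tsum_eq_zero]
  intro w
  rw [Measure.finsetSum_apply, Finset.sum_eq_zero]
  intro b _
  rw [Measure.smul_apply, Measure.map_apply (T.measurable_wordMap_ξ w b) hm,
    Measure.restrict_apply' measurableSet_Icc]
  have : (wordMap T.G w ∘ T.ξ b) ⁻¹' T.Kᶜ ∩ Icc 0 1 = ∅ := by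
    ext t
    simp only [mem_inter_iff, mem_preimage, mem_compl_iff, mem_empty_iff_false, iff_false,
      not_and]
    exact fun h1 h2 => h1 (T.mapsTo_wordMap_K w (T.ξ_mem_K b h2))
  rw [this, measure_empty, smul_zero]

theorem μline_univ (a : T.Branch → ℝ) (β : ℝ) :
    T.μline a β univ = ∑' w : List (Fin N), ∑ b, ENNReal.ofReal (β ^ w.length * a b) := by
  rw [μline, Measure.sum_apply _ MeasurableSet.univ]
  refine tsum_congr fun w => ?_
  rw [Measure.finsetSum_apply]
  refine Finset.sum_congr rfl fun b _ => ?_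
  rw [Measure.smul_apply, Measure.map_apply (T.measurable_wordMap_ξ w b) MeasurableSet.univ]
  simp

/-- There are N^n words of length n, each of weight β^n times a constant, so the total mass is a
geometric series of ratio β N < 1. -/
theorem isFiniteMeasure_μline (a : T.Branch → ℝ) {β : ℝ} (hβ : 0 < β) (hβN : β < 1 / N) :
    IsFiniteMeasure (T.μline a β) := by
  refine ⟨?_⟩
  have hN : (0 : ℝ) < N := by
    have := T.two_le
    exact_mod_cast (by omega : 0 < N)
  have hβN' : β * N < 1 := by rwa [lt_div_iff₀ hN] at hβN
  have hterm : ∀ w : List (Fin N), ∑ b, ENNReal.ofReal (β ^ w.length * a b)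
      = ENNReal.ofReal β ^ w.length * ∑ b, ENNReal.ofReal (a b) := by
    intro w
    rw [Finset.mul_sum]
    refine Finset.sum_congr rfl fun b _ => ?_
    rw [ENNReal.ofReal_mul (pow_nonneg hβ.le _), ENNReal.ofReal_pow hβ.le]
  rw [μline_univ]
  simp only [hterm]
  rw [ENNReal.tsum_mul_right]
  refine ENNReal.mul_lt_top ?_ (ENNReal.sum_lt_top.2 fun b _ => ENNReal.ofReal_lt_top)
  rw [← List.equivSigmaTuple.symm.tsum_eq, ENNReal.tsum_sigma']
  have hgeom : ∀ n : ℕ, ∑' w : Fin n → Fin N,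
      ENNReal.ofReal β ^ (List.equivSigmaTuple.symm ⟨n, w⟩).length
      = ENNReal.ofReal (β * N) ^ n := by
    intro n
    have : ∀ w : Fin n → Fin N, (List.equivSigmaTuple.symm ⟨n, w⟩).length = n :=
      fun w => List.length_ofFn
    simp only [this]
    rw [tsum_fintype, Finset.sum_const, Finset.card_univ, Fintype.card_fun, Fintype.card_fin,
      Fintype.card_fin, nsmul_eq_mul, ENNReal.ofReal_mul hβ.le, ENNReal.ofReal_natCast, mul_pow,
      mul_comm, Nat.cast_pow]
  simp only [hgeom]
  rw [ENNReal.tsum_geometric]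
  refine ENNReal.inv_lt_top.2 (tsub_pos_of_lt ?_)
  rw [← ENNReal.ofReal_one]
  exact (ENNReal.ofReal_lt_ofReal_iff one_pos).2 hβN'

theorem μline_ne_zero (a : T.Branch → ℝ) (ha : ∀ b, 0 < a b) (β : ℝ) : T.μline a β univ ≠ 0 := by
  rw [μline_univ]
  intro h
  rw [ENNReal.tsum_eq_zero] at h
  have h0 := h []
  rw [Finset.sum_eq_zero_iff] at h0
  obtain ⟨b⟩ := T.nonempty_branch
  have := h0 b (Finset.mem_univ b)
  rw [List.length_nil, pow_zero, one_mul, ENNReal.ofReal_eq_zero] at this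
  exact absurd this (not_le.2 (ha b))

theorem μη_compl_K (a : T.Branch → ℝ) (β η : ℝ) : T.μη a β η T.Kᶜ = 0 := by
  rw [μη, Measure.add_apply, Measure.smul_apply, Measure.smul_apply, μline_compl_K, μfrac_compl_K]
  simp

theorem isFiniteMeasure_μη (a : T.Branch → ℝ) {β : ℝ} (hβ : 0 < β) (hβN : β < 1 / N) (η : ℝ) :
    IsFiniteMeasure (T.μη a β η) := by
  have := T.isFiniteMeasure_μline a hβ hβN
  have h1 : IsFiniteMeasure (ENNReal.ofReal η • T.μline a β) :=
    Measure.smul_finite _ ENNReal.ofReal_ne_top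
  have h2 : IsFiniteMeasure (ENNReal.ofReal (1 - η) • T.μfrac) :=
    Measure.smul_finite _ ENNReal.ofReal_ne_top
  rw [μη]
  infer_instance

theorem μη_univ_ne_zero (a : T.Branch → ℝ) (ha : ∀ b, 0 < a b) (β : ℝ) {η : ℝ} (hη : 0 < η) :
    T.μη a β η univ ≠ 0 := by
  rw [μη, Measure.add_apply, Measure.smul_apply]
  intro h
  rw [add_eq_zero, smul_eq_mul, mul_eq_zero] at h
  rcases h.1 with h | h
  · exact absurd (ENNReal.ofReal_eq_zero.1 h) (not_le.2 hη)
  · exact T.μline_ne_zero a ha β h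

end StretchedFractal

/-! ### Quadratic functions on a real vector space -/

section Quadratic

variable {V : Type*} [AddCommGroup V] [Module ℝ V]

/-- `q` is the diagonal of a symmetric bilinear form. -/
def IsQuadratic (q : V → ℝ) : Prop :=
  ∃ B : V →ₗ[ℝ] V →ₗ[ℝ] ℝ, (∀ u v, B u v = B v u) ∧ ∀ u, q u = B u u

namespace IsQuadratic

theorem sum {ι : Type*} {s : Finset ι} {q : ι → V → ℝ} (h : ∀ i ∈ s, IsQuadratic (q i)) :
    IsQuadratic fun u => ∑ i ∈ s, q i u := by
  choose! B hB1 hB2 using h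
  refine ⟨∑ i ∈ s, B i, fun u v => ?_, fun u => ?_⟩
  · simp only [LinearMap.sum_apply]
    exact Finset.sum_congr rfl fun i hi => hB1 i hi u v
  · simp only [LinearMap.sum_apply]
    exact Finset.sum_congr rfl fun i hi => hB2 i hi u

theorem add {p q : V → ℝ} (hp : IsQuadratic p) (hq : IsQuadratic q) :
    IsQuadratic fun u => p u + q u := by
  obtain ⟨B, hB1, hB2⟩ := hp
  obtain ⟨C, hC1, hC2⟩ := hq
  refine ⟨B + C, fun u v => ?_, fun u => ?_⟩
  · simp only [LinearMap.add_apply, hB1 u, hC1 u]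
  · simp only [LinearMap.add_apply, hB2, hC2]

theorem const_mul {q : V → ℝ} (hq : IsQuadratic q) (c : ℝ) : IsQuadratic fun u => c * q u := by
  obtain ⟨B, hB1, hB2⟩ := hq
  refine ⟨c • B, fun u v => ?_, fun u => ?_⟩
  · simp only [LinearMap.smul_apply, hB1 u]
  · simp only [LinearMap.smul_apply, hB2, smul_eq_mul]

theorem norm_sq {E : Type*} [NormedAddCommGroup E] [InnerProductSpace ℝ E] (L : V →ₗ[ℝ] E) :
    IsQuadratic fun u => ‖L u‖ ^ 2 := by
  refine ⟨(innerₗ E).compl₁₂ L L, fun u v => ?_, fun u => ?_⟩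
  · simp only [LinearMap.compl₁₂_apply, innerₗ_apply_apply]
    exact real_inner_comm _ _
  · simp only [LinearMap.compl₁₂_apply, innerₗ_apply_apply, real_inner_self_eq_norm_sq]

theorem sq (L : V →ₗ[ℝ] ℝ) : IsQuadratic fun u => L u ^ 2 := by
  simpa using norm_sq L

theorem parallelogram {q : V → ℝ} (hq : IsQuadratic q) (u v : V) :
    q (u + v) + q (u - v) = 2 * q u + 2 * q v := by
  obtain ⟨B, hB1, hB2⟩ := hq
  simp only [hB2, map_add, map_sub, LinearMap.add_apply, LinearMap.sub_apply]
  ring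

theorem smul {q : V → ℝ} (hq : IsQuadratic q) (c : ℝ) (u : V) : q (c • u) = c ^ 2 * q u := by
  obtain ⟨B, hB1, hB2⟩ := hq
  simp only [hB2, map_smul, LinearMap.smul_apply, smul_eq_mul]
  ring

/-- A pointwise limit of quadratic functions is quadratic. -/
theorem of_tendsto {q : ℕ → V → ℝ} (hq : ∀ n, IsQuadratic (q n)) {p : V → ℝ}
    (h : ∀ u, Tendsto (fun n => q n u) atTop (𝓝 (p u))) : IsQuadratic p := by
  choose B hB1 hB2 using hq
  -- By polarization the bilinear forms converge as soon as their diagonals do, and the algebraic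
  -- identities pass to the limit.
  have hlim : ∀ u v, Tendsto (fun n => B n u v) atTop (𝓝 ((p (u + v) - p (u - v)) / 4)) := by
    intro u v
    refine (((h (u + v)).sub (h (u - v))).div_const 4).congr fun n => ?_
    simp only [hB2, map_add, map_sub, LinearMap.add_apply, LinearMap.sub_apply, hB1 n v u]
    ring
  refine ⟨LinearMap.mk₂ ℝ (fun u v => (p (u + v) - p (u - v)) / 4) ?_ ?_ ?_ ?_, fun u v => ?_,
    fun u => ?_⟩
  · intro u v w
    refine tendsto_nhds_unique (hlim _ _) (((hlim u w).add (hlim v w)).congr fun n => ?_)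
    simp
  · intro c u v
    refine tendsto_nhds_unique (hlim _ _) (((hlim u v).const_smul c).congr fun n => ?_)
    simp
  · intro u v w
    refine tendsto_nhds_unique (hlim _ _) (((hlim u v).add (hlim u w)).congr fun n => ?_)
    simp
  · intro c u v
    refine tendsto_nhds_unique (hlim _ _) (((hlim u v).const_smul c).congr fun n => ?_)
    simp
  · exact tendsto_nhds_unique (hlim _ _) ((hlim v u).congr fun n => hB1 n v u)
  · exact tendsto_nhds_unique (h u) ((hlim u u).congr fun n => (hB2 n u).symm)

end IsQuadratic

end Quadratic

/-! ### The approximating energies -/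

namespace StretchedFractal

variable {d N : ℕ} (T : StretchedFractal d N)

/-- Functions that are in `H¹` along all the lines `e^w_{c,l}`. -/
def lineSpace : Submodule ℝ (Eu d → ℝ) where
  carrier := {u | ∀ (w : List (Fin N)) (b : T.Branch), MemH1 (u ∘ wordMap T.G w ∘ T.ξ b)}
  add_mem' hu hv w b := (hu w b).add (hv w b)
  zero_mem' _ _ := MemH1.zero
  smul_mem' c _ hu w b := (hu w b).const_smul c

theorem Qfrac_nonneg (r₀ : T.V₀ → T.V₀ → ℝ≥0∞) (u : Eu d → ℝ) : 0 ≤ T.Qfrac r₀ u :=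
  mul_nonneg (by norm_num) (Finset.sum_nonneg fun _ _ => Finset.sum_nonneg fun _ _ =>
    mul_nonneg ENNReal.toReal_nonneg (sq_nonneg _))

theorem Gn_eq {n : ℕ} (w : Fin n → Fin N) : T.Gn w = wordMap T.G (List.ofFn w) := rfl

theorem Gn_snoc {n : ℕ} (w : Fin n → Fin N) (i : Fin N) :
    T.Gn (Fin.snoc w i : Fin (n + 1) → Fin N) = T.Gn w ∘ T.G i := by
  funext x
  have : List.ofFn (Fin.snoc w i : Fin (n + 1) → Fin N) = List.ofFn w ++ [i] := by
    rw [List.ofFn_succ_last]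
    simp
  rw [Gn_eq, this, wordMap_append]
  rfl

theorem sum_words_succ {n : ℕ} (F : (Fin (n + 1) → Fin N) → ℝ) :
    ∑ w, F w = ∑ w : Fin n → Fin N, ∑ i, F (Fin.snoc w i : Fin (n + 1) → Fin N) := by
  rw [← (Fin.snocEquiv fun _ : Fin (n + 1) => Fin N).sum_comp, Fintype.sum_prod_type,
    Finset.sum_comm]
  rfl

theorem Gn_get (w : List (Fin N)) : T.Gn w.get = wordMap T.G w := by
  rw [Gn_eq, List.ofFn_get]

/-! ### Monotonicity in the level, and the limit energy as a quadratic form -/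

namespace RegularSequence

variable {T} (R : T.RegularSequence)

theorem δ_pos (n : ℕ) : 0 < R.δ n := Finset.prod_pos fun k _ => (R.harmonic k).lam_pos

theorem δ_succ (n : ℕ) : R.δ (n + 1) = R.δ n * R.lam n := Finset.prod_range_succ _ _

theorem lineEnergy_nonneg (k : ℕ) (u : Eu d → ℝ) : 0 ≤ R.lineEnergy (R.ρ k) u :=
  Finset.sum_nonneg fun b _ => mul_nonneg (inv_nonneg.2 ((R.harmonic k).ρ_pos b).le)
    (intervalIntegral.integral_nonneg zero_le_one fun _ _ => sq_nonneg _)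

theorem energyN_nonneg (n : ℕ) (u : Eu d → ℝ) : 0 ≤ R.energyN n u :=
  add_nonneg (Finset.sum_nonneg fun _ _ => mul_nonneg (inv_nonneg.2 (R.δ_pos n).le)
    (T.Qfrac_nonneg _ _)) (Finset.sum_nonneg fun k _ => mul_nonneg (inv_nonneg.2 (R.δ_pos k).le)
      (Finset.sum_nonneg fun _ _ => R.lineEnergy_nonneg k _))

/-- The energy is a combination of squares of differences of point evaluations and of squared L²
norms of weak derivatives. The latter depend linearly on u only inside `lineSpace`. -/
theorem isQuadratic_energyN (n : ℕ) : IsQuadratic fun u : T.lineSpace => R.energyN n u.1 := by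
  have hev : ∀ x : Eu d, ∃ L : T.lineSpace →ₗ[ℝ] ℝ, ∀ u, L u = u.1 x := fun x =>
    ⟨LinearMap.proj x ∘ₗ T.lineSpace.subtype, fun u => rfl⟩
  have hQ : ∀ g : Eu d → Eu d, IsQuadratic fun u : T.lineSpace => T.Qfrac R.r₀ (u.1 ∘ g) := by
    intro g
    refine (IsQuadratic.sum fun x _ => IsQuadratic.sum fun y _ => ?_).const_mul _
    obtain ⟨L, hL⟩ := hev (g x)
    obtain ⟨L', hL'⟩ := hev (g y)
    have := (IsQuadratic.sq (L - L')).const_mul (R.r₀ x y)⁻¹.toReal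
    simpa only [LinearMap.sub_apply, hL, hL', Function.comp_apply] using this
  have hD : ∀ (k : ℕ) (w : Fin k → Fin N),
      IsQuadratic fun u : T.lineSpace => R.lineEnergy (R.ρ k) (u.1 ∘ T.Gn w) := by
    intro k w
    refine IsQuadratic.sum fun b _ => ?_
    let ι : T.lineSpace →ₗ[ℝ] H1 :=
      { toFun := fun u => ⟨u.1 ∘ T.Gn w ∘ T.ξ b, u.2 (List.ofFn w) b⟩
        map_add' := fun u v => rfl
        map_smul' := fun c u => rfl }
    have := (IsQuadratic.norm_sq (H1.derivLp ∘ₗ ι)).const_mul (R.ρ k b)⁻¹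
    simp only [LinearMap.comp_apply, H1.norm_derivLp_sq] at this
    exact this
  exact (IsQuadratic.sum fun w _ => (hQ _).const_mul _).add
    (IsQuadratic.sum fun k _ => (IsQuadratic.sum fun w _ => hD k w).const_mul _)

/-- The function u competes in the infimum for its own boundary values. -/
theorem Qfrac_le (k : ℕ) (u : Eu d → ℝ) :
    T.Qfrac R.r₀ u ≤ (R.lam k)⁻¹ * ∑ i, T.Qfrac R.r₀ (u ∘ T.G i) + T.Qline (R.ρ k) u :=
  ((R.harmonic k).trace_eq u).1 ⟨u, fun _ _ => rfl, rfl⟩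

theorem Qline_le (k : ℕ) {u : Eu d → ℝ} (hu : ∀ b, MemH1 (u ∘ T.ξ b)) :
    T.Qline (R.ρ k) u ≤ R.lineEnergy (R.ρ k) u := by
  refine Finset.sum_le_sum fun b _ =>
    mul_le_mul_of_nonneg_left ?_ (inv_nonneg.2 ((R.harmonic k).ρ_pos b).le)
  have := (hu b).sq_sub_le (right_mem_Icc.2 zero_le_one) (left_mem_Icc.2 zero_le_one)
  simpa [T.ξ_zero, T.ξ_one] using this

/-- On each cell of level n, the trace inequality for u ∘ G_w splits the vertex energy into that of
the subcells and of the new lines. A resistor bounds the Dirichlet integral along its line from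
below, and δ_{n+1} = δ_n λ_{n+1} matches the weights. -/
theorem energyN_le_succ {u : Eu d → ℝ} (hu : u ∈ T.lineSpace) (n : ℕ) :
    R.energyN n u ≤ R.energyN (n + 1) u := by
  have h1 : ∀ w : Fin n → Fin N, (R.δ n)⁻¹ * T.Qfrac R.r₀ (u ∘ T.Gn w) ≤
      (∑ i, (R.δ (n + 1))⁻¹ * T.Qfrac R.r₀ (u ∘ T.Gn (Fin.snoc w i : Fin (n + 1) → Fin N))) +
        (R.δ n)⁻¹ * R.lineEnergy (R.ρ n) (u ∘ T.Gn w) := by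
    intro w
    have h2 := R.Qfrac_le n (u ∘ T.Gn w)
    have h3 := R.Qline_le n (u := u ∘ T.Gn w) fun b => hu (List.ofFn w) b
    have h4 := mul_le_mul_of_nonneg_left (h2.trans (add_le_add_right h3 _))
      (inv_nonneg.2 (R.δ_pos n).le)
    refine h4.trans_eq ?_
    rw [δ_succ, mul_inv, ← Finset.mul_sum, mul_add, mul_assoc]
    simp only [T.Gn_snoc]
    rfl
  have h5 := Finset.sum_le_sum fun w (_ : w ∈ Finset.univ) => h1 w
  rw [Finset.sum_add_distrib, ← sum_words_succ (N := N)
    fun w => (R.δ (n + 1))⁻¹ * T.Qfrac R.r₀ (u ∘ T.Gn w)] at h5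
  rw [energyN, energyN, Finset.sum_range_succ, Finset.mul_sum (s := Finset.univ) (a := (R.δ n)⁻¹)]
  linarith

theorem monotone_energyN {u : Eu d → ℝ} (hu : u ∈ T.lineSpace) :
    Monotone fun n => R.energyN n u :=
  monotone_nat_of_le_succ (R.energyN_le_succ hu)

theorem mem_lineSpace {u : Eu d → ℝ} (hu : u ∈ R.domain) : u ∈ T.lineSpace := hu.2.1

theorem tendsto_energyN {u : Eu d → ℝ} (hu : u ∈ R.domain) :
    Tendsto (fun n => R.energyN n u) atTop (𝓝 (R.energy u)) := by
  obtain ⟨l, hl⟩ := hu.2.2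
  rwa [energy, hl.limUnder_eq]

theorem energyN_le_energy {u : Eu d → ℝ} (hu : u ∈ R.domain) (n : ℕ) :
    R.energyN n u ≤ R.energy u :=
  (R.monotone_energyN (R.mem_lineSpace hu)).ge_of_tendsto (R.tendsto_energyN hu) n

theorem energy_nonneg {u : Eu d → ℝ} (hu : u ∈ R.domain) : 0 ≤ R.energy u :=
  (R.energyN_nonneg 0 u).trans (R.energyN_le_energy hu 0)

theorem mem_domain_of_le {u : Eu d → ℝ} (hc : ContinuousOn u T.K) (hu : u ∈ T.lineSpace) {C : ℝ}
    (hC : ∀ n, R.energyN n u ≤ C) : u ∈ R.domain := by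
  refine ⟨hc, hu, _, tendsto_atTop_ciSup (R.monotone_energyN hu) ⟨C, ?_⟩⟩
  rintro _ ⟨n, rfl⟩
  exact hC n

theorem energy_le_of_le {u : Eu d → ℝ} (hu : u ∈ R.domain) {C : ℝ}
    (hC : ∀ n, R.energyN n u ≤ C) : R.energy u ≤ C :=
  le_of_tendsto' (R.tendsto_energyN hu) hC

/-- The functions in the domain that vanish on `Z`, as a vector space. -/
def domainVanishing (Z : Set (Eu d)) : Submodule ℝ (Eu d → ℝ) where
  carrier := {u | u ∈ R.domain ∧ ∀ x ∈ Z, u x = 0}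
  add_mem' := by
    rintro u v ⟨hu, hu0⟩ ⟨hv, hv0⟩
    have hu' := R.mem_lineSpace hu
    have hv' := R.mem_lineSpace hv
    refine ⟨R.mem_domain_of_le (hu.1.add hv.1) (add_mem hu' hv')
      (C := 2 * R.energy u + 2 * R.energy v) fun n => ?_, fun x hx => ?_⟩
    · have h1 := (R.isQuadratic_energyN n).parallelogram ⟨u, hu'⟩ ⟨v, hv'⟩
      have h2 := R.energyN_nonneg n (u - v)
      have h3 := R.energyN_le_energy hu n
      have h4 := R.energyN_le_energy hv n
      have h1 : R.energyN n (u + v) + R.energyN n (u - v)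
          = 2 * R.energyN n u + 2 * R.energyN n v := h1
      linarith
    · rw [Pi.add_apply, hu0 x hx, hv0 x hx, add_zero]
  zero_mem' := by
    refine ⟨R.mem_domain_of_le continuousOn_const T.lineSpace.zero_mem (C := 0) fun n => ?_,
      fun _ _ => rfl⟩
    have h1 := (R.isQuadratic_energyN n).smul 0 0
    have h1 : R.energyN n ((0 : ℝ) • (0 : Eu d → ℝ)) = 0 ^ 2 * R.energyN n 0 := h1
    rw [smul_zero, zero_pow two_ne_zero, zero_mul] at h1
    exact h1.le
  smul_mem' := by
    rintro c u ⟨hu, hu0⟩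
    have hu' := R.mem_lineSpace hu
    refine ⟨R.mem_domain_of_le (hu.1.const_smul c) (T.lineSpace.smul_mem c hu')
      (C := c ^ 2 * R.energy u) fun n => ?_, fun x hx => ?_⟩
    · have h1 := (R.isQuadratic_energyN n).smul c ⟨u, hu'⟩
      have h1 : R.energyN n (c • u) = c ^ 2 * R.energyN n u := h1
      rw [h1]
      exact mul_le_mul_of_nonneg_left (R.energyN_le_energy hu n) (sq_nonneg c)
    · rw [Pi.smul_apply, hu0 x hx, smul_zero]

theorem domainVanishing_empty : (R.domainVanishing ∅ : Set (Eu d → ℝ)) = R.domain := by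
  ext u
  exact ⟨fun h => h.1, fun h => ⟨h, fun _ hx => hx.elim⟩⟩

theorem isQuadratic_energy (Z : Set (Eu d)) :
    IsQuadratic fun u : R.domainVanishing Z => R.energy u.1 := by
  refine IsQuadratic.of_tendsto
    (q := fun n (u : R.domainVanishing Z) => R.energyN n (u : Eu d → ℝ)) (fun n => ?_)
    fun u => R.tendsto_energyN u.2.1
  obtain ⟨B, hB1, hB2⟩ := R.isQuadratic_energyN n
  let ι : R.domainVanishing Z →ₗ[ℝ] T.lineSpace :=
    Submodule.inclusion fun u hu => R.mem_lineSpace hu.1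
  exact ⟨B.compl₁₂ ι ι, fun u v => hB1 _ _, fun u => hB2 (ι u)⟩

/-- The form is bilinear on its domain. -/
theorem exists_bilin (Z : Set (Eu d)) :
    ∃ B : R.domainVanishing Z →ₗ[ℝ] R.domainVanishing Z →ₗ[ℝ] ℝ,
      (∀ u v, B u v = B v u) ∧ (∀ u, B u u = R.energy u.1) ∧ ∀ u v, B u v = R.form u.1 v.1 := by
  obtain ⟨B, hB1, hB2⟩ := R.isQuadratic_energy Z
  refine ⟨B, hB1, fun u => (hB2 u).symm, fun u v => ?_⟩
  have h1 := hB2 (u + v)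
  have h2 := hB2 (u - v)
  simp only [map_add, map_sub, LinearMap.add_apply, LinearMap.sub_apply] at h1 h2
  have h1 : R.energy (u.1 + v.1) = _ := h1
  have h2 : R.energy (u.1 - v.1) = _ := h2
  rw [form, h1, h2, hB1 v u]
  ring

/-! Estimates for a single cell -/

theorem Qfrac_comp_wordMap_le {u : Eu d → ℝ} (hu : u ∈ R.domain) (w : List (Fin N)) :
    T.Qfrac R.r₀ (u ∘ wordMap T.G w) ≤ R.δ w.length * R.energy u := by
  have h1 : (R.δ w.length)⁻¹ * T.Qfrac R.r₀ (u ∘ T.Gn w.get) ≤ R.energyN w.length u := by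
    rw [energyN]
    refine le_trans ?_ (le_add_of_nonneg_right (Finset.sum_nonneg fun k _ =>
      mul_nonneg (inv_nonneg.2 (R.δ_pos k).le)
        (Finset.sum_nonneg fun _ _ => R.lineEnergy_nonneg k _)))
    exact Finset.single_le_sum (f := fun w' : Fin w.length → Fin N =>
      (R.δ w.length)⁻¹ * T.Qfrac R.r₀ (u ∘ T.Gn w')) (fun _ _ =>
        mul_nonneg (inv_nonneg.2 (R.δ_pos _).le) (T.Qfrac_nonneg _ _)) (Finset.mem_univ _)
  rw [T.Gn_get] at h1
  have h2 := h1.trans (R.energyN_le_energy hu _)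
  rwa [inv_mul_le_iff₀ (R.δ_pos _)] at h2

theorem integral_deriv_sq_le {u : Eu d → ℝ} (hu : u ∈ R.domain) (w : List (Fin N)) (b : T.Branch)
    {M : ℝ} (hM : ∀ i b, R.ρ i b ≤ M) :
    ∫ t in (0 : ℝ)..1, deriv (u ∘ wordMap T.G w ∘ T.ξ b) t ^ 2 ≤
      M * (R.δ w.length * R.energy u) := by
  set k := w.length with hk
  have hnn : ∀ w' b, 0 ≤ (R.ρ k b)⁻¹ * ∫ t in (0 : ℝ)..1,
      deriv ((u ∘ T.Gn (n := k) w') ∘ T.ξ b) t ^ 2 := fun w' b =>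
    mul_nonneg (inv_nonneg.2 ((R.harmonic k).ρ_pos b).le)
      (intervalIntegral.integral_nonneg zero_le_one fun _ _ => sq_nonneg _)
  -- The lines of words of length k first enter the energy at level k + 1; the integral is a single
  -- non-negative summand there.
  have h1 : (R.δ k)⁻¹ * ((R.ρ k b)⁻¹ * ∫ t in (0 : ℝ)..1,
      deriv ((u ∘ T.Gn w.get) ∘ T.ξ b) t ^ 2) ≤ R.energyN (k + 1) u := by
    rw [energyN]
    refine le_trans ?_ (le_add_of_nonneg_left (Finset.sum_nonneg fun _ _ =>
      mul_nonneg (inv_nonneg.2 (R.δ_pos _).le) (T.Qfrac_nonneg _ _)))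
    refine le_trans ?_ (Finset.single_le_sum (f := fun k => (R.δ k)⁻¹ *
      ∑ w : Fin k → Fin N, R.lineEnergy (R.ρ k) (u ∘ T.Gn w)) (fun k _ =>
        mul_nonneg (inv_nonneg.2 (R.δ_pos k).le)
        (Finset.sum_nonneg fun _ _ => R.lineEnergy_nonneg k _)) (Finset.self_mem_range_succ k))
    refine mul_le_mul_of_nonneg_left ?_ (inv_nonneg.2 (R.δ_pos k).le)
    refine le_trans ?_ (Finset.single_le_sum (f := fun w : Fin k → Fin N =>
      R.lineEnergy (R.ρ k) (u ∘ T.Gn w)) (fun _ _ => R.lineEnergy_nonneg k _)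
        (Finset.mem_univ w.get))
    exact Finset.single_le_sum (f := fun b => (R.ρ k b)⁻¹ * ∫ t in (0 : ℝ)..1,
      deriv ((u ∘ T.Gn w.get) ∘ T.ξ b) t ^ 2) (fun b _ => hnn _ b) (Finset.mem_univ b)
  rw [T.Gn_get] at h1
  have h2 := h1.trans (R.energyN_le_energy hu _)
  rw [inv_mul_le_iff₀ (R.δ_pos _), inv_mul_le_iff₀ ((R.harmonic k).ρ_pos b)] at h2
  exact h2.trans (mul_le_mul_of_nonneg_right (hM k b)
    (mul_nonneg (R.δ_pos k).le (R.energy_nonneg hu)))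

end RegularSequence

end StretchedFractal

/-! ### Resistance estimates -/

/-- Chaining through a connected relation: local bounds give a global one. -/
theorem exists_chain_bound {ι : Type*} [Finite ι] {r : ι → ι → Prop}
    (hr : ∀ i j, Relation.ReflTransGen r i j) :
    ∃ C : ℝ, 0 ≤ C ∧ ∀ (u : ι → ℝ) (s : ℝ), 0 ≤ s → (∀ i j, r i j → |u i - u j| ≤ s) →
      ∀ i j, |u i - u j| ≤ C * s := by
  have := Fintype.ofFinite ι
  have h : ∀ i j, ∃ C : ℝ, 0 ≤ C ∧ ∀ (u : ι → ℝ) (s : ℝ), 0 ≤ s →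
      (∀ i j, r i j → |u i - u j| ≤ s) → |u i - u j| ≤ C * s := by
    intro i j
    induction hr i j with
    | refl => exact ⟨0, le_rfl, fun u s _ _ => by simp⟩
    | @tail j k _ hjk ih =>
      obtain ⟨C, hC, h⟩ := ih
      refine ⟨C + 1, by positivity, fun u s hs hu => ?_⟩
      have h1 := h u s hs hu
      have h2 := hu j k hjk
      have h3 := abs_sub_le (u i) (u j) (u k)
      linarith
  choose C hC0 hC using h
  refine ⟨∑ i, ∑ j, C i j, Finset.sum_nonneg fun i _ => Finset.sum_nonneg fun j _ => hC0 i j,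
    fun u s hs hu i j => (hC i j u s hs hu).trans (mul_le_mul_of_nonneg_right ?_ hs)⟩
  calc C i j ≤ ∑ j, C i j := Finset.single_le_sum (fun j _ => hC0 i j) (Finset.mem_univ j)
    _ ≤ _ := Finset.single_le_sum (f := fun i => ∑ j, C i j)
      (fun i _ => Finset.sum_nonneg fun j _ => hC0 i j) (Finset.mem_univ i)

namespace StretchedFractal

variable {d N : ℕ} (T : StretchedFractal d N)

/-- The oscillation of a function on `V₁` is controlled by its oscillation on the `1`-cells and on
the lines. -/
theorem exists_osc_V₁_bound :
    ∃ C : ℝ, 0 ≤ C ∧ ∀ (u : Eu d → ℝ) (s : ℝ), 0 ≤ s →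
      (∀ i, ∀ p ∈ T.V₀, ∀ q ∈ T.V₀, |u (T.G i p) - u (T.G i q)| ≤ s) →
      (∀ b, |u (T.crit b) - u (T.tip b)| ≤ s) →
      ∀ i j, ∀ p ∈ T.V₀, ∀ q ∈ T.V₀, |u (T.G i p) - u (T.G j q)| ≤ C * s := by
  obtain ⟨C, hC0, hC⟩ := exists_chain_bound T.reflTransGen_adjacent
  obtain ⟨p₀, hp₀⟩ := T.V₀_nonempty
  refine ⟨C * 4 + 2, by positivity, fun u s hs hcell hline i j p hp q hq => ?_⟩
  -- Four moves of size at most s: inside cell i to the tip of its line, along that line to the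
  -- critical point, along the other line, and inside cell j. The final constant adds two more
  -- moves, from p and q to the reference vertex.
  have hadj : ∀ i j, T.Adjacent i j → |u (T.G i p₀) - u (T.G j p₀)| ≤ 4 * s := by
    intro i j hij
    obtain ⟨b, b', rfl, rfl, hbb⟩ := hij.exists_branch
    obtain ⟨x, hx, htip⟩ := T.exists_tip_eq b
    obtain ⟨x', hx', htip'⟩ := T.exists_tip_eq b'
    have h1 := hcell b.1.2 p₀ hp₀ x hx
    have h2 := hcell b'.1.2 p₀ hp₀ x' hx'
    have h3 := hline b
    have h4 := hline b'
    rw [← htip] at h1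
    rw [← htip'] at h2
    rw [hbb] at h3
    rw [abs_le] at *
    constructor <;> linarith [h1.1, h1.2, h2.1, h2.2, h3.1, h3.2, h4.1, h4.2]
  have h1 := hC (fun i => u (T.G i p₀)) (4 * s) (by positivity) hadj i j
  have h2 := hcell i p hp p₀ hp₀
  have h3 := hcell j p₀ hp₀ q hq
  have h4 := abs_sub_le (u (T.G i p)) (u (T.G i p₀)) (u (T.G j q))
  have h5 := abs_sub_le (u (T.G i p₀)) (u (T.G j p₀)) (u (T.G j q))
  linarith

/-! ### Oscillation and sampling bounds for functions of finite energy -/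

namespace RegularSequence

variable {T} (R : T.RegularSequence)

/-- Each edge of finite resistance is controlled by its own term of the energy, and the network is
connected with finitely many vertices. -/
theorem exists_osc_V₀_bound : ∃ C : ℝ, 0 ≤ C ∧ ∀ u : Eu d → ℝ, ∀ p ∈ T.V₀, ∀ q ∈ T.V₀,
    |u p - u q| ≤ C * √(T.Qfrac R.r₀ u) := by
  have hH := R.harmonic 0
  obtain ⟨C, hC0, hC⟩ := exists_chain_bound hH.network_connected
  have hedge : ∀ p q : T.V₀, ∃ c : ℝ, 0 ≤ c ∧ (p ≠ q ∧ R.r₀ p q < ∞ → ∀ u : Eu d → ℝ,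
      |u p - u q| ≤ c * √(T.Qfrac R.r₀ u)) := by
    intro p q
    by_cases h : p ≠ q ∧ R.r₀ p q < ∞
    swap
    · exact ⟨0, le_rfl, fun h' => absurd h' h⟩
    set k := (R.r₀ p q)⁻¹.toReal with hk
    have hkpos : 0 < k := ENNReal.toReal_pos (ENNReal.inv_ne_zero.2 h.2.ne)
      (ENNReal.inv_ne_top.2 (hH.r₀_pos p q h.1).ne')
    -- The 2 compensates the factor 1/2 in `Qfrac`, since only one of the two ordered pairs is kept
    -- from the sum.
    refine ⟨√(2 / k), Real.sqrt_nonneg _, fun _ u => ?_⟩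
    rw [← Real.sqrt_mul (by positivity)]
    refine Real.abs_le_sqrt ?_
    have hle : k * (u p - u q) ^ 2 ≤
        ∑ x : T.V₀, ∑ y : T.V₀, (R.r₀ x y)⁻¹.toReal * (u x - u y) ^ 2 := by
      have hnn : ∀ x y : T.V₀, 0 ≤ (R.r₀ x y)⁻¹.toReal * (u x - u y) ^ 2 := fun x y =>
        mul_nonneg ENNReal.toReal_nonneg (sq_nonneg _)
      refine le_trans ?_ (Finset.single_le_sum (f := fun x : T.V₀ =>
        ∑ y : T.V₀, (R.r₀ x y)⁻¹.toReal * (u x - u y) ^ 2)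
        (fun x _ => Finset.sum_nonneg fun y _ => hnn x y) (Finset.mem_univ p))
      exact Finset.single_le_sum (f := fun y : T.V₀ => (R.r₀ p y)⁻¹.toReal * (u p - u y) ^ 2)
        (fun y _ => hnn p y) (Finset.mem_univ q)
    have : T.Qfrac R.r₀ u = (1 / 2) *
        ∑ x : T.V₀, ∑ y : T.V₀, (R.r₀ x y)⁻¹.toReal * (u x - u y) ^ 2 := rfl
    rw [div_mul_eq_mul_div, le_div_iff₀ hkpos, this]
    linarith
  choose c hc0 hc using hedge
  set c' := ∑ p, ∑ q, c p q with hc'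
  have hcc' : ∀ p q, c p q ≤ c' := fun p q =>
    (Finset.single_le_sum (fun q _ => hc0 p q) (Finset.mem_univ q)).trans
      (Finset.single_le_sum (f := fun p => ∑ q, c p q)
        (fun p _ => Finset.sum_nonneg fun q _ => hc0 p q) (Finset.mem_univ p))
  have hc'0 : 0 ≤ c' := Finset.sum_nonneg fun p _ => Finset.sum_nonneg fun q _ => hc0 p q
  refine ⟨C * c', by positivity, fun u p hp q hq => ?_⟩
  have := hC (fun x : T.V₀ => u x) (c' * √(T.Qfrac R.r₀ u)) (by positivity)
    (fun x y hxy => (hc x y hxy u).trans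
      (mul_le_mul_of_nonneg_right (hcc' x y) (Real.sqrt_nonneg _))) ⟨p, hp⟩ ⟨q, hq⟩
  simpa [mul_assoc] using this

theorem exists_ρ_le : ∃ M : ℝ, 0 ≤ M ∧ ∀ i b, R.ρ i b ≤ M := by
  obtain ⟨r, hr⟩ := R.ρ_bound
  exact ⟨max r 0, le_max_right _ _, fun i b => (hr i b).trans (le_max_left _ _)⟩

theorem exists_lam_le : ∃ l : ℝ, 0 ≤ l ∧ l < 1 ∧ ∀ i, R.lam i ≤ l := by
  obtain ⟨l, hl1, hl⟩ := R.lam_bound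
  exact ⟨l, (R.harmonic 0).lam_pos.le.trans (hl 0), hl1, hl⟩

theorem δ_add_le {l : ℝ} (hl0 : 0 ≤ l) (hl : ∀ i, R.lam i ≤ l) (m n : ℕ) :
    R.δ (m + n) ≤ l ^ n * R.δ m := by
  induction n with
  | zero => simp
  | succ n ih =>
    rw [← add_assoc, δ_succ, pow_succ, mul_assoc, mul_comm l, ← mul_assoc]
    exact mul_le_mul ih (hl _) (R.harmonic _).lam_pos.le
      (mul_nonneg (pow_nonneg hl0 n) (R.δ_pos m).le)

theorem δ_antitone : Antitone R.δ := by
  refine antitone_nat_of_succ_le fun n => ?_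
  rw [δ_succ]
  exact mul_le_of_le_one_right (R.δ_pos n).le (R.harmonic n).lam_lt_one.le

/-- The square root of `δ_{|w|} 𝓔(u)`, which bounds the oscillation of `u` on the cell of `w`. -/
def scale (u : Eu d → ℝ) (n : ℕ) : ℝ := √(R.δ n * R.energy u)

theorem scale_nonneg (u : Eu d → ℝ) (n : ℕ) : 0 ≤ R.scale u n := Real.sqrt_nonneg _

theorem scale_antitone {u : Eu d → ℝ} (hu : u ∈ R.domain) : Antitone (R.scale u) :=
  fun _ _ h => Real.sqrt_le_sqrt
    (mul_le_mul_of_nonneg_right (R.δ_antitone h) (R.energy_nonneg hu))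

theorem scale_zero (u : Eu d → ℝ) : R.scale u 0 = √(R.energy u) := by
  simp [scale, δ]

theorem scale_succ_le {u : Eu d → ℝ} (hu : u ∈ R.domain) {l : ℝ} (hl0 : 0 ≤ l)
    (hl : ∀ i, R.lam i ≤ l) (n : ℕ) : R.scale u (n + 1) ≤ √l * R.scale u n := by
  rw [scale, scale, ← Real.sqrt_mul hl0, ← mul_assoc]
  refine Real.sqrt_le_sqrt (mul_le_mul_of_nonneg_right ?_ (R.energy_nonneg hu))
  simpa using R.δ_add_le hl0 hl n 1

/-- Hölder continuity along the lines. -/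
theorem sq_sub_line_le {u : Eu d → ℝ} (hu : u ∈ R.domain) {M : ℝ} (hM : ∀ i b, R.ρ i b ≤ M)
    (w : List (Fin N)) (b : T.Branch) {s t : ℝ} (hs : s ∈ Icc (0 : ℝ) 1)
    (ht : t ∈ Icc (0 : ℝ) 1) :
    (u (wordMap T.G w (T.ξ b t)) - u (wordMap T.G w (T.ξ b s))) ^ 2 ≤
      |t - s| * (M * (R.δ w.length * R.energy u)) :=
  ((hu.2.1 w b).sq_sub_le hs ht).trans
    (mul_le_mul_of_nonneg_left (R.integral_deriv_sq_le hu w b hM) (abs_nonneg _))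

theorem abs_sub_line_le {u : Eu d → ℝ} (hu : u ∈ R.domain) {M : ℝ} (hM0 : 0 ≤ M)
    (hM : ∀ i b, R.ρ i b ≤ M)
    (w : List (Fin N)) (b : T.Branch) {s t : ℝ} (hs : s ∈ Icc (0 : ℝ) 1)
    (ht : t ∈ Icc (0 : ℝ) 1) :
    |u (wordMap T.G w (T.ξ b t)) - u (wordMap T.G w (T.ξ b s))| ≤ √M * R.scale u w.length := by
  rw [scale, ← Real.sqrt_mul hM0]
  refine Real.abs_le_sqrt ((R.sq_sub_line_le hu hM w b hs ht).trans ?_)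
  refine mul_le_of_le_one_left
    (mul_nonneg hM0 (mul_nonneg (R.δ_pos _).le (R.energy_nonneg hu))) ?_
  rw [abs_le]
  constructor <;> linarith [hs.1, hs.2, ht.1, ht.2]

/-- The chaining bound is applied to u ∘ G_w: subcells are controlled by the vertex energy one level
deeper, lines by the Morrey estimate, both at the scale of w or smaller. -/
theorem exists_osc_V₁_cell_bound : ∃ C : ℝ, 0 ≤ C ∧ ∀ u ∈ R.domain, ∀ (w : List (Fin N)) (i j),
    ∀ p ∈ T.V₀, ∀ q ∈ T.V₀,
      |u (wordMap T.G w (T.G i p)) - u (wordMap T.G w (T.G j q))| ≤ C * R.scale u w.length := by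
  obtain ⟨C₀, hC₀0, hC₀⟩ := R.exists_osc_V₀_bound
  obtain ⟨C₁, hC₁0, hC₁⟩ := T.exists_osc_V₁_bound
  obtain ⟨M, hM0, hM⟩ := R.exists_ρ_le
  refine ⟨C₁ * (C₀ + √M), by positivity, fun u hu w i j p hp q hq => ?_⟩
  have hs := R.scale_nonneg u w.length
  have h0 := Real.sqrt_nonneg M
  rw [mul_assoc]
  refine hC₁ (u ∘ wordMap T.G w) _ (by positivity) (fun k x hx y hy => ?_) (fun b => ?_)
    i j p hp q hq
  · have h1 := hC₀ (u ∘ wordMap T.G (w ++ [k])) x hx y hy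
    simp only [Function.comp_apply, wordMap_append] at h1
    refine h1.trans ?_
    have h2 : √(T.Qfrac R.r₀ (u ∘ wordMap T.G (w ++ [k]))) ≤ R.scale u w.length := by
      refine (Real.sqrt_le_sqrt (R.Qfrac_comp_wordMap_le hu _)).trans
        (R.scale_antitone hu (by simp))
    have h3 := mul_le_mul_of_nonneg_left h2 hC₀0
    nlinarith
  · have h1 := R.abs_sub_line_le hu hM0 hM w b (right_mem_Icc.2 zero_le_one)
      (left_mem_Icc.2 zero_le_one)
    rw [T.ξ_zero, T.ξ_one] at h1
    simp only [Function.comp_apply]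
    nlinarith

/-- The oscillation of a function of the domain on a cell. -/
theorem exists_osc_bound : ∃ C : ℝ, 0 ≤ C ∧ ∀ u ∈ R.domain, ∀ w : List (Fin N),
    ∀ x ∈ T.K, ∀ y ∈ T.K,
      |u (wordMap T.G w x) - u (wordMap T.G w y)| ≤ C * R.scale u w.length := by
  obtain ⟨C, hC0, hC⟩ := R.exists_osc_V₁_cell_bound
  obtain ⟨M, hM0, hM⟩ := R.exists_ρ_le
  obtain ⟨l, hl0, hl1, hl⟩ := R.exists_lam_le
  obtain ⟨p₀, hp₀⟩ := T.V₀_nonempty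
  have hp₀K := T.V₀_subset_K hp₀
  obtain ⟨i₀, p₁, hp₁, hp₀eq⟩ := T.exists_mem_V₀_eq_G hp₀
  have hl1' : √l < 1 := by rwa [Real.sqrt_lt' one_pos, one_pow]
  -- A solves A √l + C = A: it is the sum of the geometric series of oscillations C √l^k met while
  -- descending through the levels.
  set A := C / (1 - √l) with hA
  have hA0 : 0 ≤ A := div_nonneg hC0 (by linarith)
  have hAeq : A * √l + C = A := by
    have : A * (1 - √l) = C := div_mul_cancel₀ _ (by linarith)
    linarith
  -- The induction peels off the first letter i of v. Inside the cell of w i the bound has improved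
  -- by √l, and the remaining move from G_i p₀ to p₀ stays among the level-one vertices of the cell
  -- of w.
  have hvert : ∀ u ∈ R.domain, ∀ v w : List (Fin N),
      |u (wordMap T.G w (wordMap T.G v p₀)) - u (wordMap T.G w p₀)| ≤ A * R.scale u w.length := by
    intro u hu v
    induction v with
    | nil =>
      intro w
      simpa [wordMap] using mul_nonneg hA0 (R.scale_nonneg u w.length)
    | cons i v ih =>
      intro w
      have h1 := ih (w ++ [i])
      rw [wordMap_append, wordMap_append, List.length_append, List.length_singleton] at h1
      have h2 := hC u hu w i i₀ p₀ hp₀ p₁ hp₁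
      rw [← hp₀eq] at h2
      have h3 := mul_le_mul_of_nonneg_left (R.scale_succ_le hu hl0 hl w.length) hA0
      have h4 : |u (wordMap T.G w (wordMap T.G (i :: v) p₀)) - u (wordMap T.G w (T.G i p₀))| ≤
        A * R.scale u (w.length + 1) := h1
      have h5 := abs_sub_le (u (wordMap T.G w (wordMap T.G (i :: v) p₀)))
        (u (wordMap T.G w (T.G i p₀))) (u (wordMap T.G w p₀))
      have h6 : A * R.scale u w.length =
          A * (√l * R.scale u w.length) + C * R.scale u w.length := by
        conv_lhs => rw [← hAeq]
        ring
      linarith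
  have hbase : ∀ u ∈ R.domain, ∀ w : List (Fin N), ∀ x ∈ T.K,
      |u (wordMap T.G w x) - u (wordMap T.G w p₀)| ≤ (√M + C + A) * R.scale u w.length := by
    intro u hu w x hx
    have hs := R.scale_nonneg u w.length
    have hM0' := Real.sqrt_nonneg M
    -- A point on a line is joined to the tip, then to the reference vertex of the cell carrying the
    -- line, then upwards by `hvert`. A point on no line lies in cells of every level, hence is a
    -- limit of vertices, and continuity of u on K applies.
    by_cases hedge : ∃ v : List (Fin N), ∃ b, ∃ t ∈ Icc (0 : ℝ) 1, x = wordMap T.G v (T.ξ b t)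
    · obtain ⟨v, b, t, ht, rfl⟩ := hedge
      have hle : R.scale u (w ++ v).length ≤ R.scale u w.length := R.scale_antitone hu (by simp)
      have h1 := R.abs_sub_line_le hu hM0 hM (w ++ v) b (right_mem_Icc.2 zero_le_one) ht
      obtain ⟨q, hq, htip⟩ := T.exists_tip_eq b
      have h2 := hC u hu (w ++ v) b.1.2 i₀ q hq p₁ hp₁
      rw [← htip, ← hp₀eq] at h2
      rw [T.ξ_one] at h1
      simp only [wordMap_append] at h1 h2
      have h3 := hvert u hu v w
      have h4 := mul_le_mul_of_nonneg_left hle hM0'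
      have h5 := mul_le_mul_of_nonneg_left hle hC0
      have h6 : (√M + C + A) * R.scale u w.length =
        √M * R.scale u w.length + C * R.scale u w.length + A * R.scale u w.length := by ring
      rw [abs_le] at *
      constructor <;> linarith [h1.1, h1.2, h2.1, h2.2, h3.1, h3.2]
    · have hcell : ∀ n : ℕ, ∃ v : List (Fin N), v.length = n ∧ ∃ y ∈ T.K, x = wordMap T.G v y := by
        intro n
        refine (T.mem_cell_or_mem_edge n hx).resolve_right ?_
        rintro ⟨v, -, h⟩
        exact hedge ⟨v, h⟩
      choose v hv y hy hxy using hcell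
      obtain ⟨D, hD, hDK⟩ := T.exists_dist_le_K
      have hlim : Tendsto (fun n => wordMap T.G w (wordMap T.G (v n) p₀)) atTop
          (𝓝 (wordMap T.G w x)) := by
        refine ((T.lipschitzWith_wordMap_G w).continuous.tendsto x).comp ?_
        rw [tendsto_iff_dist_tendsto_zero]
        refine squeeze_zero (fun _ => dist_nonneg) (fun n => ?_) (T.tendsto_α_pow_mul D)
        rw [hxy n]
        refine (T.dist_wordMap_G_le _ _ _).trans ?_
        rw [hv]
        exact mul_le_mul_of_nonneg_left (hDK _ hp₀K _ (hy n)) (pow_nonneg T.α_pos.le n)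
      have hu1 : Tendsto (fun n => u (wordMap T.G w (wordMap T.G (v n) p₀))) atTop
          (𝓝 (u (wordMap T.G w x))) := by
        refine (hu.1 _ (T.mapsTo_wordMap_K w hx)).tendsto.comp ?_
        exact tendsto_nhdsWithin_iff.2 ⟨hlim, Eventually.of_forall fun n =>
          T.mapsTo_wordMap_K w (T.mapsTo_wordMap_K _ hp₀K)⟩
      have h1 := le_of_tendsto' (hu1.sub_const (u (wordMap T.G w p₀))).abs
        fun n => hvert u hu (v n) w
      nlinarith
  refine ⟨2 * (√M + C + A), by positivity, fun u hu w x hx y hy => ?_⟩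
  have h1 := hbase u hu w x hx
  have h2 := hbase u hu w y hy
  rw [abs_sub_comm] at h2
  have h3 := abs_sub_le (u (wordMap T.G w x)) (u (wordMap T.G w p₀)) (u (wordMap T.G w y))
  linarith

theorem exists_osc_K_bound : ∃ C : ℝ, 0 ≤ C ∧ ∀ u ∈ R.domain, ∀ x ∈ T.K, ∀ y ∈ T.K,
    |u x - u y| ≤ C * √(R.energy u) := by
  obtain ⟨C, hC0, hC⟩ := R.exists_osc_bound
  refine ⟨C, hC0, fun u hu x hx y hy => ?_⟩
  have := hC u hu [] x hx y hy
  rwa [List.length_nil, scale_zero] at this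

theorem tendsto_δ : Tendsto R.δ atTop (𝓝 0) := by
  obtain ⟨l, hl0, hl1, hl⟩ := R.exists_lam_le
  refine squeeze_zero (fun n => (R.δ_pos n).le) (fun n => ?_)
    (tendsto_pow_atTop_nhds_zero_of_lt_one hl0 hl1)
  have := R.δ_add_le hl0 hl 0 n
  simpa [δ] using this

/-- Functions of bounded energy are determined by finitely many values, up to small errors. -/
theorem exists_finite_sample {ε : ℝ} (hε : 0 < ε) : ∃ P : Set (Eu d), P.Finite ∧ P ⊆ T.K ∧
    ∀ x ∈ T.K, ∃ p ∈ P, ∀ u ∈ R.domain, |u x - u p| ≤ ε * √(R.energy u) := by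
  obtain ⟨C, hC0, hC⟩ := R.exists_osc_bound
  obtain ⟨M, hM0, hM⟩ := R.exists_ρ_le
  obtain ⟨p₀, hp₀⟩ := T.V₀_nonempty
  have hp₀K := T.V₀_subset_K hp₀
  -- Cells of level n are so small that one sample point in each suffices. The finitely many lines
  -- of lower level are sampled with mesh 1/m, where M/m ≤ ε² suits Hölder continuity of exponent
  -- 1/2.
  obtain ⟨n, hn⟩ : ∃ n, C * √(R.δ n) ≤ ε := by
    have h1 : Tendsto (fun n => C * √(R.δ n)) atTop (𝓝 0) := by
      simpa using ((Real.continuous_sqrt.tendsto 0).comp R.tendsto_δ).const_mul C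
    obtain ⟨n, hn⟩ := (h1.eventually_le_const hε).exists
    exact ⟨n, hn⟩
  obtain ⟨m, hm⟩ := exists_nat_gt (M / ε ^ 2)
  have hm0 : (0 : ℝ) < m := lt_of_le_of_lt (by positivity) hm
  have hmM : M / m ≤ ε ^ 2 := by
    rw [div_lt_iff₀ (by positivity)] at hm
    rw [div_le_iff₀ hm0]
    linarith
  let P₁ : Set (Eu d) := (fun w => wordMap T.G w p₀) '' {w : List (Fin N) | w.length = n}
  let P₂ : Set (Eu d) := (fun q : List (Fin N) × T.Branch × ℕ =>
    wordMap T.G q.1 (T.ξ q.2.1 (q.2.2 / m))) '' ({w | w.length < n} ×ˢ univ ×ˢ Iic m)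
  refine ⟨P₁ ∪ P₂, ?_, ?_, ?_⟩
  · refine ((List.finite_length_eq _ n).image _).union (Set.Finite.image _ ?_)
    exact (List.finite_length_lt _ n).prod (finite_univ.prod (finite_Iic m))
  · rintro _ (⟨w, -, rfl⟩ | ⟨⟨w, b, i⟩, ⟨-, -, hi⟩, rfl⟩)
    · exact T.mapsTo_wordMap_K w hp₀K
    · refine T.mapsTo_wordMap_K w (T.ξ_mem_K b ⟨by positivity, ?_⟩)
      rw [div_le_one hm0]
      exact_mod_cast hi
  · intro x hx
    rcases T.mem_cell_or_mem_edge n hx with ⟨w, hw, y, hy, rfl⟩ | ⟨w, hw, b, t, ht, rfl⟩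
    · refine ⟨_, Or.inl ⟨w, hw, rfl⟩, fun u hu => (hC u hu w y hy p₀ hp₀K).trans ?_⟩
      rw [hw, scale, Real.sqrt_mul (R.δ_pos n).le, ← mul_assoc]
      exact mul_le_mul_of_nonneg_right hn (Real.sqrt_nonneg _)
    · have htm : 0 ≤ t * m := mul_nonneg ht.1 hm0.le
      have hfl := Nat.floor_le htm
      have hfl' := Nat.lt_floor_add_one (t * m)
      have him : ⌊t * m⌋₊ ≤ m := by
        have : (⌊t * m⌋₊ : ℝ) ≤ m := hfl.trans (mul_le_of_le_one_left hm0.le ht.2)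
        exact_mod_cast this
      have hs : (⌊t * m⌋₊ / m : ℝ) ∈ Icc (0 : ℝ) 1 := by
        refine ⟨by positivity, ?_⟩
        rw [div_le_one hm0]
        exact_mod_cast him
      refine ⟨_, Or.inr ⟨(w, b, ⌊t * m⌋₊), ⟨hw, mem_univ _, him⟩, rfl⟩, fun u hu => ?_⟩
      have h1 := R.sq_sub_line_le hu hM w b hs ht
      have hE := R.energy_nonneg hu
      have hts : |t - ⌊t * m⌋₊ / m| ≤ 1 / m := by
        have h2 : t - ⌊t * m⌋₊ / m = (t * m - ⌊t * m⌋₊) / m := by field_simp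
        rw [h2, abs_div, abs_of_pos hm0]
        refine div_le_div_of_nonneg_right ?_ hm0.le
        rw [abs_of_nonneg (by linarith)]
        linarith
      have hδ1 : R.δ w.length ≤ 1 := by
        have := R.δ_antitone (Nat.zero_le w.length)
        simpa [δ] using this
      have h3 : (u (wordMap T.G w (T.ξ b t)) - u (wordMap T.G w (T.ξ b (⌊t * m⌋₊ / m)))) ^ 2 ≤
          ε ^ 2 * R.energy u := by
        refine h1.trans ?_
        calc |t - ⌊t * m⌋₊ / m| * (M * (R.δ w.length * R.energy u))
            ≤ 1 / m * (M * (1 * R.energy u)) := by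
              gcongr
              exact mul_nonneg hM0 (mul_nonneg (R.δ_pos _).le hE)
          _ = M / m * R.energy u := by ring
          _ ≤ ε ^ 2 * R.energy u := mul_le_mul_of_nonneg_right hmM hE
      refine (Real.abs_le_sqrt h3).trans_eq ?_
      rw [Real.sqrt_mul (sq_nonneg ε), Real.sqrt_sq hε.le]

end RegularSequence

end StretchedFractal

/-! ### Closedness of the form -/

theorem MemH1.tendsto_integral_deriv_sq {f : ℕ → ℝ → ℝ} {g : ℝ → ℝ} (hf : ∀ n, MemH1 (f n))
    (hg : MemH1 g)
    (h : Tendsto (fun n => ∫ t in (0 : ℝ)..1, deriv (f n - g) t ^ 2) atTop (𝓝 0)) :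
    Tendsto (fun n => ∫ t in (0 : ℝ)..1, deriv (f n) t ^ 2) atTop
      (𝓝 (∫ t in (0 : ℝ)..1, deriv g t ^ 2)) := by
  let φ : ℕ → H1 := fun n => ⟨f n, hf n⟩
  let γ : H1 := ⟨g, hg⟩
  have h1 : Tendsto (fun n => H1.derivLp (φ n)) atTop (𝓝 (H1.derivLp γ)) := by
    rw [tendsto_iff_norm_sub_tendsto_zero]
    have h2 := (Real.continuous_sqrt.tendsto 0).comp h
    rw [Real.sqrt_zero] at h2
    refine h2.congr fun n => ?_
    rw [← map_sub, Function.comp_apply, ← Real.sqrt_sq (norm_nonneg (H1.derivLp (φ n - γ))),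
      H1.norm_derivLp_sq]
    rfl
  have h2 := h1.norm.pow 2
  simpa only [H1.norm_derivLp_sq] using h2

namespace StretchedFractal

namespace RegularSequence

variable {d N : ℕ} {T : StretchedFractal d N} (R : T.RegularSequence)

/-- At a fixed level n the energy involves only finitely many point values and finitely many
Dirichlet integrals, so these two kinds of convergence suffice. -/
theorem tendsto_energyN_of_tendsto {v : ℕ → Eu d → ℝ} {u : Eu d → ℝ}
    (hv : ∀ m, v m ∈ T.lineSpace) (hu : u ∈ T.lineSpace)
    (hpt : ∀ x ∈ T.K, Tendsto (fun m => v m x) atTop (𝓝 (u x)))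
    (hline : ∀ (w : List (Fin N)) (b : T.Branch), Tendsto (fun m => ∫ t in (0 : ℝ)..1,
      deriv ((v m - u) ∘ wordMap T.G w ∘ T.ξ b) t ^ 2) atTop (𝓝 0)) (n : ℕ) :
    Tendsto (fun m => R.energyN n (v m)) atTop (𝓝 (R.energyN n u)) := by
  refine Tendsto.add ?_ ?_
  · refine tendsto_finsetSum _ fun w _ => Tendsto.const_mul _ (Tendsto.const_mul _ ?_)
    refine tendsto_finsetSum _ fun x _ => tendsto_finsetSum _ fun y _ => Tendsto.const_mul _ ?_
    have hmem : ∀ x : T.V₀, T.Gn w x ∈ T.K := fun x =>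
      T.mapsTo_wordMap_K _ (T.V₀_subset_K x.2)
    exact ((hpt _ (hmem x)).sub (hpt _ (hmem y))).pow 2
  · refine tendsto_finsetSum _ fun k _ => Tendsto.const_mul _ ?_
    refine tendsto_finsetSum _ fun w _ => tendsto_finsetSum _ fun b _ => Tendsto.const_mul _ ?_
    exact MemH1.tendsto_integral_deriv_sq (fun m => hv m (List.ofFn w) b) (hu (List.ofFn w) b)
      (hline (List.ofFn w) b)

/-- The form is closed: a sequence in the domain that is Cauchy in energy and uniformly on `K`
converges in both senses. -/
theorem exists_limit {Z : Set (Eu d)} (hZ : Z ⊆ T.K) (s : ℕ → R.domainVanishing Z)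
    (hunif : ∀ ε > 0, ∃ n₀, ∀ m ≥ n₀, ∀ n ≥ n₀, ∀ x ∈ T.K, |(s m).1 x - (s n).1 x| ≤ ε)
    (hE : ∀ ε > 0, ∃ n₀, ∀ m ≥ n₀, ∀ n ≥ n₀, R.energy (s m - s n).1 ≤ ε) :
    ∃ u : R.domainVanishing Z, ∀ ε > 0, ∃ n₀, ∀ n ≥ n₀, R.energy (s n - u).1 ≤ ε ∧
      ∀ x ∈ T.K, |(s n).1 x - u.1 x| ≤ ε := by
  have hptw : ∀ x, ∃ y, x ∈ T.K → Tendsto (fun n => (s n).1 x) atTop (𝓝 y) := by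
    intro x
    by_cases hx : x ∈ T.K
    swap
    · exact ⟨0, fun h => absurd h hx⟩
    have : CauchySeq fun n => (s n).1 x := by
      refine Metric.cauchySeq_iff.2 fun ε hε => ?_
      obtain ⟨n₀, h⟩ := hunif (ε / 2) (by positivity)
      exact ⟨n₀, fun m hm n hn => (h m hm n hn x hx).trans_lt (by linarith)⟩
    obtain ⟨y, hy⟩ := cauchySeq_tendsto_of_complete this
    exact ⟨y, fun _ => hy⟩
  choose u hu using hptw
  have hunif' : ∀ ε > 0, ∃ n₀, ∀ n ≥ n₀, ∀ x ∈ T.K, |(s n).1 x - u x| ≤ ε := by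
    intro ε hε
    obtain ⟨n₀, h⟩ := hunif ε hε
    refine ⟨n₀, fun n hn x hx => ?_⟩
    refine le_of_tendsto ((hu x hx).const_sub ((s n).1 x)).abs ?_
    filter_upwards [eventually_ge_atTop n₀] with m hm
    exact h n hn m hm x hx
  have hcont : ContinuousOn u T.K := by
    refine TendstoUniformlyOn.continuousOn (F := fun n => (s n).1) (p := atTop) ?_
      (Eventually.of_forall fun n => (s n).2.1.1).frequently
    refine Metric.tendstoUniformlyOn_iff.2 fun ε hε => ?_
    obtain ⟨n₀, h⟩ := hunif' (ε / 2) (by positivity)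
    filter_upwards [eventually_ge_atTop n₀] with n hn x hx
    rw [dist_comm, Real.dist_eq]
    exact (h n hn x hx).trans_lt (by linarith)
  obtain ⟨M, hM0, hM⟩ := R.exists_ρ_le
  -- On a fixed line the Dirichlet integral is at most a constant times the energy, so the
  -- derivatives form a Cauchy sequence in L² and completeness of H¹ applies.
  have hH1 : ∀ (w : List (Fin N)) (b : T.Branch), MemH1 (u ∘ wordMap T.G w ∘ T.ξ b) ∧
      Tendsto (fun m => ∫ t in (0 : ℝ)..1,
        deriv (((s m).1 - u) ∘ wordMap T.G w ∘ T.ξ b) t ^ 2) atTop (𝓝 0) := by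
    intro w b
    refine MemH1.of_tendsto (f := fun n => (s n).1 ∘ wordMap T.G w ∘ T.ξ b)
      (fun n => (s n).2.1.2.1 w b)
      (fun t ht => hu _ (T.mapsTo_wordMap_K w (T.ξ_mem_K b ht))) fun ε hε => ?_
    have hδ := R.δ_pos w.length
    obtain ⟨n₀, h⟩ := hE (ε / (2 * (M * R.δ w.length + 1))) (by positivity)
    refine ⟨n₀, fun m hm n hn => ?_⟩
    have h1 := R.integral_deriv_sq_le (s m - s n).2.1 w b hM
    refine lt_of_le_of_lt h1 ?_
    have h2 := h m hm n hn
    rw [le_div_iff₀ (by positivity)] at h2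
    have h3 := R.energy_nonneg (s m - s n).2.1
    have h4 : 0 ≤ M * R.δ w.length := mul_nonneg hM0 hδ.le
    nlinarith
  have hline : u ∈ T.lineSpace := fun w b => (hH1 w b).1
  -- Lower semicontinuity: E_k(s m - s n) is at most the full energy, hence at most ε. Letting m → ∞
  -- at fixed k gives a bound uniform in k.
  have hbound : ∀ ε > 0, ∃ n₀, ∀ n ≥ n₀, ∀ k, R.energyN k (u - (s n).1) ≤ ε := by
    intro ε hε
    obtain ⟨n₀, h⟩ := hE ε hε
    refine ⟨n₀, fun n hn k => ?_⟩
    have hn' := R.mem_lineSpace (s n).2.1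
    have h1 := R.tendsto_energyN_of_tendsto (v := fun m => (s m).1 - (s n).1)
      (u := u - (s n).1) (fun m => sub_mem (R.mem_lineSpace (s m).2.1) hn')
      (sub_mem hline hn') (fun x hx => (hu x hx).sub_const _) (fun w b => by
        simpa only [sub_sub_sub_cancel_right] using (hH1 w b).2) k
    refine le_of_tendsto h1 ?_
    filter_upwards [eventually_ge_atTop n₀] with m hm
    exact (R.energyN_le_energy (s m - s n).2.1 k).trans (h m hm n hn)
  have hdom : u ∈ R.domain := by
    obtain ⟨n₀, h⟩ := hbound 1 one_pos
    have h1 : u - (s n₀).1 ∈ R.domainVanishing ∅ :=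
      ⟨R.mem_domain_of_le (hcont.sub (s n₀).2.1.1)
        (sub_mem hline (R.mem_lineSpace (s n₀).2.1)) (h n₀ le_rfl), fun _ hx => hx.elim⟩
    have h2 : (s n₀).1 ∈ R.domainVanishing ∅ := ⟨(s n₀).2.1, fun _ hx => hx.elim⟩
    have h3 := add_mem h1 h2
    rw [sub_add_cancel] at h3
    exact h3.1
  have hvan : u ∈ R.domainVanishing Z := by
    refine ⟨hdom, fun x hx => tendsto_nhds_unique (hu x (hZ hx)) ?_⟩
    simp only [(s _).2.2 x hx]
    exact tendsto_const_nhds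
  refine ⟨⟨u, hvan⟩, fun ε hε => ?_⟩
  obtain ⟨n₁, h1⟩ := hbound ε hε
  obtain ⟨n₂, h2⟩ := hunif' ε hε
  refine ⟨max n₁ n₂, fun n hn => ⟨?_, h2 n ((le_max_right _ _).trans hn)⟩⟩
  have hmem := (s n - ⟨u, hvan⟩).2.1
  refine R.energy_le_of_le hmem fun k => ?_
  have h3 := h1 n ((le_max_left _ _).trans hn) k
  have h4 := (R.isQuadratic_energyN k).smul (-1)
    ⟨_, R.mem_lineSpace hmem⟩
  have h4 : R.energyN k ((-1 : ℝ) • ((s n).1 - u)) = (-1) ^ 2 * R.energyN k ((s n).1 - u) := h4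
  rw [neg_one_smul, neg_sub, neg_one_sq, one_mul] at h4
  rw [h4] at h3
  exact h3

end RegularSequence

end StretchedFractal

/-! ### Test functions: Lipschitz functions that are locally constant near the fractal part -/

namespace StretchedFractal

variable {d N : ℕ} (T : StretchedFractal d N)

theorem isCompact_dust : IsCompact T.dust := T.isAttractor_dust.2.1

theorem dust_eq : T.dust = ⋃ i, T.G i '' T.dust := by
  have := T.isAttractor_dust.2.2
  rwa [union_empty] at this

theorem mapsTo_G_dust (i : Fin N) : MapsTo (T.G i) T.dust T.dust := by
  intro x hx
  rw [dust_eq]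
  exact mem_iUnion.2 ⟨i, x, hx, rfl⟩

theorem continuous_G (i : Fin N) : Continuous (T.G i) :=
  (T.lipschitzWith_wordMap_G [i]).continuous

/-- If the first-level cells of the fractal part are disjoint, then it is totally separated. -/
theorem exists_separation_dust
    (hdisj : ∀ i j : Fin N, i ≠ j → Disjoint (T.G i '' T.dust) (T.G j '' T.dust))
    {x y : Eu d} (hx : x ∈ T.dust) (hy : y ∈ T.dust) (hxy : x ≠ y) :
    ∃ A B : Set (Eu d), IsCompact A ∧ IsCompact B ∧ Disjoint A B ∧ T.dust = A ∪ B ∧ x ∈ A ∧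
      y ∈ B := by
  obtain ⟨D, hD⟩ := Metric.isBounded_iff.1 T.isCompact_dust.isBounded
  -- Induction on the scale at which x and y are told apart. If their first letters differ, a
  -- first-level cell and the union of the others separate them. Otherwise both are pulled back by
  -- G_i, which expands the distance by at least 1/α; the remaining cells are then joined to the
  -- second piece.
  have main : ∀ (n : ℕ) (x y : Eu d), x ∈ T.dust → y ∈ T.dust → T.α ^ n * D < dist x y →
      ∃ A B : Set (Eu d), IsCompact A ∧ IsCompact B ∧ Disjoint A B ∧ T.dust = A ∪ B ∧ x ∈ A ∧
        y ∈ B := by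
    intro n
    induction n with
    | zero =>
      intro x y hx hy h
      rw [pow_zero, one_mul] at h
      exact absurd (hD hx hy) (not_le.2 h)
    | succ n ih =>
      intro x y hx hy h
      rw [dust_eq] at hx hy
      obtain ⟨i, x, hx', rfl⟩ := mem_iUnion.1 hx
      obtain ⟨j, y, hy', rfl⟩ := mem_iUnion.1 hy
      let U : Set (Eu d) := ⋃ k ∈ ({i}ᶜ : Set (Fin N)), T.G k '' T.dust
      have hUc : IsCompact U := (toFinite _).isCompact_biUnion fun k _ =>
        T.isCompact_dust.image (T.continuous_G k)
      have hUd : Disjoint (T.G i '' T.dust) U :=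
        disjoint_iUnion₂_right.2 fun k hk => hdisj i k (Ne.symm hk)
      have hsplit : T.dust = T.G i '' T.dust ∪ U := by
        conv_lhs => rw [dust_eq]
        refine subset_antisymm (iUnion_subset fun k => ?_) (union_subset
          (subset_iUnion (fun k => T.G k '' T.dust) i)
          (iUnion₂_subset fun k _ => subset_iUnion (fun k => T.G k '' T.dust) k))
        by_cases hk : k = i
        · exact hk ▸ subset_union_left
        · exact (subset_biUnion_of_mem (u := fun k => T.G k '' T.dust)
            (show k ∈ ({i}ᶜ : Set (Fin N)) from hk)).trans subset_union_right
      by_cases hij : i = j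
      · subst hij
        have hdist : T.α ^ n * D < dist x y := by
          have h1 := h.trans_le (T.dist_G_le i x y)
          rw [pow_succ', mul_assoc] at h1
          exact lt_of_mul_lt_mul_left h1 T.α_pos.le
        obtain ⟨A, B, hA, hB, hAB, heq, hxA, hyB⟩ := ih x y hx' hy' hdist
        have hAU : Disjoint (T.G i '' A) U :=
          hUd.mono_left (image_mono (heq ▸ subset_union_left))
        refine ⟨T.G i '' A, T.G i '' B ∪ U, hA.image (T.continuous_G i),
          (hB.image (T.continuous_G i)).union hUc,
          disjoint_union_right.2 ⟨(disjoint_image_iff (T.G_injective i)).2 hAB, hAU⟩, ?_,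
          mem_image_of_mem _ hxA, Or.inl (mem_image_of_mem _ hyB)⟩
        conv_lhs => rw [hsplit, heq]
        rw [image_union, union_assoc]
      · exact ⟨T.G i '' T.dust, U, T.isCompact_dust.image (T.continuous_G i), hUc, hUd, hsplit,
          mem_image_of_mem _ hx', mem_biUnion (show j ∈ ({i}ᶜ : Set (Fin N)) from Ne.symm hij)
            (mem_image_of_mem _ hy')⟩
  obtain ⟨n, hn⟩ := ((T.tendsto_α_pow_mul D).eventually_lt_const (dist_pos.2 hxy)).exists
  exact main n x y hx hy hn

/-- The algebra of bounded Lipschitz functions that are locally constant near the fractal part. -/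
def testAlgebra : Subalgebra ℝ C(Eu d, ℝ) where
  carrier := {f | (∃ C, LipschitzWith C f) ∧ (∃ M, ∀ x, |f x| ≤ M) ∧
    ∀ x ∈ T.dust, ∀ᶠ y in 𝓝 x, f y = f x}
  mul_mem' := by
    rintro f g ⟨⟨C, hC⟩, ⟨M, hM⟩, hf⟩ ⟨⟨C', hC'⟩, ⟨M', hM'⟩, hg⟩
    have hM0 : 0 ≤ M := (abs_nonneg _).trans (hM 0)
    have hM'0 : 0 ≤ M' := (abs_nonneg _).trans (hM' 0)
    refine ⟨⟨⟨M * C' + M' * C, by positivity⟩, LipschitzWith.of_dist_le_mul fun x y => ?_⟩,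
      ⟨M * M', fun x => ?_⟩, fun x hx => ?_⟩
    · have h1 := hC.dist_le_mul x y
      have h2 := hC'.dist_le_mul x y
      rw [Real.dist_eq] at h1 h2 ⊢
      change |f x * g x - f y * g y| ≤ (M * C' + M' * C) * dist x y
      have h3 : f x * g x - f y * g y = f x * (g x - g y) + (f x - f y) * g y := by ring
      rw [h3]
      refine (abs_add_le _ _).trans ?_
      rw [abs_mul, abs_mul]
      have h4 := mul_le_mul (hM x) h2 (abs_nonneg _) hM0
      have h5 := mul_le_mul h1 (hM' y) (abs_nonneg _) (by positivity)
      refine (add_le_add h4 h5).trans_eq ?_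
      ring
    · rw [ContinuousMap.mul_apply, abs_mul]
      exact mul_le_mul (hM x) (hM' x) (abs_nonneg _) hM0
    · filter_upwards [hf x hx, hg x hx] with y h1 h2
      rw [ContinuousMap.mul_apply, ContinuousMap.mul_apply, h1, h2]
  add_mem' := by
    rintro f g ⟨⟨C, hC⟩, ⟨M, hM⟩, hf⟩ ⟨⟨C', hC'⟩, ⟨M', hM'⟩, hg⟩
    refine ⟨⟨C + C', hC.add hC'⟩, ⟨M + M', fun x => ?_⟩, fun x hx => ?_⟩
    · exact (abs_add_le _ _).trans (add_le_add (hM x) (hM' x))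
    · filter_upwards [hf x hx, hg x hx] with y h1 h2
      rw [ContinuousMap.add_apply, ContinuousMap.add_apply, h1, h2]
  algebraMap_mem' r := by
    refine ⟨⟨0, ?_⟩, ⟨|r|, fun x => ?_⟩, fun x _ => Eventually.of_forall fun y => ?_⟩
    · exact LipschitzWith.const r
    · rfl
    · rfl

/-- If one of the points lies off the fractal part, a small tent around it works. If both lie on it,
the fractal part splits into two compact pieces at positive distance, and a truncated function of
the distance to one piece is constant near each. -/
theorem separatesPoints_testAlgebra
    (hdisj : ∀ i j : Fin N, i ≠ j → Disjoint (T.G i '' T.dust) (T.G j '' T.dust)) :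
    T.testAlgebra.SeparatesPoints := by
  have hoff : ∀ x y : Eu d, x ≠ y → x ∉ T.dust → ∃ f ∈ T.testAlgebra, f x ≠ f y := by
    intro x y hxy hx
    have hpos : 0 < Metric.infDist x T.dust :=
      (T.isCompact_dust.isClosed.notMem_iff_infDist_pos T.isAttractor_dust.1).1 hx
    -- Halving makes the tent of radius r vanish at y and in a neighbourhood of every point of the
    -- fractal part.
    set r := min (Metric.infDist x T.dust) (dist y x) / 2 with hr
    have hr0 : 0 < r := half_pos (lt_min hpos (dist_pos.2 hxy.symm))
    have hr1 : r < Metric.infDist x T.dust := by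
      have := min_le_left (Metric.infDist x T.dust) (dist y x)
      linarith
    have hr2 : r < dist y x := by
      have := min_le_right (Metric.infDist x T.dust) (dist y x)
      linarith
    have hlip : LipschitzWith (0 + 1) fun z => max 0 (r - dist z x) :=
      ((LipschitzWith.const r).sub (LipschitzWith.dist_left x)).const_max 0
    refine ⟨⟨_, hlip.continuous⟩, ⟨⟨_, hlip⟩, ⟨r, fun z => ?_⟩, fun s hs => ?_⟩, ?_⟩
    · change |max 0 (r - dist z x)| ≤ r
      rw [abs_of_nonneg (le_max_left _ _)]
      exact max_le hr0.le (by linarith [dist_nonneg (x := z) (y := x)])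
    · have h1 : r < dist s x := by
        rw [dist_comm]
        exact hr1.trans_le (Metric.infDist_le_dist_of_mem hs)
      have h2 : ∀ᶠ z in 𝓝 s, r < dist z x :=
        (continuous_id.dist continuous_const).continuousAt.eventually_const_lt h1
      filter_upwards [h2] with z hz
      change max 0 (r - dist z x) = max 0 (r - dist s x)
      rw [max_eq_left (by linarith), max_eq_left (by linarith)]
    · change max 0 (r - dist x x) ≠ max 0 (r - dist y x)
      rw [dist_self, sub_zero, max_eq_right hr0.le, max_eq_left (by linarith)]
      exact hr0.ne'
  intro x y hxy
  by_cases hx : x ∈ T.dust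
  swap
  · obtain ⟨f, hf, h⟩ := hoff x y hxy hx
    exact ⟨f, ⟨f, hf, rfl⟩, h⟩
  by_cases hy : y ∈ T.dust
  swap
  · obtain ⟨f, hf, h⟩ := hoff y x hxy.symm hy
    exact ⟨f, ⟨f, hf, rfl⟩, h.symm⟩
  obtain ⟨A, B, hA, hB, hAB, heq, hxA, hyB⟩ := T.exists_separation_dust hdisj hx hy hxy
  obtain ⟨δ, hδ, hthick⟩ := hAB.exists_thickenings hA hB.isClosed
  have hlip : LipschitzWith (0 + ‖2 / δ‖₊ * 1)
      -- This profile equals 1 up to distance δ/2 from A and 0 from distance δ on; the δ-thickening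
      -- of B is disjoint from that of A.
      fun z => max 0 (min 1 (2 - (2 / δ) • Metric.infDist z A)) :=
    (((LipschitzWith.const 2).sub ((lipschitzWith_smul (2 / δ)).comp
      (Metric.lipschitz_infDist_pt A))).const_min 1).const_max 0
  have hnearA : ∀ z, Metric.infDist z A < δ / 2 →
      max 0 (min 1 (2 - (2 / δ) • Metric.infDist z A)) = 1 := by
    intro z hz
    have : (2 / δ) * Metric.infDist z A ≤ 1 := by
      rw [div_mul_eq_mul_div, div_le_one hδ]
      linarith
    rw [smul_eq_mul, min_eq_left (by linarith), max_eq_right zero_le_one]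
  have hnearB : ∀ z ∈ Metric.thickening δ B,
      max 0 (min 1 (2 - (2 / δ) • Metric.infDist z A)) = 0 := by
    intro z hz
    have h1 : z ∉ Metric.thickening δ A := fun h => disjoint_left.1 hthick h hz
    rw [Metric.mem_thickening_iff_infDist_lt ⟨x, hxA⟩, not_lt] at h1
    have : 2 ≤ (2 / δ) * Metric.infDist z A := by
      rw [div_mul_eq_mul_div, le_div_iff₀ hδ]
      linarith
    rw [smul_eq_mul, max_eq_left]
    exact (min_le_right _ _).trans (by linarith)
  refine ⟨_, ⟨⟨_, hlip.continuous⟩, ⟨⟨_, hlip⟩, ⟨1, fun z => ?_⟩, fun s hs => ?_⟩, rfl⟩, ?_⟩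
  · change |max 0 (min 1 (2 - (2 / δ) • Metric.infDist z A))| ≤ 1
    rw [abs_of_nonneg (le_max_left _ _)]
    exact max_le zero_le_one (min_le_left _ _)
  · change ∀ᶠ z in 𝓝 s, max 0 (min 1 (2 - (2 / δ) • Metric.infDist z A)) =
      max 0 (min 1 (2 - (2 / δ) • Metric.infDist s A))
    rw [heq] at hs
    rcases hs with hs | hs
    · have h0 : Metric.infDist s A < δ / 2 := by
        rw [Metric.infDist_zero_of_mem hs]
        positivity
      filter_upwards [(Metric.continuous_infDist_pt A).continuousAt.eventually_lt_const h0]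
        with z hz
      rw [hnearA z hz, hnearA s h0]
    · filter_upwards [Metric.isOpen_thickening.mem_nhds (Metric.self_subset_thickening hδ B hs)]
        with z hz
      rw [hnearB z hz, hnearB s (Metric.self_subset_thickening hδ B hs)]
  · change max 0 (min 1 (2 - (2 / δ) • Metric.infDist x A)) ≠
      max 0 (min 1 (2 - (2 / δ) • Metric.infDist y A))
    rw [hnearA x (by rw [Metric.infDist_zero_of_mem hxA]; positivity),
      hnearB y (Metric.self_subset_thickening hδ B hyB)]
    exact one_ne_zero

/-- Test functions are constant on all sufficiently small cells. -/
theorem exists_eq_on_cells {f : C(Eu d, ℝ)} (hf : f ∈ T.testAlgebra) :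
    ∃ n₀, ∀ w : List (Fin N), n₀ ≤ w.length → ∀ x ∈ T.K, ∀ y ∈ T.K,
      f (wordMap T.G w x) = f (wordMap T.G w y) := by
  -- Each cell meets the fractal part. Once its diameter is below a Lebesgue number of the cover by
  -- open sets of constancy, it lies in one of them.
  obtain ⟨δ, hδ, hball⟩ := lebesgue_number_lemma_of_metric T.isCompact_dust
    (c := fun s : T.dust => interior {y | f y = f s}) (fun _ => isOpen_interior)
    fun s hs => mem_iUnion.2 ⟨⟨s, hs⟩, mem_interior_iff_mem_nhds.2 (hf.2.2 s hs)⟩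
  obtain ⟨s, hs⟩ := T.isAttractor_dust.1
  obtain ⟨D, hD⟩ := T.isCompact_K.isBounded.subset_ball s
  obtain ⟨n₀, hn₀⟩ := ((T.tendsto_α_pow_mul |D|).eventually_lt_const hδ).exists
  refine ⟨n₀, fun w hw => ?_⟩
  obtain ⟨s', hs'⟩ := hball _ (mapsTo_wordMap T.mapsTo_G_dust w hs)
  have hval : ∀ x ∈ T.K, f (wordMap T.G w x) = f s' := by
    intro x hx
    refine (show _ ∈ {y | f y = f s'} from interior_subset (hs' ?_))
    rw [Metric.mem_ball]
    refine (T.dist_wordMap_G_le w x s).trans_lt (lt_of_le_of_lt ?_ hn₀)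
    exact mul_le_mul (pow_le_pow_of_le_one T.α_pos.le T.α_lt_one.le hw)
      ((hD hx).le.trans (le_abs_self D)) dist_nonneg (pow_nonneg T.α_pos.le _)
  intro x hx y hy
  rw [hval x hx, hval y hy]

/-- From some level on, f is constant on every cell: the vertex terms vanish and new lines carry no
energy, so the sequence of energies is eventually constant. -/
theorem testAlgebra_subset_domain (R : T.RegularSequence) {f : C(Eu d, ℝ)}
    (hf : f ∈ T.testAlgebra) : (f : Eu d → ℝ) ∈ R.domain := by
  obtain ⟨n₀, hn₀⟩ := T.exists_eq_on_cells hf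
  obtain ⟨C, hC⟩ := hf.1
  have hline : (f : Eu d → ℝ) ∈ T.lineSpace := by
    intro w b
    obtain ⟨C', hC'⟩ := T.exists_lipschitzWith_ξ b
    exact MemH1.of_lipschitzWith (hC.comp ((T.lipschitzWith_wordMap_G w).comp hC'))
  have hQ : ∀ n ≥ n₀, ∀ w : Fin n → Fin N, T.Qfrac R.r₀ (f ∘ T.Gn w) = 0 := by
    intro n hn w
    have : ∀ x y : T.V₀, f (T.Gn w x) = f (T.Gn w y) := fun x y =>
      hn₀ (List.ofFn w) (by rwa [List.length_ofFn]) _ (T.V₀_subset_K x.2) _ (T.V₀_subset_K y.2)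
    rw [Qfrac, Finset.sum_eq_zero, mul_zero]
    refine fun x _ => Finset.sum_eq_zero fun y _ => ?_
    rw [Function.comp_apply, Function.comp_apply, this x y, sub_self]
    simp
  have hD : ∀ n ≥ n₀, ∀ w : Fin n → Fin N, R.lineEnergy (R.ρ n) (f ∘ T.Gn w) = 0 := by
    intro n hn w
    refine Finset.sum_eq_zero fun b _ => mul_eq_zero_of_right _ ?_
    rw [intervalIntegral.integral_of_le zero_le_one, integral_Ioc_eq_integral_Ioo]
    refine setIntegral_eq_zero_of_forall_eq_zero fun t ht => ?_
    have : ((f ∘ T.Gn w) ∘ T.ξ b) =ᶠ[𝓝 t] fun _ => f (T.Gn w (T.ξ b 0)) := by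
      filter_upwards [Ioo_mem_nhds ht.1 ht.2] with s hs
      exact hn₀ (List.ofFn w) (by rwa [List.length_ofFn]) _ (T.ξ_mem_K b (Ioo_subset_Icc_self hs))
        _ (T.ξ_mem_K b (left_mem_Icc.2 zero_le_one))
    rw [this.deriv_eq, deriv_const]
    simp
  refine R.mem_domain_of_le f.continuous.continuousOn hline (C := R.energyN n₀ f) fun n => ?_
  rcases le_total n n₀ with h | h
  · exact R.monotone_energyN hline h
  · induction n, h using Nat.le_induction with
    | base => exact le_rfl
    | succ n hn ih =>
      refine le_trans (le_of_eq ?_) ih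
      rw [RegularSequence.energyN, RegularSequence.energyN, Finset.sum_range_succ]
      simp only [hQ n hn, hQ (n + 1) (hn.trans n.le_succ), hD n hn]
      simp

/-- Test functions vanishing on a finite null set are dense in `L²`. -/
theorem eq_zero_of_forall_test
    (hdisj : ∀ i j : Fin N, i ≠ j → Disjoint (T.G i '' T.dust) (T.G j '' T.dust))
    {ν : Measure (Eu d)} [IsFiniteMeasure ν] (hνK : ν T.Kᶜ = 0) {Z : Set (Eu d)}
    (hZ : Z.Finite) (hZK : Z ⊆ T.K) (hνZ : ν Z = 0) (g : Lp ℝ 2 ν)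
    (hg : ∀ f ∈ T.testAlgebra, (∀ z ∈ Z, f z = 0) → ∫ x, g x * f x ∂ν = 0) : g = 0 := by
  have hgi : Integrable g ν := (Lp.memLp g).integrable one_le_two
  have hint : ∀ f : C(Eu d, ℝ), (∃ M, ∀ x, |f x| ≤ M) → Integrable (fun x => g x * f x) ν := by
    rintro f ⟨M, hM⟩
    exact hgi.mul_bdd (c := M) f.continuous.aestronglyMeasurable (Eventually.of_forall hM)
  have := hZ.to_subtype
  have := Fintype.ofFinite Z
  let Λ : T.testAlgebra →ₗ[ℝ] ℝ :=
    { toFun := fun f => ∫ x, g x * f.1 x ∂ν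
      map_add' := fun f f' => by
        rw [← integral_add (hint f.1 f.2.2.1) (hint f'.1 f'.2.2.1)]
        refine integral_congr_ae (Eventually.of_forall fun x => ?_)
        exact mul_add _ _ _
      map_smul' := fun c f => by
        rw [RingHom.id_apply, smul_eq_mul, ← integral_const_mul]
        refine integral_congr_ae (Eventually.of_forall fun x => ?_)
        exact mul_left_comm _ _ _ }
  let L : Z → T.testAlgebra →ₗ[ℝ] ℝ := fun z =>
    { toFun := fun f => f.1 z.1
      map_add' := fun _ _ => rfl
      map_smul' := fun _ _ => rfl }
  -- Integration against g vanishes on the common kernel of the evaluations at Z, hence is a linear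
  -- combination of these finitely many evaluations.
  have hspan : Λ ∈ Submodule.span ℝ (range L) := by
    refine mem_span_of_iInf_ker_le_ker fun f hf => ?_
    refine hg f.1 f.2 fun z hz => ?_
    exact (Submodule.mem_iInf _).1 hf ⟨z, hz⟩
  obtain ⟨κ, hκ⟩ := (Submodule.mem_span_range_iff_exists_fun ℝ).1 hspan
  have hΛ : ∀ f ∈ T.testAlgebra, ∫ x, g x * f x ∂ν = ∑ z, κ z * f z.1 := by
    intro f hf
    have h1 := LinearMap.congr_fun hκ ⟨f, hf⟩
    simp only [LinearMap.sum_apply, LinearMap.smul_apply, smul_eq_mul] at h1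
    exact h1.symm
  -- Both sides are continuous for uniform convergence on K, which carries ν and contains Z, so
  -- Stone–Weierstrass extends the identity to all bounded continuous functions.
  have hcont : ∀ v : C(Eu d, ℝ), (∃ M, ∀ x, |v x| ≤ M) →
      ∫ x, g x * v x ∂ν = ∑ z, κ z * v z.1 := by
    intro v hv
    set c := (∫ x, |g x| ∂ν) + ∑ z, |κ z| with hc
    have hc0 : 0 ≤ c := add_nonneg (integral_nonneg fun x => abs_nonneg _)
      (Finset.sum_nonneg fun z _ => abs_nonneg _)
    have hbound : ∀ ε > 0, |(∫ x, g x * v x ∂ν) - ∑ z, κ z * v z.1| ≤ ε * c := by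
      intro ε hε
      obtain ⟨f, hf, hfv⟩ :=
        ContinuousMap.exists_mem_subalgebra_near_continuous_of_isCompact_of_separatesPoints
          (T.separatesPoints_testAlgebra hdisj) v T.isCompact_K hε
      have h1 : |(∫ x, g x * v x ∂ν) - ∫ x, g x * f x ∂ν| ≤ ε * ∫ x, |g x| ∂ν := by
        rw [← integral_sub (hint v hv) (hint f hf.2.1), ← integral_const_mul]
        rw [← Real.norm_eq_abs]
        refine norm_integral_le_of_norm_le (hgi.abs.const_mul ε) ?_
        have hae : ∀ᵐ x ∂ν, x ∈ T.K := hνK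
        filter_upwards [hae] with x hx
        rw [← mul_sub, norm_mul, mul_comm, ← norm_neg (v x - f x), neg_sub]
        exact mul_le_mul_of_nonneg_right (hfv x hx).le (norm_nonneg _)
      have h2 : |(∑ z, κ z * f z.1) - ∑ z, κ z * v z.1| ≤ ε * ∑ z, |κ z| := by
        rw [← Finset.sum_sub_distrib, Finset.mul_sum]
        refine (Finset.abs_sum_le_sum_abs _ _).trans (Finset.sum_le_sum fun z _ => ?_)
        rw [← mul_sub, abs_mul, mul_comm]
        exact mul_le_mul_of_nonneg_right (hfv z.1 (hZK z.2)).le (abs_nonneg _)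
      rw [hΛ f hf] at h1
      have h3 := abs_sub_le (∫ x, g x * v x ∂ν) (∑ z, κ z * f z.1) (∑ z, κ z * v z.1)
      rw [hc, mul_add]
      linarith
    rw [← sub_eq_zero, ← abs_nonpos_iff]
    refine le_of_forall_pos_le_add fun ε hε => ?_
    have h1 := hbound (ε / (c + 1)) (by positivity)
    have h2 : ε / (c + 1) * c ≤ ε := by
      rw [div_mul_eq_mul_div, div_le_iff₀ (by positivity)]
      nlinarith
    linarith
  have hzero : ∀ v : BoundedContinuousFunction (Eu d) ℝ, ∫ x, g x * v x ∂ν = 0 := by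
    intro v
    let r : ℕ → ℝ := fun n => 1 / ((n : ℝ) + 1)
    have hr : ∀ n, 0 < r n := fun n => Nat.one_div_pos_of_nat
    -- Cut-offs that vanish on Z and tend to 1 off Z. They remove the point evaluations, while ν Z =
    -- 0 keeps the integral in the limit.
    let χ : ℕ → C(Eu d, ℝ) := fun n =>
      ⟨fun x => 1 - (thickenedIndicator (hr n) Z x : ℝ),
        continuous_const.sub (NNReal.continuous_coe.comp (thickenedIndicator (hr n) Z).continuous)⟩
    have hχ1 : ∀ n x, |χ n x| ≤ 1 := by
      intro n x
      have h1 : (thickenedIndicator (hr n) Z x : ℝ) ≤ 1 := by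
        exact_mod_cast thickenedIndicator_le_one (hr n) Z x
      have h0 : (0 : ℝ) ≤ thickenedIndicator (hr n) Z x := NNReal.coe_nonneg _
      change |1 - (thickenedIndicator (hr n) Z x : ℝ)| ≤ 1
      rw [abs_le]
      constructor <;> linarith
    have hint0 : ∀ n, ∫ x, g x * (v x * χ n x) ∂ν = 0 := by
      intro n
      have h1 := hcont (v.toContinuousMap * χ n) ⟨‖v‖ * 1, fun x => by
        rw [ContinuousMap.mul_apply, abs_mul]
        exact mul_le_mul (v.norm_coe_le_norm x) (hχ1 n x) (abs_nonneg _) (norm_nonneg _)⟩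
      refine h1.trans (Finset.sum_eq_zero fun z _ => ?_)
      have h2 : χ n z.1 = 0 := by
        change 1 - (thickenedIndicator (hr n) Z z.1 : ℝ) = 0
        rw [thickenedIndicator_one (hr n) Z z.2]
        simp
      rw [ContinuousMap.mul_apply, h2, mul_zero, mul_zero]
    have hlim : Tendsto (fun n => ∫ x, g x * (v x * χ n x) ∂ν) atTop
        (𝓝 (∫ x, g x * v x ∂ν)) := by
      refine tendsto_integral_of_dominated_convergence (fun x => |g x| * ‖v‖) (fun n => ?_)
        (hgi.abs.mul_const _) (fun n => Eventually.of_forall fun x => ?_) ?_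
      · exact hgi.aestronglyMeasurable.mul
          (v.continuous.mul (χ n).continuous).aestronglyMeasurable
      · rw [norm_mul, norm_mul]
        refine mul_le_mul_of_nonneg_left ?_ (norm_nonneg _)
        calc ‖v x‖ * ‖χ n x‖ ≤ ‖v‖ * 1 :=
              mul_le_mul (v.norm_coe_le_norm x) (hχ1 n x) (norm_nonneg _) (norm_nonneg _)
          _ = ‖v‖ := mul_one _
      · have hae : ∀ᵐ x ∂ν, x ∉ Z := measure_eq_zero_iff_ae_notMem.1 hνZ
        filter_upwards [hae] with x hx
        have h1 := thickenedIndicator_tendsto_indicator_closure hr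
          tendsto_one_div_add_atTop_nhds_zero_nat Z
        have h2 := tendsto_pi_nhds.1 h1 x
        rw [hZ.isClosed.closure_eq, indicator_of_notMem hx] at h2
        have h3 := ((NNReal.tendsto_coe.2 h2).const_sub 1).const_mul (v x)
        have h4 := h3.const_mul (g x)
        simp only [NNReal.coe_zero, sub_zero, mul_one] at h4
        exact h4
    simp only [hint0] at hlim
    exact (tendsto_nhds_unique hlim tendsto_const_nhds)
  refine (BoundedContinuousFunction.toLp_denseRange ℝ ν ℝ
    (ENNReal.ofNat_ne_top (n := 2))).eq_zero_of_inner_left ℝ fun v => ?_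
  rw [L2.inner_def, ← hzero v]
  refine integral_congr_ae ?_
  filter_upwards [BoundedContinuousFunction.coeFn_toLp 2 ν ℝ v] with x hx
  rw [hx]
  simp [mul_comm]

end StretchedFractal

/-! ### The operator of the energy form -/

section LpMap

variable {X : Type*} [MeasurableSpace X] {μ : Measure X}

/-- The map sending a square integrable function to its class in `L²`. -/
def toLpMap (D : Submodule ℝ (X → ℝ)) (hD : ∀ u ∈ D, MemLp u 2 μ) : D →ₗ[ℝ] Lp ℝ 2 μ where
  toFun u := (hD u.1 u.2).toLp u.1
  map_add' _ _ := rfl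
  map_smul' _ _ := rfl

theorem coeFn_toLpMap {D : Submodule ℝ (X → ℝ)} (hD : ∀ u ∈ D, MemLp u 2 μ) (u : D) :
    toLpMap D hD u =ᵐ[μ] u.1 := (hD u.1 u.2).coeFn_toLp

theorem toLpMap_eq_iff {D : Submodule ℝ (X → ℝ)} (hD : ∀ u ∈ D, MemLp u 2 μ) (u : D)
    (f : Lp ℝ 2 μ) : toLpMap D hD u = f ↔ f =ᵐ[μ] u.1 := by
  refine ⟨fun h => h ▸ coeFn_toLpMap hD u, fun h => ?_⟩
  exact Lp.ext ((coeFn_toLpMap hD u).trans h.symm)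

theorem inner_toLpMap {D : Submodule ℝ (X → ℝ)} (hD : ∀ u ∈ D, MemLp u 2 μ) (u : D)
    (g : Lp ℝ 2 μ) : inner ℝ g (toLpMap D hD u) = ∫ x, g x * u.1 x ∂μ := by
  rw [L2.inner_def]
  refine integral_congr_ae ?_
  filter_upwards [coeFn_toLpMap hD u] with x hx
  rw [hx]
  exact mul_comm _ _

theorem norm_toLpMap_sq {D : Submodule ℝ (X → ℝ)} (hD : ∀ u ∈ D, MemLp u 2 μ) (u : D) :
    ‖toLpMap D hD u‖ ^ 2 = ∫ x, u.1 x ^ 2 ∂μ := by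
  rw [← real_inner_self_eq_norm_sq, inner_toLpMap]
  refine integral_congr_ae ?_
  filter_upwards [coeFn_toLpMap hD u] with x hx
  rw [hx, sq]

theorem isFormOperator_iff {D : Submodule ℝ (X → ℝ)} (hD : ∀ u ∈ D, MemLp u 2 μ)
    {a : (X → ℝ) → (X → ℝ) → ℝ} {S : Lp ℝ 2 μ →L[ℝ] Lp ℝ 2 μ}
    (hS : ∀ f g, f = S (f + g) ↔ ∃ u : D, toLpMap D hD u = f ∧
      ∀ v : D, a u.1 v.1 = inner ℝ g (toLpMap D hD v)) (A : Lp ℝ 2 μ →ₗ.[ℝ] Lp ℝ 2 μ) :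
    IsFormOperator μ D a A ↔ IsResolventAtNegOne A S := by
  refine forall₂_congr fun f g => iff_congr Iff.rfl ?_
  simp only [hS, toLpMap_eq_iff, inner_toLpMap, Subtype.exists, Subtype.forall, exists_prop,
    SetLike.mem_coe]

end LpMap

namespace StretchedFractal

namespace RegularSequence

variable {d N : ℕ} {T : StretchedFractal d N} (R : T.RegularSequence)

theorem memLp_of_mem_domain {ν : Measure (Eu d)} [IsFiniteMeasure ν] (hνK : ν T.Kᶜ = 0)
    {u : Eu d → ℝ} (hu : u ∈ R.domain) : MemLp u 2 ν := by
  have hae : ∀ᵐ x ∂ν, x ∈ T.K := hνK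
  obtain ⟨M, hM⟩ := T.isCompact_K.exists_bound_of_continuousOn hu.1
  refine MemLp.of_bound ?_ M (hae.mono hM)
  have h := hu.1.aestronglyMeasurable (μ := ν) T.isCompact_K.measurableSet
  rwa [Measure.restrict_eq_self_of_ae_mem hae] at h

/-- Since the form norm dominates the sup norm on K, Cauchy sequences are uniformly Cauchy and
closedness follows from `exists_limit`. Density comes from the test functions, and compactness from
evaluations at a finite sample. -/
theorem exists_resolvent_energy
    (hdisj : ∀ i j : Fin N, i ≠ j → Disjoint (T.G i '' T.dust) (T.G j '' T.dust))
    {ν : Measure (Eu d)} [IsFiniteMeasure ν] (hνK : ν T.Kᶜ = 0) {Z : Set (Eu d)}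
    (hZ : Z.Finite) (hZK : Z ⊆ T.K) (hνZ : ν Z = 0)
    (hsup : ∃ C, 0 ≤ C ∧ ∀ u ∈ R.domainVanishing Z, ∀ x ∈ T.K,
      |u x| ≤ C * √(R.energy u + ∫ y, u y ^ 2 ∂ν)) :
    ∃ S : Lp ℝ 2 ν →L[ℝ] Lp ℝ 2 ν, (∀ x y, inner ℝ (S x) y = inner ℝ x (S y)) ∧
      (∀ h, S h = 0 → h = 0) ∧ (∀ h, ‖S h‖ ^ 2 ≤ inner ℝ (S h) h) ∧ IsCompactOperator S ∧
      ∀ A, IsFormOperator ν (R.domainVanishing Z : Set (Eu d → ℝ)) R.form A ↔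
        IsResolventAtNegOne A S := by
  have hae : ∀ᵐ x ∂ν, x ∈ T.K := hνK
  have hD : ∀ u ∈ R.domainVanishing Z, MemLp u 2 ν := fun u hu =>
    R.memLp_of_mem_domain hνK hu.1
  obtain ⟨B, hBsymm, hBE, hBform⟩ := R.exists_bilin Z
  set j := toLpMap (R.domainVanishing Z) hD
  obtain ⟨C, hC0, hC⟩ := hsup
  replace hC : ∀ u : R.domainVanishing Z, ∀ x ∈ T.K, |u.1 x| ≤ C * √(B u u + ‖j u‖ ^ 2) := by
    intro u x hx
    rw [hBE, norm_toLpMap_sq]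
    exact hC u.1 u.2 x hx
  have hB0 : ∀ u, 0 ≤ B u u := fun u => hBE u ▸ R.energy_nonneg u.2.1
  -- m is the square root of the total mass, which bounds the L² norm by the sup norm.
  set m : ℝ := measureUnivNNReal ν ^ (2 : ℝ≥0∞).toReal⁻¹ with hm
  have hm0 : 0 ≤ m := by positivity
  have hjle : ∀ (u : R.domainVanishing Z) (c : ℝ), 0 ≤ c → (∀ x ∈ T.K, |u.1 x| ≤ c) →
      ‖j u‖ ≤ m * c := by
    intro u c hc hu
    refine Lp.norm_le_of_ae_bound hc ?_
    filter_upwards [coeFn_toLpMap hD u, hae] with x hx hxK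
    rw [hx]
    exact hu x hxK
  have hres := exists_resolvent B j hBsymm hB0
  refine Exists.imp (fun S ⟨h1, h2, h3, h4, h5⟩ => ?_) (hres ?_ ?_ ?_)
  rotate_left 3
  · refine ⟨h1, h2, h3, h4, fun A => isFormOperator_iff hD (fun f g => ?_) A⟩
    simp only [h5, hBform]
    rfl
  · intro s hs
    have hunif : ∀ ε > 0, ∃ n₀, ∀ k ≥ n₀, ∀ n ≥ n₀, ∀ x ∈ T.K,
        |(s k).1 x - (s n).1 x| ≤ ε := by
      intro ε hε
      obtain ⟨n₀, hn₀⟩ := hs ((ε / (C + 1)) ^ 2) (by positivity)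
      refine ⟨n₀, fun k hk n hn x hx => (hC (s k - s n) x hx).trans ?_⟩
      have h6 : √(B (s k - s n) (s k - s n) + ‖j (s k - s n)‖ ^ 2) ≤ ε / (C + 1) :=
        Real.sqrt_le_iff.2 ⟨by positivity, (hn₀ k hk n hn).le⟩
      calc _ ≤ (C + 1) * (ε / (C + 1)) :=
            mul_le_mul (by linarith) h6 (Real.sqrt_nonneg _) (by positivity)
        _ = ε := mul_div_cancel₀ _ (by positivity)
    have hE : ∀ ε > 0, ∃ n₀, ∀ k ≥ n₀, ∀ n ≥ n₀, R.energy (s k - s n).1 ≤ ε := by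
      intro ε hε
      obtain ⟨n₀, hn₀⟩ := hs ε hε
      refine ⟨n₀, fun k hk n hn => ?_⟩
      have h6 := hn₀ k hk n hn
      rw [hBE] at h6
      have h7 := sq_nonneg ‖j (s k - s n)‖
      linarith
    obtain ⟨u, hu⟩ := R.exists_limit hZK s hunif hE
    refine ⟨u, ?_⟩
    have hle : ∀ ε > 0, ε ≤ 1 → ∃ n₀, ∀ n ≥ n₀,
        B (s n - u) (s n - u) + ‖j (s n - u)‖ ^ 2 ≤ (1 + m ^ 2) * ε := by
      intro ε hε hε1
      obtain ⟨n₀, hn₀⟩ := hu ε hε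
      refine ⟨n₀, fun n hn => ?_⟩
      obtain ⟨hE, hx⟩ := hn₀ n hn
      have hj := hjle (s n - u) ε hε.le hx
      have hj2 : ‖j (s n - u)‖ ^ 2 ≤ (m * ε) ^ 2 := pow_le_pow_left₀ (norm_nonneg _) hj 2
      have hε2 : m ^ 2 * ε ^ 2 ≤ m ^ 2 * ε :=
        mul_le_mul_of_nonneg_left (by nlinarith) (sq_nonneg m)
      rw [hBE]
      rw [mul_pow] at hj2
      linarith
    rw [Metric.tendsto_atTop]
    intro ε hε
    obtain ⟨n₀, hn₀⟩ := hle (min 1 (ε / 2 / (1 + m ^ 2))) (by positivity) (min_le_left _ _)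
    refine ⟨n₀, fun n hn => ?_⟩
    rw [Real.dist_eq, sub_zero, abs_of_nonneg (add_nonneg (hB0 _) (sq_nonneg _))]
    refine (hn₀ n hn).trans_lt ?_
    calc (1 + m ^ 2) * min 1 (ε / 2 / (1 + m ^ 2)) ≤ (1 + m ^ 2) * (ε / 2 / (1 + m ^ 2)) :=
          mul_le_mul_of_nonneg_left (min_le_right _ _) (by positivity)
      _ = ε / 2 := mul_div_cancel₀ _ (by positivity)
      _ < ε := half_lt_self hε
  · intro g hg
    refine T.eq_zero_of_forall_test hdisj hνK hZ hZK hνZ g fun f hf hfZ => ?_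
    rw [← hg ⟨f, T.testAlgebra_subset_domain R hf, hfZ⟩]
    exact (inner_toLpMap hD ⟨f, T.testAlgebra_subset_domain R hf, hfZ⟩ g).symm
  · intro ε hε
    -- Dividing by m + 1 absorbs the factor m of the passage from the sup norm to L², also when m =
    -- 0.
    obtain ⟨P, hP, hPK, hsample⟩ := R.exists_finite_sample (ε := ε / (m + 1)) (by positivity)
    have := hP.to_subtype
    refine ⟨P, Fintype.ofFinite P, fun p =>
      (LinearMap.proj p.1 : (Eu d → ℝ) →ₗ[ℝ] ℝ) ∘ₗ (R.domainVanishing Z).subtype, C, m,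
      fun p u => hC u p.1 (hPK p.2), fun u => ?_⟩
    set σ := √(B u u + ‖j u‖ ^ 2)
    have hσ : 0 ≤ σ := Real.sqrt_nonneg _
    have hEσ : √(R.energy u.1) ≤ σ := by
      refine Real.sqrt_le_sqrt ?_
      rw [← hBE]
      have := sq_nonneg ‖j u‖
      linarith
    let _ := Fintype.ofFinite P
    have hsum : 0 ≤ ∑ p : P, |u.1 p.1| := Finset.sum_nonneg fun p _ => abs_nonneg _
    have h6 := hjle u (ε / (m + 1) * σ + ∑ p : P, |u.1 p.1|) (by positivity) fun x hx => by
      obtain ⟨p, hp, hxp⟩ := hsample x hx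
      have h7 := hxp u.1 u.2.1
      have h8 : |u.1 p| ≤ ∑ p : P, |u.1 p.1| :=
        Finset.single_le_sum (f := fun p : P => |u.1 p.1|) (fun p _ => abs_nonneg _)
          (Finset.mem_univ (⟨p, hp⟩ : P))
      have h9 : ε / (m + 1) * √(R.energy u.1) ≤ ε / (m + 1) * σ :=
        mul_le_mul_of_nonneg_left hEσ (by positivity)
      have h10 := abs_add_le (u.1 x - u.1 p) (u.1 p)
      rw [sub_add_cancel] at h10
      linarith
    rw [mul_add] at h6
    refine h6.trans (add_le_add_left ?_ _)
    rw [← mul_assoc]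
    refine mul_le_mul_of_nonneg_right ?_ hσ
    rw [mul_div_assoc', div_le_iff₀ (by positivity)]
    nlinarith

/-- The operator of the energy form on functions vanishing on a finite null set exists, is unique
and self-adjoint, and has discrete nonnegative spectrum. -/
theorem formOperator_energy
    (hdisj : ∀ i j : Fin N, i ≠ j → Disjoint (T.G i '' T.dust) (T.G j '' T.dust))
    {ν : Measure (Eu d)} [IsFiniteMeasure ν] (hνK : ν T.Kᶜ = 0) {Z : Set (Eu d)}
    (hZ : Z.Finite) (hZK : Z ⊆ T.K) (hνZ : ν Z = 0)
    (hsup : ∃ C, 0 ≤ C ∧ ∀ u ∈ R.domainVanishing Z, ∀ x ∈ T.K,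
      |u x| ≤ C * √(R.energy u + ∫ y, u y ^ 2 ∂ν)) :
    (∃! A, IsFormOperator ν (R.domainVanishing Z : Set (Eu d → ℝ)) R.form A) ∧
      ∀ A, IsFormOperator ν (R.domainVanishing Z : Set (Eu d → ℝ)) R.form A →
        IsSelfAdjoint A ∧ HasDiscreteSpectrum A ∧ opSpectrum A ⊆ Ici 0 := by
  obtain ⟨S, hsymm, hinj, hpos, hcomp, hiff⟩ :=
    R.exists_resolvent_energy hdisj hνK hZ hZK hνZ hsup
  simp only [hiff]
  refine ⟨?_, fun A hA => ⟨hA.isSelfAdjoint hsymm hinj, ⟨fun z hz =>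
    ⟨hA.opEigenspace_ne_bot hcomp hz, hA.finiteDimensional_opEigenspace hcomp hz⟩,
    hA.not_accPt hcomp hsymm hpos⟩, fun z hz => hA.nonneg_of_mem_opSpectrum hcomp hpos hz⟩⟩
  obtain ⟨A, hA⟩ := exists_isResolventAtNegOne S hinj
  refine ⟨A, hA, fun A' hA' => LinearPMap.eq_of_eq_graph ?_⟩
  ext ⟨f, g⟩
  rw [hA, hA' f g]

/-- Average u(x)² ≤ 2 (u(x) - u(y))² + 2 u(y)² over y: the oscillation bound controls the first term
by the energy, and positive mass allows division by ν(K). -/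
theorem exists_sup_bound {ν : Measure (Eu d)} [IsFiniteMeasure ν] (hνK : ν T.Kᶜ = 0)
    (hν : ν univ ≠ 0) : ∃ C, 0 ≤ C ∧ ∀ u ∈ R.domain, ∀ x ∈ T.K,
      |u x| ≤ C * √(R.energy u + ∫ y, u y ^ 2 ∂ν) := by
  obtain ⟨C, hC0, hC⟩ := R.exists_osc_K_bound
  have hae : ∀ᵐ x ∂ν, x ∈ T.K := hνK
  set θ := ν.real univ with hθ
  have hθ0 : 0 < θ := ENNReal.toReal_pos hν (measure_ne_top _ _)
  refine ⟨√(2 * C ^ 2 + 2 / θ), Real.sqrt_nonneg _, fun u hu x hx => ?_⟩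
  have hE := R.energy_nonneg hu
  have hI : 0 ≤ ∫ y, u y ^ 2 ∂ν := integral_nonneg fun y => sq_nonneg _
  have hint : Integrable (fun y => u y ^ 2) ν := (R.memLp_of_mem_domain hνK hu).integrable_sq
  have hpt : ∀ y ∈ T.K, u x ^ 2 ≤ 2 * C ^ 2 * R.energy u + 2 * u y ^ 2 := by
    intro y hy
    have h1 := pow_le_pow_left₀ (abs_nonneg _) (hC u hu x hx y hy) 2
    rw [sq_abs, mul_pow, Real.sq_sqrt hE] at h1
    nlinarith [sq_nonneg (u x - 2 * u y)]
  have havg : u x ^ 2 * θ ≤ 2 * C ^ 2 * R.energy u * θ + 2 * ∫ y, u y ^ 2 ∂ν := by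
    have h1 := integral_mono_ae (μ := ν) (integrable_const (u x ^ 2))
      ((integrable_const (2 * C ^ 2 * R.energy u)).add (hint.const_mul 2)) (hae.mono hpt)
    simp only [Pi.add_apply] at h1
    rw [integral_add (integrable_const _) (hint.const_mul 2), integral_const_mul 2, integral_const,
      integral_const, smul_eq_mul, smul_eq_mul, ← hθ, mul_comm θ, mul_comm θ] at h1
    exact h1
  rw [← Real.sqrt_mul (by positivity)]
  refine Real.abs_le_sqrt ?_
  rw [← mul_le_mul_iff_left₀ hθ0]
  have h2 : 2 / θ * θ = 2 := div_mul_cancel₀ _ hθ0.ne'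
  have h3 : (2 * C ^ 2 + 2 / θ) * (R.energy u + ∫ y, u y ^ 2 ∂ν) * θ =
      2 * C ^ 2 * R.energy u * θ + 2 * (∫ y, u y ^ 2 ∂ν) +
        (2 * C ^ 2 * θ * (∫ y, u y ^ 2 ∂ν) + 2 * R.energy u) := by
    linear_combination (R.energy u + ∫ y, u y ^ 2 ∂ν) * h2
  rw [h3]
  have h4 : 0 ≤ 2 * C ^ 2 * θ * (∫ y, u y ^ 2 ∂ν) + 2 * R.energy u := by positivity
  linarith

/-- Comparison with a zero of u in Z: the energy alone dominates the sup norm, so the measure may be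
arbitrary. -/
theorem exists_sup_bound_of_vanishing {Z : Set (Eu d)} (hZK : Z ⊆ T.K) (hZ : Z.Nonempty)
    (ν : Measure (Eu d)) : ∃ C, 0 ≤ C ∧ ∀ u ∈ R.domainVanishing Z, ∀ x ∈ T.K,
      |u x| ≤ C * √(R.energy u + ∫ y, u y ^ 2 ∂ν) := by
  obtain ⟨C, hC0, hC⟩ := R.exists_osc_K_bound
  obtain ⟨p, hp⟩ := hZ
  refine ⟨C, hC0, fun u hu x hx => ?_⟩
  have h1 := hC u hu.1 x hx p (hZK hp)
  rw [hu.2 p hp, sub_zero] at h1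
  refine h1.trans (mul_le_mul_of_nonneg_left (Real.sqrt_le_sqrt ?_) hC0)
  exact le_add_of_nonneg_right (integral_nonneg fun y => sq_nonneg _)

end RegularSequence

end StretchedFractal

end Stretched

end

/-! ### The Neumann and Dirichlet Laplacians -/

open MeasureTheory Stretched in
theorem lemma5p3 {d N : ℕ} (T : StretchedFractal d N)
    (hdisj : ∀ i j : Fin N, i ≠ j → Disjoint (T.G i '' T.dust) (T.G j '' T.dust))
    (R : T.RegularSequence)
    (a : T.Branch → ℝ) (ha : ∀ b, 0 < a b)
    (β : ℝ) (hβ : 0 < β) (hβN : β < 1 / N) (hsum : ∑ b, a b = 1 - β * N)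
    (η : ℝ) (hη : 0 < η) (hη1 : η ≤ 1) :
    -- the Neumann Laplacian
    ((∃! A, IsFormOperator (T.μη a β η) R.domain R.form A) ∧
      ∀ A, IsFormOperator (T.μη a β η) R.domain R.form A →
        IsSelfAdjoint A ∧ HasDiscreteSpectrum A ∧ opSpectrum A ⊆ Set.Ici 0) ∧
    -- the Dirichlet Laplacian
    ((∃! A, IsFormOperator ((T.μη a β η).restrict T.V₀ᶜ) R.domain₀ R.form A) ∧
      ∀ A, IsFormOperator ((T.μη a β η).restrict T.V₀ᶜ) R.domain₀ R.form A →
        IsSelfAdjoint A ∧ HasDiscreteSpectrum A ∧ opSpectrum A ⊆ Set.Ici 0) := by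
  have := T.isFiniteMeasure_μη a hβ hβN η
  constructor
  -- Neumann case, Z = ∅: constants have no energy, so the sup bound needs the positive mass of the
  -- measure, supplied by the line part through η > 0.
  · have h := R.formOperator_energy hdisj (T.μη_compl_K a β η) finite_empty (empty_subset _)
      measure_empty (by
        obtain ⟨C, hC0, hC⟩ := R.exists_sup_bound (T.μη_compl_K a β η)
          (T.μη_univ_ne_zero a ha β hη)
        exact ⟨C, hC0, fun u hu => hC u hu.1⟩)
    rwa [R.domainVanishing_empty] at h
  -- Dirichlet case, Z = V₀: it is null because the measure is restricted to its complement.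
  · have hV : T.V₀.Finite := toFinite _
    refine R.formOperator_energy hdisj ?_ hV T.V₀_subset_K ?_
      (R.exists_sup_bound_of_vanishing T.V₀_subset_K T.V₀_nonempty _)
    · exact le_antisymm ((Measure.restrict_apply_le _ _).trans_eq (T.μη_compl_K a β η)) zero_le
    · rw [Measure.restrict_apply hV.measurableSet, inter_compl_self, measure_empty]
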